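/- Let $\Omega\subset\mathbb R^2$ be a bounded domain with smooth boundary, let $a_1,a_2,b_1,b_2>0$ and $\theta_1,\theta_2>1$, and put $\theta_{\max}=\max\{\theta_1,\theta_2\}$. Write $\|w\|=\big(\int_\Omega|\nabla w|^2dx\big)^{1/2}$ for $w\in H^1_0(\Omega)$, let $|\cdot|$ be the Euclidean norm, $W=(u,v)\in\mathbb R^2$, and let $\nabla H=(H_u,H_v)$ denote the gradient of $H$ in $W$. Let $H:\Omega\times\mathbb R^2\to\mathbb R$ be such that $H(x,\cdot)\in C^1(\mathbb R^2)$ for every $x\in\Omega$, such that $H$ and $\nabla H$ are continuous on $\Omega\times\mathbb R^2$, and such that $\nabla H$ is bounded on $\Omega\times\{|W|\le R\}$ for every $R>0$. Assume: - (critical growth) there is $\beta_0>0$ such that, as $|W|\to\infty$ and uniformly in $x\in\Omega$, $\dfrac{|\nabla H(x,W)|}{\exp(\beta|W|^2)}\to 0$ for every $\beta>\beta_0$ and $\dfrac{|\nabla H(x,W)|}{\exp(\beta|W|^2)}\to\infty$ for every $\beta<\beta_0$; - ($H_1$) $H(x,W)\ge 0$, $uH_u(x,W)\ge0$ and $vH_v(x,W)\ge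 0$ for all $x\in\Omega$ and $W=(u,v)\in\mathbb R^2$; - ($H_2$) there are $S_0,M_0>0$ with $0<H(x,W)\le M_0|\nabla H(x,W)|$ for all $x\in\Omega$ and $|W|\ge S_0$; - ($SL$) $H(x,W)/|W|^2\to0$ as $|W|\to0$, uniformly in $x\in\Omega$; - ($H_3$) $0<2\theta_{\max}H(x,W)\le W\cdot\nabla H(x,W)$ for all $x\in\Omega$ and $W\in\mathbb R^2\setminus\{(0,0)\}$. Then there is $\lambda_*>0$ such that for every $\lambda\ge\lambda_*$ the system $$ \begin{cases} -\big(a_1+b_1\|u\|^{2(\theta_1-1)}\big)\Delta u=\lambda H_u(x,u,v)&\text{in }\Omega,\\ -\big(a_2+b_2\|v\|^{2(\theta_2-1)}\big)\Delta v=\lambda H_v(x,u,v)&\text{in }\Omega,\\ u=v=0&\text{on }\partial\Omega \end{cases} $$ has a weak solution $W=(u,v)\in H^1_0(\Omega)\times H^1_0(\Omega)$, $W\neq(0,0)$, with positive energy. That is, for all $\Phi=(\varphi,\psi)\in H^1_0(\Omega)\times H^1_0(\Omega)$ the function $\Phi\cdot\nabla H(x,W)$ is integrable on $\Omega$ and $$\big(a_1+b_1\|u\|^{2(\theta_1-1)}\big)\int_\Omega\nabla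 u\cdot\nabla\varphi\,dx+\big(a_2+b_2\|v\|^{2(\theta_2-1)}\big)\int_\Omega\nabla v\cdot\nabla\psi\,dx=\lambda\int_\Omega\Phi\cdot\nabla H(x,W)\,dx ,$$ and $H(x,W)$ is integrable on $\Omega$ with $$\frac12\Big(a_1\|u\|^2+\frac{b_1}{\theta_1}\|u\|^{2\theta_1}\Big)+\frac12\Big(a_2\|v\|^2+\frac{b_2}{\theta_2}\|v\|^{2\theta_2}\Big)-\lambda\int_\Omega H(x,W)\,dx>0 .$$ -/

import Mathlib

open MeasureTheory Set
open scoped ContDiff Gradient RealInnerProductSpace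

noncomputable section

namespace KirchhoffSystem

/-- The Euclidean plane, used both for the space variable `x` and for the values `W = (u, v)`. -/
abbrev Plane : Type := EuclideanSpace ℝ (Fin 2)

/-- The vector `(s, t)` of the Euclidean plane. -/
def vec (s t : ℝ) : Plane := !₂[s, t]

/-- A bounded domain (nonempty, open, connected) with smooth boundary: near each boundary point,
`Ω` is the set where a smooth function with nonvanishing differential is negative. -/
structure IsSmoothBoundedDomain (Ω : Set Plane) : Prop where
  isOpen : IsOpen Ω
  isConnected : IsConnected Ω
  isBounded : Bornology.IsBounded Ω
  smooth_boundary : ∀ p ∈ frontier Ω, ∃ (U : Set Plane) (g : Plane → ℝ),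
    IsOpen U ∧ p ∈ U ∧ ContDiff ℝ ∞ g ∧ (∀ x ∈ U, fderiv ℝ g x ≠ 0) ∧
      Ω ∩ U = {x ∈ U | g x < 0}

/-! ### The Sobolev space with zero boundary values -/

/-- Smooth functions with compact support in `Ω`. -/
structure IsTestFunction (Ω : Set Plane) (φ : Plane → ℝ) : Prop where
  smooth : ContDiff ℝ ∞ φ
  hasCompactSupport : HasCompactSupport φ
  tsupport_subset : tsupport φ ⊆ Ω

/-- The Hilbert space `L²(Ω) × L²(Ω, ℝ²)`, in which `H¹` lives through `u ↦ (u, ∇u)`. -/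
abbrev L2Pair (Ω : Set Plane) : Type :=
  WithLp 2 (Lp ℝ 2 (volume.restrict Ω) × Lp Plane 2 (volume.restrict Ω))

/-- The pairs `(φ, ∇φ)` with `φ` a test function on `Ω`. -/
def testPairs (Ω : Set Plane) : Submodule ℝ (L2Pair Ω) where
  carrier := {p | ∃ φ : Plane → ℝ, IsTestFunction Ω φ ∧
    p.fst =ᵐ[volume.restrict Ω] φ ∧ p.snd =ᵐ[volume.restrict Ω] ∇ φ}
  zero_mem' := by
    refine ⟨0, ⟨contDiff_const, HasCompactSupport.zero, by simp⟩, ?_, ?_⟩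
    · exact Lp.coeFn_zero _ _ _
    · have h : ∇ (0 : Plane → ℝ) = 0 := by
        funext x; simp [gradient]
      rw [h]
      exact Lp.coeFn_zero _ _ _
  add_mem' := by
    rintro p q ⟨φ, hφ, h1, h2⟩ ⟨ψ, hψ, h3, h4⟩
    refine ⟨φ + ψ, ⟨hφ.smooth.add hψ.smooth, hφ.hasCompactSupport.add hψ.hasCompactSupport,
      (tsupport_add φ ψ).trans (union_subset hφ.tsupport_subset hψ.tsupport_subset)⟩, ?_, ?_⟩
    · filter_upwards [Lp.coeFn_add p.fst q.fst, h1, h3] with x hx h1 h3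
      exact hx.trans (by simp [h1, h3])
    · filter_upwards [Lp.coeFn_add p.snd q.snd, h2, h4] with x hx h2 h4
      have hd : fderiv ℝ (φ + ψ) x = fderiv ℝ φ x + fderiv ℝ ψ x :=
        fderiv_add (hφ.smooth.differentiable (by simp) x)
          (hψ.smooth.differentiable (by simp) x)
      exact hx.trans (by simp [h2, h4, gradient, hd])
  smul_mem' := by
    rintro c p ⟨φ, hφ, h1, h2⟩
    refine ⟨c • φ, ⟨hφ.smooth.const_smul c,
      hφ.hasCompactSupport.mono (Function.support_const_smul_subset c φ),
      (closure_mono (Function.support_const_smul_subset c φ)).trans hφ.tsupport_subset⟩, ?_, ?_⟩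
    · filter_upwards [Lp.coeFn_smul c p.fst, h1] with x hx h1
      simp [hx, h1]
    · filter_upwards [Lp.coeFn_smul c p.snd, h2] with x hx h2
      have hd : fderiv ℝ (c • φ) x = c • fderiv ℝ φ x :=
        fderiv_const_smul (hφ.smooth.differentiable (by simp) x) c
      simp [hx, h2, gradient, hd]

/-- `H¹₀(Ω)`: the closure of the test functions for the `H¹` norm. An element is the pair
`(u, ∇u)` of a function and its weak gradient. -/
def H10 (Ω : Set Plane) : Submodule ℝ (L2Pair Ω) := (testPairs Ω).topologicalClosure

/-- The function `u` underlying an element of `H¹₀(Ω)`. -/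
def val {Ω : Set Plane} (u : H10 Ω) : Plane → ℝ := u.1.fst

/-- The weak gradient of an element of `H¹₀(Ω)`. -/
def grad {Ω : Set Plane} (u : H10 Ω) : Plane → Plane := u.1.snd

/-- `∫_Ω ∇u · ∇φ dx`. -/
def dirichlet {Ω : Set Plane} (u φ : H10 Ω) : ℝ := ∫ x in Ω, ⟪grad u x, grad φ x⟫

/-- `‖u‖ = (∫_Ω |∇u|² dx)^{1/2}`. -/
def gnorm {Ω : Set Plane} (u : H10 Ω) : ℝ := Real.sqrt (∫ x in Ω, ‖grad u x‖ ^ 2)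

/-- The values `(u(x), v(x))` of an element `W = (u, v)` of `H¹₀(Ω, ℝ²)`. -/
def pairVal {Ω : Set Plane} (W : H10 Ω × H10 Ω) (x : Plane) : Plane := vec (val W.1 x) (val W.2 x)

/-! ### Hypotheses on the potential `H(x, W)`; `∇ (H x) W = (H_u, H_v)(x, W)` -/

/-- `H` and its gradient in `W` are continuous on `Ω × ℝ²`, and the gradient is bounded, uniformly
in `x ∈ Ω`, for `W` in bounded sets. -/
structure IsC1Potential (Ω : Set Plane) (H : Plane → Plane → ℝ) : Prop where
  contDiff : ∀ x ∈ Ω, ContDiff ℝ 1 (H x)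
  continuousOn : ContinuousOn (fun p : Plane × Plane => H p.1 p.2) (Ω ×ˢ univ)
  continuousOn_grad : ContinuousOn (fun p : Plane × Plane => ∇ (H p.1) p.2) (Ω ×ˢ univ)
  bounded_grad : ∀ R : ℝ, ∃ C : ℝ, ∀ x ∈ Ω, ∀ W : Plane, ‖W‖ ≤ R → ‖∇ (H x) W‖ ≤ C

/-- Critical growth at infinity with exponent `β₀`: as `|W| → ∞`, uniformly in `x ∈ Ω`,
`|h(x, W)| / exp(β|W|²)` tends to `0` for `β > β₀` and to `∞` for `β < β₀`. -/
def HasCriticalGrowth (Ω : Set Plane) (h : Plane → Plane → Plane) (β₀ : ℝ) : Prop :=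
  (∀ β > β₀, ∀ ε > 0, ∃ R : ℝ, ∀ x ∈ Ω, ∀ W : Plane, R ≤ ‖W‖ →
      ‖h x W‖ / Real.exp (β * ‖W‖ ^ 2) < ε) ∧
  (∀ β < β₀, ∀ K : ℝ, ∃ R : ℝ, ∀ x ∈ Ω, ∀ W : Plane, R ≤ ‖W‖ →
      K < ‖h x W‖ / Real.exp (β * ‖W‖ ^ 2))

/-- `H ≥ 0`, `u H_u ≥ 0` and `v H_v ≥ 0`. -/
def CondH1 (Ω : Set Plane) (H : Plane → Plane → ℝ) : Prop :=
  ∀ x ∈ Ω, ∀ W : Plane, 0 ≤ H x W ∧ 0 ≤ W 0 * (∇ (H x) W) 0 ∧ 0 ≤ W 1 * (∇ (H x) W) 1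

/-- `0 < H ≤ M₀ |∇H|` for `|W| ≥ S₀`. -/
def CondH2 (Ω : Set Plane) (H : Plane → Plane → ℝ) : Prop :=
  ∃ S₀ > 0, ∃ M₀ > 0, ∀ x ∈ Ω, ∀ W : Plane, S₀ ≤ ‖W‖ →
    0 < H x W ∧ H x W ≤ M₀ * ‖∇ (H x) W‖

/-- `0 < 2 θ H ≤ W · ∇H` for `W ≠ 0`. -/
def CondH3 (Ω : Set Plane) (H : Plane → Plane → ℝ) (θ : ℝ) : Prop :=
  ∀ x ∈ Ω, ∀ W : Plane, W ≠ 0 → 0 < 2 * θ * H x W ∧ 2 * θ * H x W ≤ ⟪W, ∇ (H x) W⟫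

/-- Superlinearity at `0`: `H(x, W) / |W|² → 0` as `W → 0`, uniformly in `x ∈ Ω`. -/
def CondSL (Ω : Set Plane) (H : Plane → Plane → ℝ) : Prop :=
  ∀ ε > 0, ∃ δ > 0, ∀ x ∈ Ω, ∀ W : Plane, 0 < ‖W‖ → ‖W‖ < δ → |H x W| / ‖W‖ ^ 2 < ε

/-! ### Weak solutions and energy -/

/-- `W = (u, v)` is a weak solution of `-(a₁ + b₁‖u‖^{2(θ₁-1)}) Δu = lam H_u(x, u, v)`,
`-(a₂ + b₂‖v‖^{2(θ₂-1)}) Δv = lam H_v(x, u, v)` in `Ω` with `u = v = 0` on `∂Ω`. -/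
def IsWeakSolution (Ω : Set Plane) (a₁ a₂ b₁ b₂ θ₁ θ₂ lam : ℝ) (H : Plane → Plane → ℝ)
    (W : H10 Ω × H10 Ω) : Prop :=
  ∀ Φ : H10 Ω × H10 Ω,
    IntegrableOn (fun x => ⟪pairVal Φ x, ∇ (H x) (pairVal W x)⟫) Ω ∧
    (a₁ + b₁ * gnorm W.1 ^ (2 * (θ₁ - 1))) * dirichlet W.1 Φ.1 +
        (a₂ + b₂ * gnorm W.2 ^ (2 * (θ₂ - 1))) * dirichlet W.2 Φ.2 =
      lam * ∫ x in Ω, ⟪pairVal Φ x, ∇ (H x) (pairVal W x)⟫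

/-- The energy functional of the system. -/
def energy (Ω : Set Plane) (a₁ a₂ b₁ b₂ θ₁ θ₂ lam : ℝ) (H : Plane → Plane → ℝ)
    (W : H10 Ω × H10 Ω) : ℝ :=
  1 / 2 * (a₁ * gnorm W.1 ^ 2 + b₁ / θ₁ * gnorm W.1 ^ (2 * θ₁)) +
    1 / 2 * (a₂ * gnorm W.2 ^ 2 + b₂ / θ₂ * gnorm W.2 ^ (2 * θ₂)) -
    lam * ∫ x in Ω, H x (pairVal W x)

end KirchhoffSystem

end

/-! Weak solutions are the critical points of `energy` on pairs in `H¹₀(Ω)`, and one is found at a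
mountain pass level. Exponential growth of critical type usually destroys compactness. The point
here is that a large `lam` pushes the mountain pass level below any prescribed threshold, and in a
small enough ball the nonlinearity is harmless. No sharp Trudinger constant is needed, only some
exponent `α > 0` with `∫ exp(α u²)` bounded on the unit ball (`exists_trudinger_const`).

Choose `r` so small that Trudinger bounds `∇H(x, W)` in `L²` for `‖W‖ ≤ r`
(`exists_norm_nemytskii_le`). The inequality `2ΘH ≤ W · ∇H`, with `Θ` at least both Kirchhoff
exponents, gives the Ambrosetti–Rabinowitz estimate (`mul_norm_sq_le`): almost critical sequences at
a level below `κ(1/2 - 1/(2Θ)) r²` eventually lie in that ball. By Rellich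
(`isCompactOperator_valL`) a subsequence converges in `L²`. The Kirchhoff operator is strongly
monotone and the nonlinear terms are bounded in `L²`, so this subsequence is Cauchy in `H¹₀`
(`mul_norm_sub_sq_le`) and its limit is critical.

The level is low for the following reason. Along the segment `t e`, the Kirchhoff energy is small
for `t` near `0`, while for `t` in the remaining compact interval `∫ H(x, t e)` has a positive
minimum, which a large `lam` multiplies past everything else. Superlinearity at the origin and
Trudinger give `∫ H(x, W) = o(‖W‖²)`, hence a positive barrier on a small sphere. Almost critical
points at the minimax level come from Ekeland's principle on the space of paths (`mountain_pass`).

The energy is `C¹` because `W ↦ ∇H(x, W)` is continuous into `L²`: all exponential integrals are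
locally bounded on the space (`exists_expInt_bound_nhds`), and Vitali's theorem applies. Trudinger's
inequality itself follows by truncation from `W^{1,1} ⊂ L²`. -/

noncomputable section

namespace KirchhoffSystem

open Filter Topology
open scoped ENNReal NNReal

/-! ### Ekeland's principle and the mountain pass theorem -/

section MountainPass

/-- Ekeland's variational principle. -/
theorem exists_ekeland_point {X : Type*} [MetricSpace X] [CompleteSpace X] {f : X → ℝ}
    (hf : LowerSemicontinuous f) {m : ℝ} (hm : ∀ x, m ≤ f x) {ε : ℝ} (hε : 0 < ε) (x₀ : X) :
    ∃ x, f x ≤ f x₀ ∧ ∀ y, f x ≤ f y + ε * dist x y := by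
  -- `S x` collects the points below `x` in the Ekeland order. These sets are closed and decrease
  -- along the order, so a greedy sequence of almost minimizers on them converges to a point `p`
  -- with `S p = {p}`.
  let S : X → Set X := fun x => {y | f y + ε * dist x y ≤ f x}
  have hself : ∀ x, x ∈ S x := fun x => by simp [S]
  have htrans : ∀ {x y z}, y ∈ S x → z ∈ S y → z ∈ S x := by
    intro x y z hy hz
    simp only [S, mem_ofPred_eq] at *
    nlinarith [dist_triangle x y z]
  have hclosed : ∀ x, IsClosed (S x) := by
    intro x
    have h : LowerSemicontinuous fun y => f y + ε * dist x y :=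
      hf.add (by fun_prop : Continuous fun y => ε * dist x y).lowerSemicontinuous
    exact lowerSemicontinuous_iff_isClosed_preimage.1 h (f x)
  have hstep : ∀ (n : ℕ) (x : X), ∃ y ∈ S x, ∀ z ∈ S x, f y ≤ f z + (1 / 2 : ℝ) ^ n := by
    intro n x
    have hne : (f '' S x).Nonempty := ⟨_, mem_image_of_mem f (hself x)⟩
    have hbd : BddBelow (f '' S x) := ⟨m, by rintro _ ⟨y, -, rfl⟩; exact hm y⟩
    obtain ⟨_, ⟨y, hy, rfl⟩, hlt⟩ :=
      exists_lt_of_csInf_lt hne (lt_add_of_pos_right (sInf (f '' S x))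
        (by positivity : (0 : ℝ) < (1 / 2) ^ n))
    exact ⟨y, hy, fun z hz => hlt.le.trans
      (by gcongr; exact csInf_le hbd (mem_image_of_mem f hz))⟩
  choose next hnext hmin using hstep
  let x : ℕ → X := fun n => Nat.rec x₀ next n
  have hx : ∀ n, x (n + 1) = next n (x n) := fun _ => rfl
  have hmem : ∀ n k, x (n + k) ∈ S (x n) := by
    intro n k
    induction k with
    | zero => exact hself _
    | succ k ih => exact htrans ih (by rw [← add_assoc, hx]; exact hnext _ _)
  have hanti : Antitone fun n => f (x n) := by
    intro a b hab
    obtain ⟨k, rfl⟩ := Nat.exists_eq_add_of_le hab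
    have h := hmem a k
    simp only [S, mem_ofPred_eq] at h
    have := mul_nonneg hε.le (dist_nonneg (x := x a) (y := x (a + k)))
    show f (x (a + k)) ≤ f (x a)
    linarith
  have hbd : BddBelow (range fun n => f (x n)) := ⟨m, by rintro _ ⟨n, rfl⟩; exact hm _⟩
  have hlim := tendsto_atTop_ciInf hanti hbd
  set ℓ := ⨅ n, f (x n)
  have hℓ : ∀ n, ℓ ≤ f (x n) := fun n => ciInf_le hbd n
  have hd : ∀ N n, N ≤ n → dist (x N) (x n) ≤ (f (x N) - ℓ) / ε := by
    intro N n hn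
    obtain ⟨k, rfl⟩ := Nat.exists_eq_add_of_le hn
    have h := hmem N k
    simp only [S, mem_ofPred_eq] at h
    rw [le_div_iff₀ hε]
    linarith [hℓ (N + k)]
  have hcauchy : CauchySeq x := by
    refine cauchySeq_of_le_tendsto_0 (fun N => (f (x N) - ℓ) / ε + (f (x N) - ℓ) / ε) ?_ ?_
    · intro n k N hn hk
      exact (dist_triangle_left _ _ (x N)).trans (add_le_add (hd N n hn) (hd N k hk))
    · have h1 : Tendsto (fun N => (f (x N) - ℓ) / ε) atTop (𝓝 0) := by
        simpa using (hlim.sub_const ℓ).div_const ε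
      simpa using h1.add h1
  obtain ⟨p, hp⟩ := cauchySeq_tendsto_of_complete hcauchy
  have hpS : ∀ n, p ∈ S (x n) := fun n => (hclosed (x n)).mem_of_tendsto
    ((tendsto_add_atTop_iff_nat n).2 hp) (Eventually.of_forall fun k => by
      rw [add_comm]; exact hmem n k)
  have hle : ∀ {u v}, v ∈ S u → f v ≤ f u := by
    intro u v h
    simp only [S, mem_ofPred_eq] at h
    have := mul_nonneg hε.le (dist_nonneg (x := u) (y := v))
    linarith
  refine ⟨p, hle (hpS 0), fun y => ?_⟩
  by_contra! hy
  have hyS : y ∈ S p := hy.le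
  -- A point `y` of `S p` competed in every choice of the sequence, so `f p` exceeds `f y` by at
  -- most `2⁻ⁿ` for all `n`.
  have hfy : f p ≤ f y := by
    refine ge_of_tendsto' (x := atTop) (f := fun n : ℕ => f y + (1 / 2 : ℝ) ^ n) ?_ ?_
    · simpa using (tendsto_pow_atTop_nhds_zero_of_lt_one (by norm_num : (0 : ℝ) ≤ 1 / 2)
        (by norm_num)).const_add (f y)
    · intro n
      exact (hle (hpS (n + 1))).trans (hmin n (x n) y (htrans (hpS n) hyS))
  linarith [mul_nonneg hε.le (dist_nonneg (x := p) (y := y))]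

/-- The set of continuous paths from `0` to `e`. -/
def pathSet {X : Type*} [NormedAddCommGroup X] (e : X) : Set C(unitInterval, X) :=
  {γ | γ 0 = 0 ∧ γ 1 = e}

theorem isClosed_pathSet {X : Type*} [NormedAddCommGroup X] (e : X) : IsClosed (pathSet e) :=
  (isClosed_eq (by fun_prop) continuous_const).inter (isClosed_eq (by fun_prop) continuous_const)

/-- The maximum of a function along a path. -/
def pathMax {X : Type*} [NormedAddCommGroup X] (I : X → ℝ) (γ : C(unitInterval, X)) : ℝ :=
  ⨆ t, I (γ t)

section MountainPass

variable {X : Type*} [NormedAddCommGroup X] {I : X → ℝ}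

theorem le_pathMax (hI : Continuous I) (γ : C(unitInterval, X)) (t : unitInterval) :
    I (γ t) ≤ pathMax I γ :=
  le_ciSup (isCompact_range (hI.comp γ.continuous)).bddAbove t

theorem exists_eq_pathMax (hI : Continuous I) (γ : C(unitInterval, X)) :
    ∃ t, I (γ t) = pathMax I γ := by
  obtain ⟨t, -, ht⟩ := isCompact_univ.exists_isMaxOn univ_nonempty
    (hI.comp γ.continuous).continuousOn
  exact ⟨t, le_antisymm (le_pathMax hI γ t) (ciSup_le fun s => ht (mem_univ s))⟩

/-- A supremum of continuous functions of the path. This is all the regularity that Ekeland's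
principle needs. -/
theorem lowerSemicontinuous_pathMax (hI : Continuous I) :
    LowerSemicontinuous (pathMax I) :=
  lowerSemicontinuous_ciSup (fun γ => (isCompact_range (hI.comp γ.continuous)).bddAbove)
    fun t => (hI.comp (by fun_prop : Continuous fun γ : C(unitInterval, X) => γ t)
      ).lowerSemicontinuous

variable [NormedSpace ℝ X]

/-- An almost minimal path passes through an almost critical point at its maximal level. -/
theorem exists_almost_critical_on_path {D : X → X →L[ℝ] ℝ}
    (hD : ∀ x, HasFDerivAt I (D x) x) (hDc : Continuous D) {e : X} {γ : C(unitInterval, X)}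
    (hγ : γ ∈ pathSet e) (h0 : I 0 < pathMax I γ) (he : I e < pathMax I γ) {ε : ℝ} (hε : 0 < ε)
    (hmin : ∀ η ∈ pathSet e, pathMax I γ ≤ pathMax I η + ε * dist γ η) :
    ∃ t, I (γ t) = pathMax I γ ∧ ‖D (γ t)‖ ≤ 2 * ε := by
  have hI : Continuous I := continuous_iff_continuousAt.2 fun x => (hD x).continuousAt
  by_contra! hcon
  -- Admissible deformation directions: descent at a rate above `2ε` where the path is at its
  -- maximum, and no motion at the endpoints. The sets are convex and locally share a common point,
  -- so a partition of unity selects a continuous field `v`.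
  let T : unitInterval → Set X := fun t =>
    {v | ‖v‖ ≤ 1 ∧ (I (γ t) = pathMax I γ → D (γ t) v < -(2 * ε)) ∧ ((t = 0 ∨ t = 1) → v = 0)}
  have hconv : ∀ t, Convex ℝ (T t) := by
    intro t v hv w hw a b ha hb hab
    refine ⟨?_, fun ht => ?_, fun ht => by simp [hv.2.2 ht, hw.2.2 ht]⟩
    · calc ‖a • v + b • w‖ ≤ a * ‖v‖ + b * ‖w‖ := by
            refine (norm_add_le _ _).trans ?_
            rw [norm_smul, norm_smul, Real.norm_of_nonneg ha, Real.norm_of_nonneg hb]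
        _ ≤ a * 1 + b * 1 := by gcongr; exacts [hv.1, hw.1]
        _ = 1 := by linarith
    · have h1 := hv.2.1 ht
      have h2 := hw.2.1 ht
      simp only [map_add, map_smul, smul_eq_mul]
      rcases ha.eq_or_lt with rfl | ha
      · have : b = 1 := by linarith
        simpa [this] using h2
      · nlinarith [mul_lt_mul_of_pos_left h1 ha, mul_le_mul_of_nonneg_left h2.le hb]
  have hclosedM : IsClosed {t | I (γ t) = pathMax I γ} :=
    isClosed_eq (hI.comp γ.continuous) continuous_const
  have hends : ∀ t, I (γ t) = pathMax I γ → ¬ (t = 0 ∨ t = 1) := by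
    rintro t ht (rfl | rfl)
    · rw [hγ.1] at ht; linarith
    · rw [hγ.2] at ht; linarith
  have hloc : ∀ t, ∃ v : X, ∀ᶠ s in 𝓝 t, v ∈ T s := by
    intro t
    by_cases ht : I (γ t) = pathMax I γ
    · obtain ⟨v, hv1, hv2⟩ : ∃ v : X, ‖v‖ ≤ 1 ∧ D (γ t) v < -(2 * ε) := by
        obtain ⟨v, hv, hlt⟩ := (D (γ t)).exists_lt_apply_of_lt_opNorm (hcon t ht)
        rcases lt_abs.1 (show 2 * ε < |D (γ t) v| from hlt) with h | h
        · exact ⟨-v, by rw [norm_neg]; exact hv.le, by rw [map_neg]; linarith⟩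
        · exact ⟨v, hv.le, by linarith⟩
      have hcont : Continuous fun s => D (γ s) v :=
        (hDc.comp γ.continuous).clm_apply continuous_const
      have hopen : ∀ᶠ s in 𝓝 t, ¬ (s = 0 ∨ s = 1) := by
        have : IsOpen {s : unitInterval | ¬ (s = 0 ∨ s = 1)} := by
          have : IsClosed ({0, 1} : Set unitInterval) := (Set.toFinite _).isClosed
          exact this.isOpen_compl
        exact this.mem_nhds (hends t ht)
      refine ⟨v, ?_⟩
      filter_upwards [hcont.continuousAt.eventually_lt_const hv2, hopen] with s hs1 hs2
      exact ⟨hv1, fun _ => hs1, fun h => absurd h hs2⟩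
    · refine ⟨0, ?_⟩
      filter_upwards [hclosedM.isOpen_compl.mem_nhds ht] with s hs
      exact ⟨by simp, fun h => absurd h hs, fun _ => rfl⟩
  obtain ⟨v, hv⟩ := exists_continuous_forall_mem_convex_of_local_const hconv hloc
  have hs : ∀ n : ℕ, (0 : ℝ) < 1 / (n + 1) := fun n => Nat.one_div_pos_of_nat
  -- The deformed paths are within `1/(n+1)` of `γ`, so almost minimality lets their maximum drop by
  -- at most `ε/(n+1)`. Near a limit of their maximum points, descent at rate `2ε` contradicts this.
  let η : ℕ → C(unitInterval, X) := fun n => γ + (1 / ((n : ℝ) + 1)) • v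
  have hηP : ∀ n, η n ∈ pathSet e := by
    intro n
    refine ⟨?_, ?_⟩
    · simp [η, hγ.1, (hv 0).2.2 (Or.inl rfl)]
    · simp [η, hγ.2, (hv 1).2.2 (Or.inr rfl)]
  have hηd : ∀ n, dist γ (η n) ≤ 1 / (n + 1) := by
    intro n
    rw [ContinuousMap.dist_le (hs n).le]
    intro t
    simp only [η, ContinuousMap.add_apply, ContinuousMap.smul_apply, dist_self_add_right, norm_smul]
    rw [Real.norm_of_nonneg (hs n).le]
    exact mul_le_of_le_one_right (hs n).le (hv t).1
  choose t ht using fun n => exists_eq_pathMax hI (η n)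
  have hlow : ∀ n, pathMax I γ - ε * (1 / (n + 1)) ≤ I (η n (t n)) := by
    intro n
    rw [ht n]
    have := hmin _ (hηP n)
    nlinarith [mul_le_mul_of_nonneg_left (hηd n) hε.le]
  obtain ⟨τ, -, φ, hφ, hτ⟩ := isCompact_univ.tendsto_subseq (x := t) fun n => mem_univ _
  have hs0 : Tendsto (fun n => (1 : ℝ) / ((φ n : ℝ) + 1)) atTop (𝓝 0) :=
    tendsto_one_div_add_atTop_nhds_zero_nat.comp hφ.tendsto_atTop
  have hvτ : Tendsto (fun n => v (t (φ n))) atTop (𝓝 (v τ)) := (v.continuous.tendsto τ).comp hτ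
  have hγτ : Tendsto (fun n => γ (t (φ n))) atTop (𝓝 (γ τ)) := (γ.continuous.tendsto τ).comp hτ
  have hητ : Tendsto (fun n => η (φ n) (t (φ n))) atTop (𝓝 (γ τ)) := by
    simpa [η] using hγτ.add (hs0.smul hvτ)
  have hτM : I (γ τ) = pathMax I γ := by
    refine le_antisymm (le_pathMax hI γ τ) ?_
    refine le_of_tendsto_of_tendsto' (f := fun n => pathMax I γ - ε * (1 / ((φ n : ℝ) + 1)))
      ?_ ((hI.tendsto _).comp hητ) fun n => hlow (φ n)
    simpa using (hs0.const_mul ε).const_sub (pathMax I γ)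
  have hDτ : ∀ᶠ n in atTop, D (γ τ) (v (t (φ n))) < -(2 * ε) :=
    (((D (γ τ)).continuous.tendsto _).comp hvτ).eventually_lt_const ((hv τ).2.1 hτM)
  -- Both `γ (t n)` and `η n (t n)` vary with `n`, so strict differentiability at the common limit
  -- is required. With error `ε/2` per unit length the drop is still at least `3ε/2` times the step.
  have hstrict : HasStrictFDerivAt I (D (γ τ)) (γ τ) :=
    hasStrictFDerivAt_of_hasFDerivAt_of_continuousAt (Eventually.of_forall hD) hDc.continuousAt
  have hlittle := ((hητ.prodMk_nhds hγτ).eventually (hstrict.isLittleO.def (half_pos hε)))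
  obtain ⟨n, h1, h2⟩ := (hDτ.and hlittle).exists
  set s : ℝ := 1 / ((φ n : ℝ) + 1)
  have hspos : 0 < s := hs (φ n)
  have hdiff : η (φ n) (t (φ n)) - γ (t (φ n)) = s • v (t (φ n)) := by simp [η, s]
  simp only [hdiff, map_smul, smul_eq_mul, norm_smul, Real.norm_of_nonneg hspos.le] at h2
  have h3 := (abs_le.1 h2).2
  have h4 := hlow (φ n)
  have h5 := le_pathMax hI γ (t (φ n))
  have h6 : ε / 2 * (s * ‖v (t (φ n))‖) ≤ ε / 2 * s := by
    gcongr
    exact mul_le_of_le_one_right hspos.le (hv _).1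
  have h7 : s * D (γ τ) (v (t (φ n))) < s * -(2 * ε) := mul_lt_mul_of_pos_left h1 hspos
  nlinarith [mul_pos hspos hε]

/-- The mountain pass theorem, without a compactness condition. -/
theorem mountain_pass [CompleteSpace X] {D : X → X →L[ℝ] ℝ}
    (hD : ∀ x, HasFDerivAt I (D x) x) (hDc : Continuous D) {e : X} {ρ α κ : ℝ}
    (hρ : 0 < ρ) (hρe : ρ < ‖e‖) (h0 : I 0 < α) (he : I e < α)
    (hα : ∀ x, ‖x‖ = ρ → α ≤ I x) (hκ : ∀ t ∈ Icc (0 : ℝ) 1, I (t • e) ≤ κ) :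
    ∃ c, α ≤ c ∧ c ≤ κ ∧ ∀ ε > 0, ∃ x, |I x - c| ≤ ε ∧ ‖D x‖ ≤ ε := by
  have hI : Continuous I := continuous_iff_continuousAt.2 fun x => (hD x).continuousAt
  -- Every path from `0` to `e` crosses the sphere of radius `ρ`.
  have hlow : ∀ γ ∈ pathSet e, α ≤ pathMax I γ := by
    intro γ hγ
    have hmem : ρ ∈ Icc ‖γ 0‖ ‖γ 1‖ := by
      rw [hγ.1, hγ.2]; exact ⟨by simpa using hρ.le, hρe.le⟩
    obtain ⟨t, ht⟩ := intermediate_value_univ 0 1 γ.continuous.norm hmem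
    exact (hα _ ht).trans (le_pathMax hI γ t)
  let γ₀ : C(unitInterval, X) := ⟨fun t => (t : ℝ) • e, by fun_prop⟩
  have hγ₀ : γ₀ ∈ pathSet e := ⟨by simp [γ₀], by simp [γ₀]⟩
  have : Nonempty (pathSet e) := ⟨⟨γ₀, hγ₀⟩⟩
  have hbd : BddBelow (range fun γ : pathSet e => pathMax I γ.1) :=
    ⟨α, by rintro _ ⟨γ, rfl⟩; exact hlow γ.1 γ.2⟩
  have : CompleteSpace (pathSet e) := (isClosed_pathSet e).completeSpace_coe
  refine ⟨⨅ γ : pathSet e, pathMax I γ.1, le_ciInf fun γ => hlow γ.1 γ.2,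
    (ciInf_le hbd ⟨γ₀, hγ₀⟩).trans (ciSup_le fun t => hκ t t.2), fun ε hε => ?_⟩
  obtain ⟨γ₁, hγ₁⟩ := exists_lt_of_ciInf_lt
    (lt_add_of_pos_right (⨅ γ : pathSet e, pathMax I γ.1) hε)
  have hlsc : LowerSemicontinuous fun γ : pathSet e => pathMax I γ.1 :=
    (lowerSemicontinuous_pathMax hI).comp continuous_subtype_val
  -- Slope `ε/2` for the paths becomes the bound `ε` for the derivative. The path stays below `γ₁`,
  -- so its maximum is still within `ε` of the infimum.
  obtain ⟨γ, hγle, hγmin⟩ := exists_ekeland_point hlsc (fun γ => hlow γ.1 γ.2)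
    (half_pos hε) γ₁
  have hαγ := hlow γ.1 γ.2
  obtain ⟨t, ht, hDt⟩ := exists_almost_critical_on_path hD hDc γ.2 (h0.trans_le hαγ)
    (he.trans_le hαγ) (half_pos hε) fun η hη => hγmin ⟨η, hη⟩
  refine ⟨γ.1 t, ?_, by linarith⟩
  have hc := ciInf_le hbd γ
  rw [ht, abs_of_nonneg (by linarith)]
  linarith

end MountainPass

/-- A function with a continuous Gateaux derivative is Fréchet differentiable. -/
theorem hasFDerivAt_of_hasLineDerivAt_of_continuous {X : Type*} [NormedAddCommGroup X]
    [NormedSpace ℝ X] {I : X → ℝ} {D : X → X →L[ℝ] ℝ}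
    (hD : ∀ x v, HasLineDerivAt ℝ I (D x v) x v) (hDc : Continuous D) (x : X) :
    HasFDerivAt I (D x) x := by
  rw [hasFDerivAt_iff_isLittleO, Asymptotics.isLittleO_iff]
  intro ε hε
  obtain ⟨δ, hδ, hball⟩ := Metric.continuous_iff.1 hDc x ε hε
  filter_upwards [Metric.ball_mem_nhds x hδ] with y hy
  set v := y - x
  -- The mean value inequality on the segment from `x` to `y`: subtracting the linear part leaves a
  -- derivative of size at most `ε ‖v‖`.
  have hder : ∀ s ∈ Icc (0 : ℝ) 1, HasDerivWithinAt (fun s : ℝ => I (x + s • v) - s * D x v)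
      (D (x + s • v) v - D x v) (Icc 0 1) s := by
    intro s _
    have h1 : HasDerivAt (fun s : ℝ => I (x + s • v)) (D (x + s • v) v) s := by
      have h := (hD (x + s • v) v)
      rw [HasLineDerivAt] at h
      have h2 := HasDerivAt.comp_sub_const s s (by simpa using h)
      refine h2.congr_of_eventuallyEq (Eventually.of_forall fun r => ?_)
      simp only [add_assoc, ← add_smul]
      congr 3; ring
    have h2 : HasDerivAt (fun s : ℝ => s * D x v) (D x v) s := by
      simpa using (hasDerivAt_id s).mul_const (D x v)
    exact (h1.sub h2).hasDerivWithinAt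
  have hbound : ∀ s ∈ Icc (0 : ℝ) 1, ‖D (x + s • v) v - D x v‖ ≤ ε * ‖v‖ := by
    intro s hs
    rw [← sub_apply]
    refine (ContinuousLinearMap.le_opNorm _ _).trans ?_
    gcongr
    rw [← dist_eq_norm]
    refine (hball _ ?_).le
    rw [dist_self_add_left, norm_smul, Real.norm_of_nonneg hs.1]
    have hv : ‖v‖ < δ := by rw [← dist_eq_norm]; exact hy
    nlinarith [norm_nonneg v, hs.2]
  have := Convex.norm_image_sub_le_of_norm_hasDerivWithin_le hder hbound (convex_Icc 0 1)
    (left_mem_Icc.2 zero_le_one) (right_mem_Icc.2 zero_le_one)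
  simp only [one_smul, one_mul, zero_smul, add_zero, zero_mul, sub_zero, norm_one, mul_one] at this
  have hxy : x + v = y := by simp [v]
  rw [hxy] at this
  calc ‖I y - I x - D x v‖ = ‖I y - D x v - I x‖ := by ring_nf
    _ ≤ ε * ‖v‖ := this

end MountainPass

/-! ### A Trudinger inequality for test functions -/

section Trudinger

theorem norm_gradient (φ : Plane → ℝ) (x : Plane) : ‖∇ φ x‖ = ‖fderiv ℝ φ x‖ := by
  simp [gradient]

theorem sq_lintegral_le_measure_mul {α : Type*} [MeasurableSpace α] {μ : Measure α} {f : α → ℝ≥0∞}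
    (hf : AEMeasurable f μ) : (∫⁻ x, f x ∂μ) ^ 2 ≤ μ univ * ∫⁻ x, f x ^ 2 ∂μ := by
  have h := ENNReal.lintegral_mul_le_Lp_mul_Lq μ (Real.HolderConjugate.two_two) hf
    (aemeasurable_const (b := (1 : ℝ≥0∞)))
  simp only [Pi.mul_apply, mul_one, ENNReal.one_rpow, lintegral_const, one_mul] at h
  calc (∫⁻ x, f x ∂μ) ^ 2
      ≤ ((∫⁻ x, f x ^ (2 : ℝ) ∂μ) ^ (1 / 2 : ℝ) * (μ univ) ^ (1 / 2 : ℝ)) ^ 2 := by gcongr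
    _ = μ univ * ∫⁻ x, f x ^ 2 ∂μ := by
      rw [mul_pow, ← ENNReal.rpow_natCast, ← ENNReal.rpow_natCast, ← ENNReal.rpow_mul,
        ← ENNReal.rpow_mul]
      norm_num [mul_comm]

/-- The Sobolev inequality `W^{1,1} ⊂ L²` in the plane. -/
theorem exists_sobolev_const : ∃ C : ℝ≥0, ∀ u : Plane → ℝ, ContDiff ℝ 1 u → HasCompactSupport u →
    ∫⁻ x, ‖u x‖ₑ ^ 2 ≤ C * (∫⁻ x, ‖fderiv ℝ u x‖ₑ) ^ 2 := by
  refine ⟨lintegralPowLePowLIntegralFDerivConst (volume : Measure Plane) 2, fun u hu hc => ?_⟩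
  have h := lintegral_pow_le_pow_lintegral_fderiv (volume : Measure Plane) hu hc (p := 2)
    (by simpa using Real.HolderConjugate.two_two)
  simpa only [ENNReal.rpow_two] using h

theorem deriv_smoothTransition_eq_zero {x : ℝ} (hx : x ≤ 0 ∨ 1 ≤ x) :
    deriv Real.smoothTransition x = 0 := by
  rcases hx with hx | hx
  · refine IsLocalMin.deriv_eq_zero (Eventually.of_forall fun y => ?_)
    rw [Real.smoothTransition.zero_of_nonpos hx]
    exact Real.smoothTransition.nonneg y
  · refine IsLocalMax.deriv_eq_zero (Eventually.of_forall fun y => ?_)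
    rw [Real.smoothTransition.one_of_one_le hx]
    exact Real.smoothTransition.le_one y

theorem exists_abs_deriv_smoothTransition_le :
    ∃ K : ℝ, 0 < K ∧ ∀ x, |deriv Real.smoothTransition x| ≤ K := by
  have hcont : Continuous (deriv Real.smoothTransition) :=
    (Real.smoothTransition.contDiff (n := 1)).continuous_deriv le_rfl
  obtain ⟨K, hK⟩ := (isCompact_Icc (a := (0 : ℝ)) (b := 1)).exists_bound_of_continuousOn
    hcont.continuousOn
  refine ⟨max K 1, by positivity, fun x => ?_⟩
  by_cases hx : x ∈ Icc (0 : ℝ) 1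
  · exact (hK x hx).trans (le_max_left _ _)
  · rw [deriv_smoothTransition_eq_zero]
    · simp
    · simp only [mem_Icc, not_and_or, not_le] at hx
      exact hx.imp le_of_lt le_of_lt

theorem IsTestFunction.eq_zero_of_notMem {Ω : Set Plane} {u : Plane → ℝ} (hu : IsTestFunction Ω u)
    {x : Plane} (hx : x ∉ Ω) : u x = 0 :=
  image_eq_zero_of_notMem_tsupport fun h => hx (hu.tsupport_subset h)

theorem IsTestFunction.neg {Ω : Set Plane} {u : Plane → ℝ} (hu : IsTestFunction Ω u) :
    IsTestFunction Ω (fun x => -u x) :=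
  ⟨hu.smooth.neg, hu.hasCompactSupport.neg, by
    have : tsupport (fun x => -u x) = tsupport u := tsupport_neg u
    rw [this]; exact hu.tsupport_subset⟩

/-- Truncation estimate: the measures of two superlevel sets, compared through the energy in
between. -/
theorem exists_superlevel_const : ∃ C : ℝ, 0 < C ∧ ∀ (Ω : Set Plane) (u : Plane → ℝ),
    IsTestFunction Ω u → ∀ a h : ℝ, 0 ≤ a → 0 < h →
      volume {x | x ∈ Ω ∧ a + h ≤ u x} ≤ ENNReal.ofReal (C / h ^ 2) *
        ((∫⁻ x in {x | a < u x ∧ u x < a + h}, ‖fderiv ℝ u x‖ₑ ^ 2) *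
          volume {x | x ∈ Ω ∧ a ≤ u x}) := by
  obtain ⟨C, hC⟩ := exists_sobolev_const
  obtain ⟨K, hK0, hK⟩ := exists_abs_deriv_smoothTransition_le
  refine ⟨(C + 1) * K ^ 2, by positivity, fun Ω u hu a h ha hh => ?_⟩
  -- A smooth truncation of `u` between the levels `a` and `a + h`: it is `1` on the upper
  -- superlevel set and its gradient lives in the layer. Sobolev for `g`, then Cauchy–Schwarz on the
  -- layer, gives the claim; `a ≥ 0` makes `g` vanish wherever `u` does.
  let g : Plane → ℝ := fun x => Real.smoothTransition ((u x - a) / h)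
  have hgs : ContDiff ℝ 1 g := by
    have h1 : ContDiff ℝ 1 u := hu.smooth.of_le (by simp)
    exact Real.smoothTransition.contDiff.comp ((h1.sub contDiff_const).div_const h)
  have hgc : HasCompactSupport g := by
    refine hu.hasCompactSupport.mono fun x hx => ?_
    rw [Function.mem_support] at hx ⊢
    intro h0
    refine hx (Real.smoothTransition.zero_of_nonpos ?_)
    rw [h0]
    exact div_nonpos_of_nonpos_of_nonneg (by linarith) hh.le
  set S : Set Plane := {x | a < u x ∧ u x < a + h} with hS
  have huc : Continuous u := hu.smooth.continuous
  have hSm : MeasurableSet S :=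
    ((isOpen_lt continuous_const huc).inter (isOpen_lt huc continuous_const)).measurableSet
  have hfg : ∀ x, ‖fderiv ℝ g x‖ₑ ≤
      S.indicator (fun x => ENNReal.ofReal (K / h) * ‖fderiv ℝ u x‖ₑ) x := by
    intro x
    have hud : HasFDerivAt u (fderiv ℝ u x) x :=
      (hu.smooth.differentiable (by simp) x).hasFDerivAt
    have hsd : HasDerivAt Real.smoothTransition (deriv Real.smoothTransition ((u x - a) / h))
        ((u x - a) / h) :=
      ((Real.smoothTransition.contDiff (n := 1)).differentiable (by simp) _).hasDerivAt
    have hgd : HasFDerivAt g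
        (deriv Real.smoothTransition ((u x - a) / h) • (h⁻¹ • fderiv ℝ u x)) x := by
      refine HasDerivAt.comp_hasFDerivAt (f := fun x => (u x - a) / h) x hsd ?_
      have := (hud.sub_const a).mul_const h⁻¹
      simpa [div_eq_mul_inv] using this
    rw [hgd.fderiv]
    by_cases hx : x ∈ S
    · rw [indicator_of_mem hx, smul_smul, enorm_smul]
      gcongr
      rw [Real.enorm_eq_ofReal_abs, abs_mul, abs_of_pos (inv_pos.2 hh),
        div_eq_mul_inv K]
      exact ENNReal.ofReal_le_ofReal (mul_le_mul_of_nonneg_right (hK _) (inv_pos.2 hh).le)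
    · rw [enorm_smul, deriv_smoothTransition_eq_zero]
      · rw [enorm_zero, zero_mul]; exact zero_le
      · simp only [hS, mem_ofPred_eq, not_and_or, not_lt] at hx
        refine hx.imp (fun h1 => ?_) (fun h1 => ?_)
        · exact div_nonpos_of_nonpos_of_nonneg (by linarith) hh.le
        · rw [le_div_iff₀ hh]; linarith
  have hfum : Measurable fun x => ‖fderiv ℝ u x‖ₑ :=
    (hu.smooth.continuous_fderiv (by simp)).enorm.measurable
  calc volume {x | x ∈ Ω ∧ a + h ≤ u x}
      ≤ ∫⁻ x, ‖g x‖ₑ ^ 2 := by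
        have hle : ∀ x, {x | a + h ≤ u x}.indicator 1 x ≤ ‖g x‖ₑ ^ 2 := by
          intro x
          by_cases hx : a + h ≤ u x
          · have : g x = 1 := Real.smoothTransition.one_of_one_le (by
              rw [le_div_iff₀ hh]; linarith)
            rw [this, indicator_of_mem (by exact hx)]; simp
          · rw [indicator_of_notMem (by exact hx)]; exact zero_le
        have hm : MeasurableSet {x | a + h ≤ u x} :=
          (isClosed_le continuous_const huc).measurableSet
        calc volume {x | x ∈ Ω ∧ a + h ≤ u x} ≤ volume {x | a + h ≤ u x} :=
              measure_mono fun x hx => hx.2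
          _ = ∫⁻ x, {x | a + h ≤ u x}.indicator 1 x := by rw [lintegral_indicator_one hm]
          _ ≤ _ := lintegral_mono hle
    _ ≤ C * (∫⁻ x, ‖fderiv ℝ g x‖ₑ) ^ 2 := hC g hgs hgc
    _ ≤ C * (∫⁻ x in S, ENNReal.ofReal (K / h) * ‖fderiv ℝ u x‖ₑ) ^ 2 := by
        rw [← lintegral_indicator hSm]
        gcongr
        exact hfg _
    _ = C * (ENNReal.ofReal (K / h) ^ 2 * (∫⁻ x in S, ‖fderiv ℝ u x‖ₑ) ^ 2) := by
        rw [lintegral_const_mul _ hfum, mul_pow]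
    _ ≤ C * (ENNReal.ofReal (K / h) ^ 2 * (volume S * ∫⁻ x in S, ‖fderiv ℝ u x‖ₑ ^ 2)) := by
        gcongr
        refine (sq_lintegral_le_measure_mul hfum.aemeasurable).trans ?_
        rw [Measure.restrict_apply_univ]
    _ ≤ ENNReal.ofReal ((C + 1) * K ^ 2 / h ^ 2) * ((∫⁻ x in S, ‖fderiv ℝ u x‖ₑ ^ 2) *
          volume {x | x ∈ Ω ∧ a ≤ u x}) := by
        have h1 : volume S ≤ volume {x | x ∈ Ω ∧ a ≤ u x} := by
          refine measure_mono fun x hx => ⟨?_, hx.1.le⟩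
          by_contra hxΩ
          have := hu.eq_zero_of_notMem hxΩ
          linarith [hx.1]
        have h2 : (C : ℝ≥0∞) * ENNReal.ofReal (K / h) ^ 2 ≤
            ENNReal.ofReal ((C + 1) * K ^ 2 / h ^ 2) := by
          rw [← ENNReal.ofReal_coe_nnreal, ← ENNReal.ofReal_pow (by positivity),
            ← ENNReal.ofReal_mul (by positivity)]
          refine ENNReal.ofReal_le_ofReal ?_
          rw [div_pow, mul_div_assoc]
          gcongr
          linarith
        rw [← mul_assoc, mul_comm (∫⁻ x in S, ‖fderiv ℝ u x‖ₑ ^ 2)]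
        gcongr

/-- The arithmetic–geometric mean inequality: the worst case is an energy spread evenly over the `n`
layers. -/
theorem prod_le_sum_div_pow {n : ℕ} (hn : n ≠ 0) {d : ℕ → ℝ} (hd : ∀ j, 0 ≤ d j) {L : ℝ}
    (hL : ∑ j ∈ Finset.range n, d j ≤ L) : ∏ j ∈ Finset.range n, d j ≤ (L / n) ^ n := by
  have hn' : (0 : ℝ) < n := by positivity
  have h := Real.geom_mean_le_arith_mean (Finset.range n) (fun _ => (1 : ℝ)) d
    (fun _ _ => zero_le_one) (by simpa using hn') (fun j _ => hd j)
  simp only [Real.rpow_one, Finset.sum_const, Finset.card_range, nsmul_eq_mul, mul_one, one_mul]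
    at h
  have hP : 0 ≤ ∏ j ∈ Finset.range n, d j := Finset.prod_nonneg fun j _ => hd j
  calc ∏ j ∈ Finset.range n, d j = ((∏ j ∈ Finset.range n, d j) ^ (n : ℝ)⁻¹) ^ n := by
        rw [Real.rpow_inv_natCast_pow hP hn]
    _ ≤ (L / n) ^ n := by
        refine pow_le_pow_left₀ (Real.rpow_nonneg hP _) (h.trans ?_) n
        gcongr

theorem le_pow_of_recursion {n : ℕ} (hn : n ≠ 0) {m d : ℕ → ℝ} {B L : ℝ} (hB : 0 ≤ B)
    (hm0 : 0 ≤ m 0) (hd : ∀ j, 0 ≤ d j) (hrec : ∀ j, m (j + 1) ≤ B * (d j * m j))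
    (hL : ∑ j ∈ Finset.range n, d j ≤ L) : m n ≤ (B * L / n) ^ n * m 0 := by
  have h : ∀ k, m k ≤ B ^ k * (∏ j ∈ Finset.range k, d j) * m 0 := by
    intro k
    induction k with
    | zero => simp
    | succ k ih =>
      calc m (k + 1) ≤ B * (d k * m k) := hrec k
        _ ≤ B * (d k * (B ^ k * (∏ j ∈ Finset.range k, d j) * m 0)) := by
            gcongr
            exact hd k
        _ = _ := by rw [Finset.prod_range_succ]; ring
  calc m n ≤ B ^ n * (∏ j ∈ Finset.range n, d j) * m 0 := h n
    _ ≤ B ^ n * (L / n) ^ n * m 0 := by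
        gcongr
        exact prod_le_sum_div_pow hn hd hL
    _ = _ := by rw [← mul_pow, mul_div_assoc]

/-- Gaussian decay of the measure of the superlevel sets. -/
theorem exists_superlevel_decay {Ω : Set Plane} (hΩb : Bornology.IsBounded Ω) :
    ∃ A : ℝ, 0 < A ∧ ∀ u : Plane → ℝ, IsTestFunction Ω u → ∫⁻ x, ‖fderiv ℝ u x‖ₑ ^ 2 ≤ 4 →
      ∀ n : ℕ, volume {x | x ∈ Ω ∧ A * √n ≤ u x} ≤ ENNReal.ofReal ((1 / 4) ^ n) * volume Ω := by
  obtain ⟨C, hC0, hC⟩ := exists_superlevel_const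
  have hA : (0 : ℝ) < 4 * √C := by positivity
  refine ⟨4 * √C, hA, fun u hu hL n => ?_⟩
  rcases eq_or_ne n 0 with rfl | hn
  · simpa using measure_mono fun x hx => hx.1
  have hn' : (0 : ℝ) < n := by positivity
  have hΩfin : volume Ω ≠ ⊤ := hΩb.measure_lt_top.ne
  have hfin : ∀ a : ℝ, volume {x | x ∈ Ω ∧ a ≤ u x} ≠ ⊤ := fun a =>
    measure_ne_top_of_subset (fun x hx => hx.1) hΩfin
  -- With this width, `n` layers reach the level `A √n`. The total energy of the disjoint layers is
  -- at most `4`, so after the arithmetic–geometric mean inequality each layer contributes the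
  -- factor `(C / h²) · 4 / n = 1/4`.
  set h : ℝ := 4 * √C / √n with hh
  have hhpos : 0 < h := by positivity
  let S : ℕ → Set Plane := fun j => {x | j * h < u x ∧ u x < j * h + h}
  have huc : Continuous u := hu.smooth.continuous
  have hSm : ∀ j, MeasurableSet (S j) := fun j =>
    ((isOpen_lt continuous_const huc).inter (isOpen_lt huc continuous_const)).measurableSet
  let d : ℕ → ℝ≥0∞ := fun j => ∫⁻ x in S j, ‖fderiv ℝ u x‖ₑ ^ 2
  have hdisj : ∀ i j, i < j → Disjoint (S i) (S j) := by
    intro i j hij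
    rw [Set.disjoint_left]
    rintro x ⟨-, h1⟩ ⟨h2, -⟩
    have : (i : ℝ) + 1 ≤ j := by exact_mod_cast hij
    nlinarith
  have hsum : ∀ k, ∑ j ∈ Finset.range k, d j ≤ 4 := by
    intro k
    have hpd : Set.PairwiseDisjoint (↑(Finset.range k)) S := by
      intro i _ j _ hij
      rcases lt_or_gt_of_ne hij with h | h
      · exact hdisj i j h
      · exact (hdisj j i h).symm
    rw [← lintegral_biUnion_finset hpd fun j _ => hSm j]
    exact (setLIntegral_le_lintegral _ _).trans hL
  have hdfin : ∀ j, d j ≠ ⊤ := fun j =>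
    ((setLIntegral_le_lintegral _ _).trans_lt (hL.trans_lt (by simp))).ne
  have hmain := le_pow_of_recursion hn (m := fun j => (volume {x | x ∈ Ω ∧ j * h ≤ u x}).toReal)
    (d := fun j => (d j).toReal) (B := C / h ^ 2) (L := 4) (by positivity)
    ENNReal.toReal_nonneg (fun j => ENNReal.toReal_nonneg) ?_ ?_
  · have e1 : (n : ℝ) * h = 4 * √C * √n := by
      rw [hh]; field_simp; rw [Real.sq_sqrt hn'.le]
    have e2 : C / h ^ 2 * 4 / n = 1 / 4 := by
      rw [hh, div_pow, mul_pow, Real.sq_sqrt hC0.le, Real.sq_sqrt hn'.le]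
      field_simp
    simp only [e1, e2] at hmain
    rw [← ENNReal.ofReal_toReal (hfin _)]
    refine (ENNReal.ofReal_le_ofReal hmain).trans ?_
    rw [ENNReal.ofReal_mul (by positivity), ENNReal.ofReal_toReal (hfin _)]
    gcongr
    exact fun x hx => hx.1
  · intro j
    have := ENNReal.toReal_mono ?_ (hC Ω u hu (j * h) h (by positivity) hhpos)
    · simp only [ENNReal.toReal_mul] at this
      rw [ENNReal.toReal_ofReal (by positivity)] at this
      simpa [add_mul] using this
    · exact ENNReal.mul_ne_top ENNReal.ofReal_ne_top (ENNReal.mul_ne_top (hdfin j) (hfin _))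
  · rw [← ENNReal.toReal_sum fun j _ => hdfin j]
    exact ENNReal.toReal_le_of_le_ofReal (by norm_num) (by simpa using hsum n)

/-- A discrete layer cake formula: the single term `n = ⌊s⌋` already suffices. -/
theorem two_rpow_le_tsum {s : ℝ} (hs : 0 ≤ s) :
    ENNReal.ofReal (2 ^ s) ≤ ∑' n : ℕ, (if (n : ℝ) ≤ s then (2 : ℝ≥0∞) ^ (n + 1) else 0) := by
  refine le_trans ?_ (ENNReal.le_tsum ⌊s⌋₊)
  rw [if_pos (Nat.floor_le hs)]
  calc ENNReal.ofReal (2 ^ s) ≤ ENNReal.ofReal (2 ^ (⌊s⌋₊ + 1)) := by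
        refine ENNReal.ofReal_le_ofReal ?_
        rw [← Real.rpow_natCast]
        refine Real.rpow_le_rpow_of_exponent_le (by norm_num) ?_
        push_cast
        exact (Nat.lt_floor_add_one s).le
    _ = 2 ^ (⌊s⌋₊ + 1) := by rw [ENNReal.ofReal_pow (by norm_num)]; norm_num

/-- The (non sharp) Trudinger inequality for test functions. -/
theorem exists_trudinger_const_test {Ω : Set Plane} (hΩb : Bornology.IsBounded Ω) :
    ∃ α : ℝ, 0 < α ∧ ∃ K : ℝ≥0∞, K ≠ ⊤ ∧ ∀ u : Plane → ℝ, IsTestFunction Ω u →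
      ∫⁻ x, ‖fderiv ℝ u x‖ₑ ^ 2 ≤ 4 →
        ∫⁻ x in Ω, ENNReal.ofReal (Real.exp (α * u x ^ 2)) ≤ K := by
  obtain ⟨A, hA, hdecay⟩ := exists_superlevel_decay hΩb
  -- This exponent turns `exp(α u²)` into `2 ^ (u² / A²)`. The weight `2 ^ (n + 1)` is then beaten
  -- by the decay `4⁻ⁿ` of the sets `{|u| ≥ A √n}`; the factor `2` counts `u` and `-u`.
  refine ⟨Real.log 2 / A ^ 2, by positivity,
    ∑' n : ℕ, 2 ^ (n + 1) * (2 * (ENNReal.ofReal ((1 / 4) ^ n) * volume Ω)), ?_,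
    fun u hu hL => ?_⟩
  · have h1 : ∀ n : ℕ, (2 : ℝ≥0∞) ^ (n + 1) * (2 * (ENNReal.ofReal ((1 / 4) ^ n) * volume Ω)) =
        ENNReal.ofReal ((1 / 2) ^ n) * (4 * volume Ω) := by
      intro n
      have : (2 : ℝ≥0∞) ^ n * ENNReal.ofReal ((1 / 4) ^ n) = ENNReal.ofReal ((1 / 2) ^ n) := by
        have h2 : (2 : ℝ≥0∞) ^ n = ENNReal.ofReal (2 ^ n) := by
          rw [ENNReal.ofReal_pow (by norm_num)]; norm_num
        rw [h2, ← ENNReal.ofReal_mul (by positivity), ← mul_pow]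
        norm_num
      rw [← this]; ring
    simp_rw [h1]
    rw [ENNReal.tsum_mul_right]
    refine ENNReal.mul_ne_top ?_ (ENNReal.mul_ne_top (by simp) hΩb.measure_lt_top.ne)
    exact (summable_geometric_of_lt_one (by norm_num) (by norm_num)).tsum_ofReal_ne_top
  have huc : Continuous u := hu.smooth.continuous
  have hpt : ∀ x, ENNReal.ofReal (Real.exp (Real.log 2 / A ^ 2 * u x ^ 2)) ≤
      ∑' n : ℕ, {x | A * √n ≤ |u x|}.indicator (fun _ => (2 : ℝ≥0∞) ^ (n + 1)) x := by
    intro x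
    have hs : 0 ≤ u x ^ 2 / A ^ 2 := by positivity
    have h1 : Real.exp (Real.log 2 / A ^ 2 * u x ^ 2) = 2 ^ (u x ^ 2 / A ^ 2) := by
      rw [Real.rpow_def_of_pos (by norm_num)]; congr 1; ring
    rw [h1]
    refine (two_rpow_le_tsum hs).trans (ENNReal.tsum_le_tsum fun n => ?_)
    by_cases hn : (n : ℝ) ≤ u x ^ 2 / A ^ 2
    · rw [if_pos hn, indicator_of_mem]
      rw [mem_ofPred_eq, ← Real.sqrt_sq_eq_abs, mul_comm, ← le_div_iff₀ hA]
      calc √n ≤ √(u x ^ 2 / A ^ 2) := Real.sqrt_le_sqrt hn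
        _ = √(u x ^ 2) / A := by rw [Real.sqrt_div (by positivity), Real.sqrt_sq hA.le]
    · rw [if_neg hn]; exact zero_le
  have hmeas : ∀ n : ℕ, MeasurableSet {x | A * √n ≤ |u x|} := fun n =>
    (isClosed_le continuous_const huc.abs).measurableSet
  calc ∫⁻ x in Ω, ENNReal.ofReal (Real.exp (Real.log 2 / A ^ 2 * u x ^ 2))
      ≤ ∫⁻ x in Ω, ∑' n : ℕ, {x | A * √n ≤ |u x|}.indicator (fun _ => (2 : ℝ≥0∞) ^ (n + 1)) x :=
        lintegral_mono hpt
    _ = ∑' n : ℕ, ∫⁻ x in Ω, {x | A * √n ≤ |u x|}.indicator (fun _ => (2 : ℝ≥0∞) ^ (n + 1)) x :=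
        lintegral_tsum fun n => (measurable_const.indicator (hmeas n)).aemeasurable
    _ ≤ _ := by
        refine ENNReal.tsum_le_tsum fun n => ?_
        rw [lintegral_indicator_const (hmeas n), Measure.restrict_apply (hmeas n)]
        gcongr
        have hsub : {x | A * √n ≤ |u x|} ∩ Ω ⊆
            {x | x ∈ Ω ∧ A * √n ≤ u x} ∪ {x | x ∈ Ω ∧ A * √n ≤ -u x} := by
          rintro x ⟨h1, h2⟩
          rcases le_abs.1 (show A * √n ≤ |u x| from h1) with h | h
          · exact Or.inl ⟨h2, h⟩
          · exact Or.inr ⟨h2, h⟩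
        refine (measure_mono hsub).trans ((measure_union_le _ _).trans ?_)
        rw [two_mul]
        refine add_le_add (hdecay u hu hL n) (hdecay _ hu.neg ?_ n)
        have : ∀ x, fderiv ℝ (fun x => -u x) x = -fderiv ℝ u x := fun x => fderiv_fun_neg
        simpa [this] using hL

/-- The Poincaré inequality for test functions. -/
theorem exists_poincare_const_test {Ω : Set Plane} (hΩb : Bornology.IsBounded Ω)
    (hΩm : MeasurableSet Ω) :
    ∃ C : ℝ≥0, ∀ u : Plane → ℝ, IsTestFunction Ω u →
      ∫⁻ x, ‖u x‖ₑ ^ 2 ≤ C * ∫⁻ x, ‖fderiv ℝ u x‖ₑ ^ 2 := by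
  obtain ⟨C, hC⟩ := exists_sobolev_const
  have hΩfin : volume Ω ≠ ⊤ := hΩb.measure_lt_top.ne
  refine ⟨C * (volume Ω).toNNReal, fun u hu => ?_⟩
  have hfum : Measurable fun x => ‖fderiv ℝ u x‖ₑ :=
    (hu.smooth.continuous_fderiv (by simp)).enorm.measurable
  have hsupp : Function.support (fun x => ‖fderiv ℝ u x‖ₑ) ⊆ Ω := by
    refine Subset.trans (fun x hx => ?_)
      ((tsupport_fderiv_subset ℝ (f := u)).trans hu.tsupport_subset)
    exact subset_tsupport _ fun h0 => hx (by
      show ‖fderiv ℝ u x‖ₑ = 0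
      rw [h0, enorm_eq_nnnorm, nnnorm_zero, ENNReal.coe_zero])
  calc ∫⁻ x, ‖u x‖ₑ ^ 2 ≤ C * (∫⁻ x, ‖fderiv ℝ u x‖ₑ) ^ 2 :=
        hC u (hu.smooth.of_le (by simp)) hu.hasCompactSupport
    _ = C * (∫⁻ x in Ω, ‖fderiv ℝ u x‖ₑ) ^ 2 := by
        rw [← lintegral_indicator hΩm, indicator_eq_self.2 hsupp]
    _ ≤ C * (volume Ω * ∫⁻ x in Ω, ‖fderiv ℝ u x‖ₑ ^ 2) := by
        gcongr
        refine (sq_lintegral_le_measure_mul hfum.aemeasurable).trans ?_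
        rw [Measure.restrict_apply_univ]
    _ ≤ C * (volume Ω * ∫⁻ x, ‖fderiv ℝ u x‖ₑ ^ 2) := by
        gcongr
        exact Measure.restrict_le_self
    _ = _ := by
        rw [ENNReal.coe_mul, ENNReal.coe_toNNReal hΩfin, mul_assoc]

end Trudinger

/-! ### The space `H¹₀` -/

section SobolevSpace

instance (Ω : Set Plane) : CompleteSpace (H10 Ω) :=
  (Submodule.isClosed_topologicalClosure (testPairs Ω)).completeSpace_coe

/-- The pairs of elements of `H¹₀(Ω)`. -/
abbrev Pairs (Ω : Set Plane) : Type := H10 Ω × H10 Ω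

/-- The embedding of `H¹₀(Ω)` into `L²(Ω)`. -/
def valL (Ω : Set Plane) : H10 Ω →L[ℝ] Lp ℝ 2 (volume.restrict Ω) :=
  (WithLp.fstL 2 ℝ _ _).comp (H10 Ω).subtypeL

/-- The weak gradient as a continuous linear map into `L²(Ω, ℝ²)`. -/
def gradL (Ω : Set Plane) : H10 Ω →L[ℝ] Lp Plane 2 (volume.restrict Ω) :=
  (WithLp.sndL 2 ℝ _ _).comp (H10 Ω).subtypeL

variable {Ω : Set Plane}

theorem coeFn_valL (u : H10 Ω) : (valL Ω u : Plane → ℝ) = val u := rfl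

theorem coeFn_gradL (u : H10 Ω) : (gradL Ω u : Plane → Plane) = grad u := rfl

theorem norm_sq_eq (u : H10 Ω) : ‖u‖ ^ 2 = ‖valL Ω u‖ ^ 2 + ‖gradL Ω u‖ ^ 2 :=
  WithLp.prod_norm_sq_eq_of_L2 u.1

theorem norm_gradL_le (u : H10 Ω) : ‖gradL Ω u‖ ≤ ‖u‖ :=
  (sq_le_sq₀ (norm_nonneg _) (norm_nonneg _)).1
    (by rw [norm_sq_eq]; nlinarith [sq_nonneg ‖valL Ω u‖])

theorem dirichlet_eq_inner (u φ : H10 Ω) : dirichlet u φ = ⟪gradL Ω u, gradL Ω φ⟫ := by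
  rw [L2.inner_def]; rfl

theorem gnorm_eq_norm (u : H10 Ω) : gnorm u = ‖gradL Ω u‖ := by
  rw [norm_eq_sqrt_real_inner, L2.inner_def]
  simp only [real_inner_self_eq_norm_sq]
  rfl

theorem enorm_sq_eq_lintegral {α E : Type*} [MeasurableSpace α] [NormedAddCommGroup E]
    {μ : Measure α} (f : Lp E 2 μ) : ‖f‖ₑ ^ 2 = ∫⁻ x, ‖f x‖ₑ ^ 2 ∂μ := by
  have h := eLpNorm_nnreal_pow_eq_lintegral (f := f) (μ := μ) (p := 2) (by norm_num)
  rw [Lp.enorm_def]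
  simpa using h

/-- A test function as an element of `H¹₀`. -/
theorem IsTestFunction.exists_H10 {φ : Plane → ℝ} (hφ : IsTestFunction Ω φ) :
    ∃ u : H10 Ω, val u =ᵐ[volume.restrict Ω] φ ∧ grad u =ᵐ[volume.restrict Ω] ∇ φ := by
  have h1 : MemLp φ 2 (volume.restrict Ω) :=
    (hφ.smooth.continuous.memLp_of_hasCompactSupport hφ.hasCompactSupport).restrict Ω
  have hc : Continuous (∇ φ) :=
    (InnerProductSpace.toDual ℝ Plane).symm.continuous.comp (hφ.smooth.continuous_fderiv (by simp))
  have hs : HasCompactSupport (∇ φ) := by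
    refine (hφ.hasCompactSupport.fderiv (𝕜 := ℝ)).mono fun x hx => ?_
    simp only [Function.mem_support, gradient] at hx ⊢
    intro h0
    simp [h0] at hx
  have h2 : MemLp (∇ φ) 2 (volume.restrict Ω) := (hc.memLp_of_hasCompactSupport hs).restrict Ω
  let p : L2Pair Ω := WithLp.toLp 2 (h1.toLp φ, h2.toLp (∇ φ))
  have hp : p ∈ testPairs Ω := ⟨φ, hφ, h1.coeFn_toLp, h2.coeFn_toLp⟩
  exact ⟨⟨p, Submodule.le_topologicalClosure _ hp⟩, h1.coeFn_toLp, h2.coeFn_toLp⟩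

/-- The elements of `H¹₀` given by test functions. -/
def testSet (Ω : Set Plane) : Set (H10 Ω) :=
  {u | ∃ φ : Plane → ℝ, IsTestFunction Ω φ ∧
    val u =ᵐ[volume.restrict Ω] φ ∧ grad u =ᵐ[volume.restrict Ω] ∇ φ}

theorem dense_testSet : Dense (testSet Ω) := by
  rw [Subtype.dense_iff]
  intro p hp
  refine closure_mono ?_ (show p ∈ closure (testPairs Ω : Set (L2Pair Ω)) from hp)
  intro q hq
  exact ⟨⟨q, Submodule.le_topologicalClosure _ hq⟩, hq, rfl⟩

/-- The derivative of a test function vanishes off `Ω`, so whole-plane inequalities transfer to the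
norm of `H¹₀(Ω)`. -/
theorem enorm_gradL_sq_of_test {u : H10 Ω} {φ : Plane → ℝ} (hΩm : MeasurableSet Ω)
    (hφ : IsTestFunction Ω φ) (h : grad u =ᵐ[volume.restrict Ω] ∇ φ) :
    ‖gradL Ω u‖ₑ ^ 2 = ∫⁻ x, ‖fderiv ℝ φ x‖ₑ ^ 2 := by
  have hsupp : Function.support (fun x => ‖fderiv ℝ φ x‖ₑ ^ 2) ⊆ Ω := by
    refine Subset.trans (fun x hx => ?_)
      ((tsupport_fderiv_subset ℝ (f := φ)).trans hφ.tsupport_subset)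
    refine subset_tsupport _ fun h0 => hx ?_
    show ‖fderiv ℝ φ x‖ₑ ^ 2 = 0
    rw [h0, enorm_eq_nnnorm, nnnorm_zero, ENNReal.coe_zero, zero_pow two_ne_zero]
  rw [enorm_sq_eq_lintegral, ← indicator_eq_self.2 hsupp, lintegral_indicator hΩm]
  refine lintegral_congr_ae ?_
  filter_upwards [h] with x hx
  rw [coeFn_gradL, hx, ← ofReal_norm, ← ofReal_norm, norm_gradient]

theorem enorm_valL_sq_of_test {u : H10 Ω} {φ : Plane → ℝ}
    (h : val u =ᵐ[volume.restrict Ω] φ) :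
    ‖valL Ω u‖ₑ ^ 2 = ∫⁻ x in Ω, ‖φ x‖ₑ ^ 2 := by
  rw [enorm_sq_eq_lintegral]
  refine lintegral_congr_ae ?_
  filter_upwards [h] with x hx
  rw [coeFn_valL, hx]

/-- The Poincaré inequality. -/
theorem exists_poincare_const (hΩb : Bornology.IsBounded Ω) (hΩm : MeasurableSet Ω) :
    ∃ C : ℝ, 0 < C ∧ ∀ u : H10 Ω, ‖u‖ ^ 2 ≤ C * ‖gradL Ω u‖ ^ 2 := by
  obtain ⟨C, hC⟩ := exists_poincare_const_test hΩb hΩm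
  refine ⟨C + 1, by positivity, fun u => ?_⟩
  refine dense_testSet.induction (P := fun u => ‖u‖ ^ 2 ≤ (C + 1 : ℝ) * ‖gradL Ω u‖ ^ 2) ?_
    (isClosed_le (by fun_prop) (by fun_prop)) u
  rintro u ⟨φ, hφ, h1, h2⟩
  have h3 : ‖valL Ω u‖ₑ ^ 2 ≤ C * ‖gradL Ω u‖ₑ ^ 2 := by
    rw [enorm_valL_sq_of_test h1, enorm_gradL_sq_of_test hΩm hφ h2]
    exact (setLIntegral_le_lintegral _ _).trans (hC φ hφ)
  have h4 : ‖valL Ω u‖ ^ 2 ≤ C * ‖gradL Ω u‖ ^ 2 := by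
    simp only [enorm_eq_nnnorm] at h3
    exact_mod_cast h3
  rw [norm_sq_eq]
  linarith

/-- Fatou's lemma along a sequence converging in `Lᵖ`. -/
theorem lintegral_comp_le_of_tendsto_Lp {α E : Type*} [MeasurableSpace α] [NormedAddCommGroup E]
    {μ : Measure α} {p : ℝ≥0∞} [Fact (1 ≤ p)] {f : ℕ → Lp E p μ} {g : Lp E p μ}
    (hfg : Tendsto f atTop (𝓝 g)) {G : E → ℝ≥0∞} (hG : Continuous G) {K : ℝ≥0∞}
    (hK : ∀ᶠ n in atTop, ∫⁻ x, G (f n x) ∂μ ≤ K) : ∫⁻ x, G (g x) ∂μ ≤ K := by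
  obtain ⟨ns, hns, hae⟩ := (tendstoInMeasure_of_tendsto_Lp hfg).exists_seq_tendsto_ae
  calc ∫⁻ x, G (g x) ∂μ = ∫⁻ x, liminf (fun i => G (f (ns i) x)) atTop ∂μ := by
        refine lintegral_congr_ae ?_
        filter_upwards [hae] with x hx
        exact (((hG.tendsto _).comp hx).liminf_eq).symm
    _ ≤ liminf (fun i => ∫⁻ x, G (f (ns i) x) ∂μ) atTop := by
        refine lintegral_liminf_le' fun i => ?_
        exact (hG.comp_aestronglyMeasurable (Lp.aestronglyMeasurable _)).aemeasurable
    _ ≤ K := by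
        refine liminf_le_of_le (by isBoundedDefault) fun b hb => ?_
        obtain ⟨i, h1, h2⟩ := (hb.and (hns.tendsto_atTop.eventually hK)).exists
        exact h1.trans h2

theorem exists_seq_testSet_tendsto (u : H10 Ω) :
    ∃ p : ℕ → H10 Ω, (∀ n, p n ∈ testSet Ω) ∧ Tendsto p atTop (𝓝 u) :=
  mem_closure_iff_seq_limit.1 (dense_testSet u)

/-- The (non sharp) Trudinger inequality in `H¹₀`. -/
theorem exists_trudinger_const (hΩb : Bornology.IsBounded Ω) (hΩm : MeasurableSet Ω) :
    ∃ α : ℝ, 0 < α ∧ ∃ K : ℝ≥0∞, K ≠ ⊤ ∧ ∀ u : H10 Ω, ‖u‖ ≤ 1 →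
      ∫⁻ x in Ω, ENNReal.ofReal (Real.exp (α * val u x ^ 2)) ≤ K := by
  obtain ⟨α, hα, K, hK, hT⟩ := exists_trudinger_const_test hΩb
  refine ⟨α, hα, K, hK, fun u hu => ?_⟩
  obtain ⟨p, hp, hlim⟩ := exists_seq_testSet_tendsto u
  refine lintegral_comp_le_of_tendsto_Lp (((valL Ω).continuous.tendsto u).comp hlim)
    (G := fun s => ENNReal.ofReal (Real.exp (α * s ^ 2)))
    (ENNReal.continuous_ofReal.comp (by fun_prop)) ?_
  -- Approximants may leave the unit ball but eventually have norm at most `2`; this is why the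
  -- inequality for test functions allows gradient energy `4`.
  filter_upwards [hlim.norm.eventually_le_const (hu.trans_lt one_lt_two)] with n hn
  obtain ⟨φ, hφ, h1, h2⟩ := hp n
  have h3 : ∫⁻ x, ‖fderiv ℝ φ x‖ₑ ^ 2 ≤ 4 := by
    rw [← enorm_gradL_sq_of_test hΩm hφ h2]
    have h4 : ‖gradL Ω (p n)‖ₑ ≤ 2 := by
      rw [← ofReal_norm]
      exact ENNReal.ofReal_le_of_le_toReal (by simpa using (norm_gradL_le _).trans hn)
    calc ‖gradL Ω (p n)‖ₑ ^ 2 ≤ 2 ^ 2 := by gcongr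
      _ = 4 := by norm_num
  refine le_trans (le_of_eq (lintegral_congr_ae ?_)) (hT φ hφ h3)
  filter_upwards [h1] with x hx
  show ENNReal.ofReal (Real.exp (α * val (p n) x ^ 2)) = _
  rw [hx]

/-! ### Pairs of functions -/

/-- The pair `(u, v)` as an element of `L²(Ω, ℝ²)`. -/
def toL2 (Ω : Set Plane) : Pairs Ω →L[ℝ] Lp Plane 2 (volume.restrict Ω) :=
  ((ContinuousLinearMap.compLpL 2 _ ((ContinuousLinearMap.id ℝ ℝ).smulRight (vec 1 0))).comp
      ((valL Ω).comp (ContinuousLinearMap.fst ℝ _ _))) +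
    ((ContinuousLinearMap.compLpL 2 _ ((ContinuousLinearMap.id ℝ ℝ).smulRight (vec 0 1))).comp
      ((valL Ω).comp (ContinuousLinearMap.snd ℝ _ _)))

theorem norm_vec_sq (s t : ℝ) : ‖vec s t‖ ^ 2 = s ^ 2 + t ^ 2 := by
  simp [vec, EuclideanSpace.norm_sq_eq]

theorem coeFn_toL2 (W : Pairs Ω) : toL2 Ω W =ᵐ[volume.restrict Ω] pairVal W := by
  have h1 := ContinuousLinearMap.coeFn_compLpL (p := 2) (μ := volume.restrict Ω)
    ((ContinuousLinearMap.id ℝ ℝ).smulRight (vec 1 0)) (valL Ω W.1)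
  have h2 := ContinuousLinearMap.coeFn_compLpL (p := 2) (μ := volume.restrict Ω)
    ((ContinuousLinearMap.id ℝ ℝ).smulRight (vec 0 1)) (valL Ω W.2)
  filter_upwards [h1, h2, Lp.coeFn_add
    (ContinuousLinearMap.compLpL 2 _ ((ContinuousLinearMap.id ℝ ℝ).smulRight (vec 1 0))
      (valL Ω W.1))
    (ContinuousLinearMap.compLpL 2 _ ((ContinuousLinearMap.id ℝ ℝ).smulRight (vec 0 1))
      (valL Ω W.2))] with x hx1 hx2 hx3
  refine hx3.trans ?_
  rw [Pi.add_apply, hx1, hx2, coeFn_valL, coeFn_valL]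
  ext i
  fin_cases i <;> simp [pairVal, vec]

theorem norm_pairVal_sq (W : Pairs Ω) (x : Plane) :
    ‖pairVal W x‖ ^ 2 = val W.1 x ^ 2 + val W.2 x ^ 2 := norm_vec_sq _ _

/-- The integral `∫ exp (q |W|²)`. -/
def expInt (q : ℝ) (W : Pairs Ω) : ℝ≥0∞ :=
  ∫⁻ x in Ω, ENNReal.ofReal (Real.exp (q * ‖pairVal W x‖ ^ 2))

theorem pairVal_smul (c : ℝ) (W : Pairs Ω) :
    pairVal (c • W) =ᵐ[volume.restrict Ω] fun x => c • pairVal W x := by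
  filter_upwards [coeFn_toL2 W, coeFn_toL2 (c • W), Lp.coeFn_smul c (toL2 Ω W)] with x h1 h2 h3
  rw [← h1, ← h2, (toL2 Ω).map_smul c W]
  exact h3

theorem pairVal_add (V W : Pairs Ω) :
    pairVal (V + W) =ᵐ[volume.restrict Ω] fun x => pairVal V x + pairVal W x := by
  filter_upwards [coeFn_toL2 V, coeFn_toL2 W, coeFn_toL2 (V + W),
    Lp.coeFn_add (toL2 Ω V) (toL2 Ω W)] with x h1 h2 h3 h4
  rw [← h1, ← h2, ← h3, (toL2 Ω).map_add V W]
  exact h4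

/-- The Trudinger inequality for pairs. -/
theorem exists_expInt_const (hΩb : Bornology.IsBounded Ω) (hΩm : MeasurableSet Ω) :
    ∃ α : ℝ, 0 < α ∧ ∃ K : ℝ≥0∞, K ≠ ⊤ ∧ ∀ (W : Pairs Ω) (q r : ℝ), 0 < r → ‖W‖ ≤ r →
      q * r ^ 2 ≤ α → expInt q W ≤ K := by
  obtain ⟨α, hα, K, hK, hT⟩ := exists_trudinger_const hΩb hΩm
  refine ⟨α / 2, by positivity, K + K, by simp [hK], fun W q r hr hW hq => ?_⟩
  have hW1 : ‖r⁻¹ • W‖ ≤ 1 := by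
    rw [norm_smul, Real.norm_of_nonneg (inv_nonneg.2 hr.le)]
    exact inv_mul_le_one_of_le₀ hW hr.le
  have h1 := hT _ ((norm_fst_le (r⁻¹ • W)).trans hW1)
  have h2 := hT _ ((norm_snd_le (r⁻¹ • W)).trans hW1)
  have hm : ∀ u : H10 Ω, AEMeasurable (fun x => ENNReal.ofReal (Real.exp (α * val u x ^ 2)))
      (volume.restrict Ω) := by
    intro u
    have := (Lp.aestronglyMeasurable (valL Ω u)).aemeasurable
    rw [coeFn_valL] at this
    fun_prop
  refine le_trans ?_ (add_le_add h1 h2)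
  rw [← lintegral_add_left' (hm _)]
  refine lintegral_mono_ae ?_
  filter_upwards [pairVal_smul r⁻¹ W] with x hx
  rw [← ENNReal.ofReal_add (Real.exp_pos _).le (Real.exp_pos _).le]
  refine ENNReal.ofReal_le_ofReal ?_
  set s := val (r⁻¹ • W).1 x
  set t := val (r⁻¹ • W).2 x
  have h3 : ‖pairVal W x‖ ^ 2 = r ^ 2 * (s ^ 2 + t ^ 2) := by
    rw [← norm_pairVal_sq, hx, norm_smul, mul_pow, Real.norm_of_nonneg (inv_nonneg.2 hr.le)]
    field_simp
  have h4 : q * ‖pairVal W x‖ ^ 2 ≤ α / 2 * (s ^ 2 + t ^ 2) := by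
    rw [h3, ← mul_assoc]
    gcongr
  refine (Real.exp_le_exp.2 h4).trans ?_
  -- Halving `α` pays for `s² + t² ≤ 2 max(s², t²)`.
  rcases le_total (s ^ 2) (t ^ 2) with h | h
  · have : Real.exp (α / 2 * (s ^ 2 + t ^ 2)) ≤ Real.exp (α * t ^ 2) :=
      Real.exp_le_exp.2 (by linarith [mul_le_mul_of_nonneg_left h hα.le])
    linarith [Real.exp_pos (α * s ^ 2)]
  · have : Real.exp (α / 2 * (s ^ 2 + t ^ 2)) ≤ Real.exp (α * s ^ 2) :=
      Real.exp_le_exp.2 (by linarith [mul_le_mul_of_nonneg_left h hα.le])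
    linarith [Real.exp_pos (α * t ^ 2)]

/-- The exponential integrals are locally bounded. -/
theorem exists_expInt_bound_nhds (hΩb : Bornology.IsBounded Ω) (hΩm : MeasurableSet Ω) {q : ℝ}
    (hq : 0 ≤ q) (W : Pairs Ω) :
    ∃ K : ℝ≥0∞, K ≠ ⊤ ∧ ∀ᶠ V in 𝓝 W, expInt q V ≤ K := by
  obtain ⟨α, hα, K, hK, hT⟩ := exists_expInt_const hΩb hΩm
  obtain ⟨r, hr, hqr⟩ : ∃ r : ℝ, 0 < r ∧ 2 * q * r ^ 2 ≤ α := by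
    refine ⟨√(α / (2 * q + 1)), by positivity, ?_⟩
    rw [Real.sq_sqrt (by positivity), ← mul_div_assoc, div_le_iff₀ (by positivity)]
    nlinarith
  have hdense : Dense (testSet Ω ×ˢ testSet Ω) := dense_testSet.prod dense_testSet
  -- For an arbitrary exponent `q`, split `V = (V - A) + A` with `A` a bounded pair of test
  -- functions. The remainder has norm at most `r`, small enough for Trudinger with exponent `2q`,
  -- and `|V|² ≤ 2|V - A|² + 2|A|²`.
  obtain ⟨A, ⟨⟨φ, hφ, h1, -⟩, ⟨ψ, hψ, h2, -⟩⟩, hA⟩ := hdense.exists_dist_lt W (half_pos hr)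
  obtain ⟨B, hB⟩ : ∃ B : ℝ, ∀ x, φ x ^ 2 + ψ x ^ 2 ≤ B := by
    obtain ⟨B1, hB1⟩ := hφ.hasCompactSupport.exists_bound_of_continuous hφ.smooth.continuous
    obtain ⟨B2, hB2⟩ := hψ.hasCompactSupport.exists_bound_of_continuous hψ.smooth.continuous
    refine ⟨B1 ^ 2 + B2 ^ 2, fun x => ?_⟩
    have e1 := pow_le_pow_left₀ (norm_nonneg _) (hB1 x) 2
    have e2 := pow_le_pow_left₀ (norm_nonneg _) (hB2 x) 2
    simp only [Real.norm_eq_abs, sq_abs] at e1 e2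
    linarith
  refine ⟨ENNReal.ofReal (Real.exp (2 * q * B)) * K, ENNReal.mul_ne_top ENNReal.ofReal_ne_top hK,
    ?_⟩
  filter_upwards [Metric.ball_mem_nhds W (half_pos hr)] with V hV
  have hVA : ‖V - A‖ ≤ r := by
    rw [← dist_eq_norm]
    have : dist V W < r / 2 := hV
    linarith [dist_triangle V W A]
  refine le_trans ?_ (mul_le_mul_right (hT (V - A) (2 * q) r hr hVA hqr) _)
  rw [expInt, expInt, ← lintegral_const_mul' _ _ ENNReal.ofReal_ne_top]
  refine lintegral_mono_ae ?_
  filter_upwards [pairVal_add (V - A) A, h1, h2] with x hx hx1 hx2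
  rw [← ENNReal.ofReal_mul (Real.exp_pos _).le, ← Real.exp_add]
  refine ENNReal.ofReal_le_ofReal (Real.exp_le_exp.2 ?_)
  rw [sub_add_cancel] at hx
  have e1 : ‖pairVal A x‖ ^ 2 ≤ B := by rw [norm_pairVal_sq, hx1, hx2]; exact hB x
  have e2 : ‖pairVal V x‖ ^ 2 ≤ 2 * ‖pairVal (V - A) x‖ ^ 2 + 2 * B := by
    rw [hx]
    have := norm_add_le (pairVal (V - A) x) (pairVal A x)
    nlinarith [sq_nonneg (‖pairVal (V - A) x‖ - ‖pairVal A x‖),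
      norm_nonneg (pairVal (V - A) x + pairVal A x)]
  nlinarith [mul_le_mul_of_nonneg_left e2 hq]

theorem expInt_ne_top (hΩb : Bornology.IsBounded Ω) (hΩm : MeasurableSet Ω) {q : ℝ}
    (hq : 0 ≤ q) (W : Pairs Ω) : expInt q W ≠ ⊤ := by
  obtain ⟨K, hK, h⟩ := exists_expInt_bound_nhds hΩb hΩm hq W
  exact (h.self_of_nhds.trans_lt hK.lt_top).ne

end SobolevSpace

/-! ### Compactness of the embedding of `H¹₀` into `L²` -/

section Rellich

/-- The fundamental theorem of calculus on the segment from `x` to `x + z`, Cauchy–Schwarz in the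
parameter, then Tonelli and translation invariance. -/
theorem lintegral_sq_sub_translate_le {φ : Plane → ℝ} (hφ : ContDiff ℝ 1 φ) (z : Plane) :
    ∫⁻ x, ‖φ x - φ (x + z)‖ₑ ^ 2 ≤ ‖z‖ₑ ^ 2 * ∫⁻ x, ‖fderiv ℝ φ x‖ₑ ^ 2 := by
  have hfc : Continuous (fderiv ℝ φ) := hφ.continuous_fderiv one_ne_zero
  have hpt : ∀ x, ‖φ x - φ (x + z)‖ₑ ^ 2 ≤
      ∫⁻ t in Ioc (0 : ℝ) 1, ‖z‖ₑ ^ 2 * ‖fderiv ℝ φ (x + t • z)‖ₑ ^ 2 := by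
    intro x
    have hc : Continuous fun t : ℝ => fderiv ℝ φ (x + t • z) z := by fun_prop
    have hder : ∀ t ∈ uIcc (0 : ℝ) 1,
        HasDerivAt (fun t : ℝ => φ (x + t • z)) (fderiv ℝ φ (x + t • z) z) t := by
      intro t _
      have h1 : HasDerivAt (fun t : ℝ => x + t • z) z t := by
        simpa using ((hasDerivAt_id t).smul_const z).const_add x
      exact ((hφ.differentiable one_ne_zero _).hasFDerivAt).comp_hasDerivAt t h1
    have hint := intervalIntegral.integral_eq_sub_of_hasDerivAt hder (hc.intervalIntegrable _ _)
    simp only [one_smul, zero_smul, add_zero] at hint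
    have h2 : ‖φ x - φ (x + z)‖ₑ ≤ ∫⁻ t in Ioc (0 : ℝ) 1, ‖fderiv ℝ φ (x + t • z) z‖ₑ := by
      rw [enorm_sub_rev, ← hint, intervalIntegral.integral_of_le zero_le_one]
      exact enorm_integral_le_lintegral_enorm _
    calc ‖φ x - φ (x + z)‖ₑ ^ 2 ≤ (∫⁻ t in Ioc (0 : ℝ) 1, ‖fderiv ℝ φ (x + t • z) z‖ₑ) ^ 2 := by
          gcongr
      _ ≤ ∫⁻ t in Ioc (0 : ℝ) 1, ‖fderiv ℝ φ (x + t • z) z‖ₑ ^ 2 := by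
          refine (sq_lintegral_le_measure_mul hc.enorm.aemeasurable).trans ?_
          simp
      _ ≤ _ := by
          gcongr with t
          rw [← mul_pow, mul_comm]
          gcongr
          exact ContinuousLinearMap.le_opENorm _ _
  have hm : Measurable fun p : Plane × ℝ => ‖z‖ₑ ^ 2 * ‖fderiv ℝ φ (p.1 + p.2 • z)‖ₑ ^ 2 := by
    have : Continuous fun p : Plane × ℝ => fderiv ℝ φ (p.1 + p.2 • z) := by fun_prop
    exact (this.enorm.measurable.pow_const 2).const_mul _
  calc ∫⁻ x, ‖φ x - φ (x + z)‖ₑ ^ 2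
      ≤ ∫⁻ x, ∫⁻ t in Ioc (0 : ℝ) 1, ‖z‖ₑ ^ 2 * ‖fderiv ℝ φ (x + t • z)‖ₑ ^ 2 :=
        lintegral_mono hpt
    _ = ∫⁻ t in Ioc (0 : ℝ) 1, ∫⁻ x, ‖z‖ₑ ^ 2 * ‖fderiv ℝ φ (x + t • z)‖ₑ ^ 2 :=
        lintegral_lintegral_swap hm.aemeasurable
    _ = ∫⁻ _ in Ioc (0 : ℝ) 1, ‖z‖ₑ ^ 2 * ∫⁻ x, ‖fderiv ℝ φ x‖ₑ ^ 2 := by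
        refine lintegral_congr fun t => ?_
        rw [lintegral_const_mul _ (by fun_prop)]
        congr 1
        exact lintegral_add_right_eq_self (fun x => ‖fderiv ℝ φ x‖ₑ ^ 2) (t • z)
    _ = _ := by simp

/-- The index of the cell of the grid of size `h` that contains `x`. -/
def gridIndex (h : ℝ) (x : Plane) (i : Fin 2) : ℤ := ⌊x i / h⌋

/-- The cells of the grid of size `h`. -/
def gridCell (h : ℝ) (k : Fin 2 → ℤ) : Set Plane := {x | gridIndex h x = k}

theorem measurable_gridIndex (h : ℝ) : Measurable (gridIndex h) := by
  refine measurable_pi_lambda _ fun i => ?_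
  exact Int.measurable_floor.comp (by fun_prop)

theorem measurableSet_gridCell (h : ℝ) (k : Fin 2 → ℤ) : MeasurableSet (gridCell h k) :=
  measurable_gridIndex h (measurableSet_singleton k)

theorem volume_gridCell {h : ℝ} (hh : 0 < h) (k : Fin 2 → ℤ) :
    volume (gridCell h k) = ENNReal.ofReal (h ^ 2) := by
  have : gridCell h k = (WithLp.ofLp : Plane → Fin 2 → ℝ) ⁻¹'
      (pi univ fun i => Ico (h * k i) (h * k i + h)) := by
    ext x
    simp only [gridCell, gridIndex, mem_ofPred_eq, funext_iff, mem_preimage, Set.mem_pi, mem_univ,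
      true_imp_iff, mem_Ico, Int.floor_eq_iff]
    refine forall_congr' fun i => ?_
    rw [le_div_iff₀ hh, div_lt_iff₀ hh, add_mul, one_mul, mul_comm]
  rw [this, (PiLp.volume_preserving_ofLp (Fin 2)).measure_preimage
    (MeasurableSet.univ_pi fun i => measurableSet_Ico).nullMeasurableSet, Real.volume_pi_Ico]
  simp [ENNReal.ofReal_pow hh.le]

theorem norm_sub_le_of_mem_gridCell {h : ℝ} (hh : 0 < h) {k : Fin 2 → ℤ} {x y : Plane}
    (hx : x ∈ gridCell h k) (hy : y ∈ gridCell h k) : ‖y - x‖ ≤ 2 * h := by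
  have hc : ∀ i, |(y - x) i| ≤ h := by
    intro i
    have h1 := Int.abs_sub_lt_one_of_floor_eq_floor
      ((congrFun hy i).trans (congrFun hx i).symm : ⌊y i / h⌋ = ⌊x i / h⌋)
    rw [← sub_div, abs_div, abs_of_pos hh, div_lt_one hh] at h1
    simpa using h1.le
  rw [← sq_le_sq₀ (norm_nonneg _) (by positivity), EuclideanSpace.norm_sq_eq]
  simp only [Fin.sum_univ_two, Real.norm_eq_abs]
  nlinarith [hc 0, hc 1, abs_nonneg ((y - x) 0), abs_nonneg ((y - x) 1)]

/-- The mean of `φ` over the cell that contains `x`. -/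
def cellMean (h : ℝ) (φ : Plane → ℝ) (x : Plane) : ℝ :=
  (h ^ 2)⁻¹ * ∫ y in gridCell h (gridIndex h x), φ y

/-- Cauchy–Schwarz on the cell of `x`, which is contained in `x + closedBall 0 (2h)`. Enlarging to
the ball makes the range of `z` independent of `x`, so that Tonelli applies afterwards. -/
theorem enorm_sub_cellMean_sq_le {h : ℝ} (hh : 0 < h) {φ : Plane → ℝ} (hφ : Continuous φ)
    (hφc : HasCompactSupport φ) (x : Plane) :
    ‖φ x - cellMean h φ x‖ₑ ^ 2 ≤
      ENNReal.ofReal (h ^ 2)⁻¹ * ∫⁻ z in Metric.closedBall 0 (2 * h), ‖φ x - φ (x + z)‖ₑ ^ 2 := by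
  set Q := gridCell h (gridIndex h x) with hQ
  have hQm : MeasurableSet Q := measurableSet_gridCell _ _
  have hQv : volume Q = ENNReal.ofReal (h ^ 2) := volume_gridCell hh _
  have hreal : volume.real Q = h ^ 2 := by
    rw [measureReal_def, hQv, ENNReal.toReal_ofReal (by positivity)]
  have hint : IntegrableOn φ Q := (hφ.integrable_of_hasCompactSupport hφc).integrableOn
  have hconst : IntegrableOn (fun _ : Plane => φ x) Q :=
    integrableOn_const (by rw [hQv]; exact ENNReal.ofReal_ne_top)
  have h1 : φ x - cellMean h φ x = (h ^ 2)⁻¹ * ∫ y in Q, (φ x - φ y) := by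
    rw [integral_sub hconst hint, setIntegral_const, hreal, cellMean, smul_eq_mul]
    field_simp
    rfl
  have hm : Measurable fun y => ‖φ x - φ y‖ₑ := (continuous_const.sub hφ).enorm.measurable
  have h2 : ‖φ x - cellMean h φ x‖ₑ ≤ ENNReal.ofReal (h ^ 2)⁻¹ * ∫⁻ y in Q, ‖φ x - φ y‖ₑ := by
    rw [h1, enorm_mul, Real.enorm_of_nonneg (by positivity)]
    gcongr
    exact enorm_integral_le_lintegral_enorm _
  have hsub : ∫⁻ y in Q, ‖φ x - φ y‖ₑ ^ 2 ≤
      ∫⁻ z in Metric.closedBall 0 (2 * h), ‖φ x - φ (x + z)‖ₑ ^ 2 := by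
    rw [← lintegral_indicator hQm, ← lintegral_indicator Metric.isClosed_closedBall.measurableSet,
      ← lintegral_add_left_eq_self _ x]
    refine lintegral_mono fun z => ?_
    by_cases hz : x + z ∈ Q
    · have hz' : z ∈ Metric.closedBall (0 : Plane) (2 * h) := by
        have := norm_sub_le_of_mem_gridCell hh (show x ∈ Q from rfl) hz
        simpa using this
      rw [indicator_of_mem hz, indicator_of_mem hz']
    · rw [indicator_of_notMem hz]; exact zero_le
  calc ‖φ x - cellMean h φ x‖ₑ ^ 2
      ≤ (ENNReal.ofReal (h ^ 2)⁻¹ * ∫⁻ y in Q, ‖φ x - φ y‖ₑ) ^ 2 := by gcongr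
    _ ≤ ENNReal.ofReal (h ^ 2)⁻¹ ^ 2 * (ENNReal.ofReal (h ^ 2) * ∫⁻ y in Q, ‖φ x - φ y‖ₑ ^ 2) := by
        rw [mul_pow]
        gcongr
        refine (sq_lintegral_le_measure_mul hm.aemeasurable).trans ?_
        rw [Measure.restrict_apply_univ, hQv]
    _ = ENNReal.ofReal (h ^ 2)⁻¹ * ∫⁻ y in Q, ‖φ x - φ y‖ₑ ^ 2 := by
        rw [← mul_assoc, sq (ENNReal.ofReal _), mul_assoc (ENNReal.ofReal _),
          ← ENNReal.ofReal_mul (by positivity), inv_mul_cancel₀ (by positivity),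
          ENNReal.ofReal_one, mul_one]
    _ ≤ _ := by gcongr

/-- The factor `16 h²` is `h⁻²` from the mean, `(2h)²` from the translation estimate and `(2h)²`
from the area of the ball. -/
theorem lintegral_sub_cellMean_sq_le {h : ℝ} (hh : 0 < h) {φ : Plane → ℝ} (hφ : ContDiff ℝ 1 φ)
    (hφc : HasCompactSupport φ) :
    ∫⁻ x, ‖φ x - cellMean h φ x‖ₑ ^ 2 ≤
      ENNReal.ofReal (16 * h ^ 2) * volume (Metric.ball (0 : Plane) 1) *
        ∫⁻ x, ‖fderiv ℝ φ x‖ₑ ^ 2 := by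
  have hc := hφ.continuous
  have hm : Measurable fun p : Plane × Plane => ‖φ p.1 - φ (p.1 + p.2)‖ₑ ^ 2 := by
    have : Continuous fun p : Plane × Plane => φ p.1 - φ (p.1 + p.2) := by fun_prop
    exact this.enorm.measurable.pow_const 2
  have hB := (Metric.isClosed_closedBall (x := (0 : Plane)) (ε := 2 * h)).measurableSet
  calc ∫⁻ x, ‖φ x - cellMean h φ x‖ₑ ^ 2
      ≤ ∫⁻ x, ENNReal.ofReal (h ^ 2)⁻¹ *
          ∫⁻ z in Metric.closedBall 0 (2 * h), ‖φ x - φ (x + z)‖ₑ ^ 2 :=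
        lintegral_mono (enorm_sub_cellMean_sq_le hh hc hφc)
    _ = ENNReal.ofReal (h ^ 2)⁻¹ *
          ∫⁻ z in Metric.closedBall 0 (2 * h), ∫⁻ x, ‖φ x - φ (x + z)‖ₑ ^ 2 := by
        rw [lintegral_const_mul' _ _ ENNReal.ofReal_ne_top]
        congr 1
        exact lintegral_lintegral_swap hm.aemeasurable
    _ ≤ ENNReal.ofReal (h ^ 2)⁻¹ * ∫⁻ _ in Metric.closedBall (0 : Plane) (2 * h),
          ENNReal.ofReal (2 * h) ^ 2 * ∫⁻ x, ‖fderiv ℝ φ x‖ₑ ^ 2 := by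
        refine mul_le_mul_right ?_ _
        refine setLIntegral_mono measurable_const fun z hz => ?_
        refine (lintegral_sq_sub_translate_le hφ z).trans ?_
        gcongr
        rw [← ofReal_norm]
        exact ENNReal.ofReal_le_ofReal (by simpa using hz)
    _ = _ := by
        rw [setLIntegral_const, Measure.addHaar_closedBall _ _ (by positivity),
          ← ENNReal.ofReal_pow (by positivity)]
        simp only [finrank_euclideanSpace, Fintype.card_fin]
        have : ENNReal.ofReal (16 * h ^ 2) = ENNReal.ofReal (h ^ 2)⁻¹ *
            (ENNReal.ofReal ((2 * h) ^ 2) * ENNReal.ofReal ((2 * h) ^ 2)) := by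
          rw [← ENNReal.ofReal_mul (by positivity), ← ENNReal.ofReal_mul (by positivity)]
          congr 1
          field_simp
          ring
        rw [this]
        ring

variable {Ω : Set Plane}

theorem finite_gridIndex_image (hΩb : Bornology.IsBounded Ω) {h : ℝ} (hh : 0 < h) :
    (gridIndex h '' Ω).Finite := by
  obtain ⟨R, hR⟩ := hΩb.exists_norm_le
  refine (Set.finite_Icc (fun _ : Fin 2 => ⌊-R / h⌋) (fun _ => ⌊R / h⌋)).subset ?_
  rintro _ ⟨x, hx, rfl⟩
  have hxi : ∀ i, |x i| ≤ R := fun i => (PiLp.norm_apply_le x i).trans (hR x hx)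
  refine ⟨fun i => ?_, fun i => ?_⟩
  · exact Int.floor_le_floor (by gcongr; exact (abs_le.1 (hxi i)).1)
  · exact Int.floor_le_floor (by gcongr; exact (abs_le.1 (hxi i)).2)

theorem coeFn_finset_sum {α E ι : Type*} [MeasurableSpace α] [NormedAddCommGroup E]
    {μ : Measure α} {p : ℝ≥0∞} (s : Finset ι) (f : ι → Lp E p μ) :
    ⇑(∑ i ∈ s, f i) =ᵐ[μ] fun x => ∑ i ∈ s, f i x := by
  classical
  induction s using Finset.induction_on with
  | empty => simpa using! Lp.coeFn_zero E p μ
  | insert i s hi ih =>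
    rw [Finset.sum_insert hi]
    filter_upwards [Lp.coeFn_add (f i) (∑ j ∈ s, f j), ih] with x h1 h2
    rw [h1, Pi.add_apply, h2, Finset.sum_insert hi]

/-- Averaging over the cells of the grid is a compact operator on `L²(Ω)`. -/
theorem exists_cellMean_operator (hΩb : Bornology.IsBounded Ω) (hΩm : MeasurableSet Ω) {h : ℝ}
    (hh : 0 < h) : ∃ T : Lp ℝ 2 (volume.restrict Ω) →L[ℝ] Lp ℝ 2 (volume.restrict Ω),
      IsCompactOperator T ∧ ∀ (f : Lp ℝ 2 (volume.restrict Ω)) (φ : Plane → ℝ),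
        f =ᵐ[volume.restrict Ω] φ → (∀ x ∉ Ω, φ x = 0) →
          T f =ᵐ[volume.restrict Ω] cellMean h φ := by
  classical
  have hfin : ∀ k, (volume.restrict Ω) (gridCell h k) ≠ ⊤ := fun k =>
    ((Measure.restrict_apply_le Ω _).trans_lt
      (by rw [volume_gridCell hh]; exact ENNReal.ofReal_lt_top)).ne
  let e : (Fin 2 → ℤ) → Lp ℝ 2 (volume.restrict Ω) := fun k =>
    indicatorConstLp 2 (measurableSet_gridCell h k) (hfin k) 1
  let F : Finset (Fin 2 → ℤ) := (finite_gridIndex_image hΩb hh).toFinset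
  -- Only finitely many cells meet the bounded set `Ω`, so the operator has finite rank. The means
  -- are over whole cells, which agrees with integration over `Ω` because `φ` vanishes outside.
  refine ⟨(h ^ 2)⁻¹ • ∑ k ∈ F, (innerSL ℝ (e k)).smulRight (e k), ?_, fun f φ hf hφ => ?_⟩
  · show _ ∈ compactOperator (RingHom.id ℝ) _ _
    refine Submodule.smul_mem _ _ (Submodule.sum_mem _ fun k _ => ?_)
    have h1 : IsCompactOperator (innerSL ℝ (e k)) :=
      isCompactOperator_of_locallyCompactSpace_dom _
    exact h1.clm_comp (ContinuousLinearMap.toSpanSingleton ℝ (e k))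
  · have hval : ((h ^ 2)⁻¹ • ∑ k ∈ F, (innerSL ℝ (e k)).smulRight (e k)) f =
        ∑ k ∈ F, ((h ^ 2)⁻¹ * ∫ y in gridCell h k, φ y) • e k := by
      rw [smul_apply, sum_apply, Finset.smul_sum]
      refine Finset.sum_congr rfl fun k _ => ?_
      rw [ContinuousLinearMap.smulRight_apply, innerSL_apply_apply, smul_smul]
      congr 2
      rw [L2.inner_indicatorConstLp_one, Measure.restrict_restrict (measurableSet_gridCell h k)]
      have h2 : ∫ y in gridCell h k ∩ Ω, f y = ∫ y in gridCell h k ∩ Ω, φ y :=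
        integral_congr_ae (ae_mono (Measure.restrict_mono_set _ inter_subset_right) hf)
      rw [h2]
      refine (setIntegral_eq_of_subset_of_forall_sdiff_eq_zero (measurableSet_gridCell h k)
        inter_subset_left fun x hx => hφ x fun hxΩ => hx.2 ⟨hx.1, hxΩ⟩).symm
    rw [hval]
    have hae : ∀ᵐ x ∂(volume.restrict Ω), ∀ k : Fin 2 → ℤ,
        (((h ^ 2)⁻¹ * ∫ y in gridCell h k, φ y) • e k : Lp ℝ 2 (volume.restrict Ω)) x =
          ((h ^ 2)⁻¹ * ∫ y in gridCell h k, φ y) * (gridCell h k).indicator (fun _ => 1) x := by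
      rw [ae_all_iff]
      intro k
      filter_upwards [Lp.coeFn_smul ((h ^ 2)⁻¹ * ∫ y in gridCell h k, φ y) (e k),
        indicatorConstLp_coeFn (p := 2) (hs := measurableSet_gridCell h k) (hμs := hfin k)
          (c := (1 : ℝ))] with x h3 h4
      rw [h3, Pi.smul_apply, smul_eq_mul, h4]
    filter_upwards [coeFn_finset_sum F fun k => ((h ^ 2)⁻¹ * ∫ y in gridCell h k, φ y) • e k, hae,
      ae_restrict_mem hΩm] with x h5 h6 hx
    rw [h5, Finset.sum_congr rfl fun k _ => h6 k, Finset.sum_eq_single (gridIndex h x)]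
    · rw [indicator_of_mem (show x ∈ gridCell h (gridIndex h x) from rfl), mul_one]
      rfl
    · intro k _ hk
      have hnot : x ∉ gridCell h k := fun hmem => hk (Eq.symm hmem)
      rw [indicator_of_notMem hnot, mul_zero]
    · intro hmem
      exact absurd ((finite_gridIndex_image hΩb hh).mem_toFinset.2 (mem_image_of_mem _ hx)) hmem

theorem ofReal_mul_mul_enorm_sq {E : Type*} [NormedAddCommGroup E] (g : E) {V : ℝ≥0∞}
    (hV : V ≠ ⊤) (h : ℝ) : ENNReal.ofReal (16 * h ^ 2) * V * ‖g‖ₑ ^ 2 =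
      ENNReal.ofReal ((4 * √V.toReal * h * ‖g‖) ^ 2) := by
  rw [← ofReal_norm, ← ENNReal.ofReal_pow (norm_nonneg _)]
  nth_rw 1 [← ENNReal.ofReal_toReal hV]
  rw [← ENNReal.ofReal_mul (by positivity), ← ENNReal.ofReal_mul (by positivity)]
  congr 1
  rw [mul_pow, mul_pow, mul_pow, Real.sq_sqrt ENNReal.toReal_nonneg]
  ring

theorem norm_valL_sub_le_of_ae_eq_cellMean (hΩm : MeasurableSet Ω) {h : ℝ} (hh : 0 < h) {u : H10 Ω}
    {φ : Plane → ℝ} (hφ : IsTestFunction Ω φ) (h1 : val u =ᵐ[volume.restrict Ω] φ)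
    (h2 : grad u =ᵐ[volume.restrict Ω] ∇ φ) {f : Lp ℝ 2 (volume.restrict Ω)}
    (hf : f =ᵐ[volume.restrict Ω] cellMean h φ) :
    ‖valL Ω u - f‖ ≤ 4 * √(volume (Metric.ball (0 : Plane) 1)).toReal * h * ‖gradL Ω u‖ := by
  have h3 : ‖valL Ω u - f‖ₑ ^ 2 ≤ ENNReal.ofReal
      ((4 * √(volume (Metric.ball (0 : Plane) 1)).toReal * h * ‖gradL Ω u‖) ^ 2) := by
    rw [enorm_sq_eq_lintegral]
    calc ∫⁻ x in Ω, ‖(valL Ω u - f : Lp ℝ 2 (volume.restrict Ω)) x‖ₑ ^ 2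
        = ∫⁻ x in Ω, ‖φ x - cellMean h φ x‖ₑ ^ 2 := by
          refine lintegral_congr_ae ?_
          filter_upwards [Lp.coeFn_sub (valL Ω u) f, h1, hf] with x e1 e2 e3
          rw [e1, Pi.sub_apply, e3, coeFn_valL, e2]
      _ ≤ ∫⁻ x, ‖φ x - cellMean h φ x‖ₑ ^ 2 := setLIntegral_le_lintegral _ _
      _ ≤ ENNReal.ofReal (16 * h ^ 2) * volume (Metric.ball (0 : Plane) 1) *
            ∫⁻ x, ‖fderiv ℝ φ x‖ₑ ^ 2 :=
          lintegral_sub_cellMean_sq_le hh (hφ.smooth.of_le (by simp)) hφ.hasCompactSupport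
      _ = _ := by
          rw [← enorm_gradL_sq_of_test hΩm hφ h2]
          exact ofReal_mul_mul_enorm_sq _ measure_ball_lt_top.ne h
  rwa [← ofReal_norm, ← ENNReal.ofReal_pow (norm_nonneg _),
    ENNReal.ofReal_le_ofReal_iff (by positivity), sq_le_sq₀ (norm_nonneg _) (by positivity)] at h3

/-- The Rellich theorem: the embedding of `H¹₀(Ω)` into `L²(Ω)` is compact. -/
theorem isCompactOperator_valL (hΩb : Bornology.IsBounded Ω) (hΩm : MeasurableSet Ω) :
    IsCompactOperator (valL Ω) := by
  have hs : ∀ n : ℕ, (0 : ℝ) < 1 / (n + 1) := fun n => Nat.one_div_pos_of_nat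
  choose T hTc hT using fun n => exists_cellMean_operator hΩb hΩm (hs n)
  set C := 4 * √(volume (Metric.ball (0 : Plane) 1)).toReal
  have hC : 0 ≤ C := by positivity
  have hbound : ∀ (n : ℕ) (u : H10 Ω),
      ‖valL Ω u - T n (valL Ω u)‖ ≤ C * (1 / ((n : ℝ) + 1)) * ‖u‖ := by
    intro n u
    refine dense_testSet.induction
      (P := fun u => ‖valL Ω u - T n (valL Ω u)‖ ≤ C * (1 / ((n : ℝ) + 1)) * ‖u‖) ?_
      (isClosed_le (by fun_prop) (by fun_prop)) u
    rintro u ⟨φ, hφ, h1, h2⟩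
    refine (norm_valL_sub_le_of_ae_eq_cellMean hΩm (hs n) hφ h1 h2
      (hT n _ φ h1 fun x hx => hφ.eq_zero_of_notMem hx)).trans ?_
    exact mul_le_mul_of_nonneg_left (norm_gradL_le u) (mul_nonneg hC (hs n).le)
  -- The embedding is a limit of compact operators in operator norm, as the averaging error is of
  -- the order of the cell size.
  refine isCompactOperator_of_tendsto (l := atTop) (F := fun n => (T n).comp (valL Ω)) ?_
    (Eventually.of_forall fun n => (hTc n).comp_clm (valL Ω))
  refine (tendsto_iff_norm_sub_tendsto_zero
    (E := H10 Ω →L[ℝ] Lp ℝ 2 (volume.restrict Ω))).2 ?_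
  refine squeeze_zero (fun n => ContinuousLinearMap.opNorm_nonneg _)
    (g := fun n : ℕ => C * (1 / ((n : ℝ) + 1))) (fun n => ?_) ?_
  · refine ContinuousLinearMap.opNorm_le_bound _ (mul_nonneg hC (hs n).le) fun u => ?_
    have h := hbound n u
    rw [norm_sub_rev] at h
    exact h
  · simpa using (tendsto_one_div_add_atTop_nhds_zero_nat (𝕜 := ℝ)).const_mul C

theorem exists_subseq_tendsto_valL (hΩb : Bornology.IsBounded Ω) (hΩm : MeasurableSet Ω)
    {u : ℕ → H10 Ω} {r : ℝ} (hu : ∀ n, ‖u n‖ ≤ r) :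
    ∃ ns : ℕ → ℕ, StrictMono ns ∧ ∃ w, Tendsto (fun n => valL Ω (u (ns n))) atTop (𝓝 w) := by
  obtain ⟨S, hS, hsub⟩ := IsCompactOperator.image_closedBall_subset_compact
    (f := (valL Ω).toLinearMap) (isCompactOperator_valL hΩb hΩm) r
  obtain ⟨w, -, ns, hns, hlim⟩ := hS.tendsto_subseq (x := fun n => valL Ω (u n))
    fun n => hsub ⟨u n, by simpa using hu n, rfl⟩
  exact ⟨ns, hns, w, hlim⟩

/-- A bounded sequence of pairs has a subsequence converging in `L²`. -/
theorem exists_subseq_cauchy_toL2 (hΩb : Bornology.IsBounded Ω) (hΩm : MeasurableSet Ω)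
    {W : ℕ → Pairs Ω} {r : ℝ} (hW : ∀ n, ‖W n‖ ≤ r) :
    ∃ ns : ℕ → ℕ, StrictMono ns ∧ CauchySeq fun n => toL2 Ω (W (ns n)) := by
  obtain ⟨n1, h1, w1, hl1⟩ := exists_subseq_tendsto_valL hΩb hΩm (u := fun n => (W n).1)
    fun n => (norm_fst_le _).trans (hW n)
  obtain ⟨n2, h2, w2, hl2⟩ := exists_subseq_tendsto_valL hΩb hΩm (u := fun n => (W (n1 n)).2)
    fun n => (norm_snd_le _).trans (hW _)
  refine ⟨n1 ∘ n2, h1.comp h2, ?_⟩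
  have h3 := (((ContinuousLinearMap.compLpL 2 (volume.restrict Ω)
    ((ContinuousLinearMap.id ℝ ℝ).smulRight (vec 1 0))).continuous.tendsto w1).comp
      (hl1.comp h2.tendsto_atTop)).add (((ContinuousLinearMap.compLpL 2 (volume.restrict Ω)
    ((ContinuousLinearMap.id ℝ ℝ).smulRight (vec 0 1))).continuous.tendsto w2).comp hl2)
  exact Tendsto.cauchySeq h3

end Rellich

/-! ### The potential term of the energy -/

section Potential

/-- A sequence bounded in `L⁴` and converging almost everywhere converges in `L²`. -/
theorem tendsto_eLpNorm_two_of_ae_of_lintegral_pow_four_le {α E : Type*} [MeasurableSpace α]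
    [NormedAddCommGroup E] {μ : Measure α} [IsFiniteMeasure μ] {f : ℕ → α → E} {g : α → E}
    (hf : ∀ n, AEStronglyMeasurable (f n) μ) (hg : MemLp g 2 μ) {K : ℝ≥0∞} (hK : K ≠ ⊤)
    (hfK : ∀ n, ∫⁻ x, ‖f n x‖ₑ ^ 4 ∂μ ≤ K)
    (hfg : ∀ᵐ x ∂μ, Tendsto (fun n => f n x) atTop (𝓝 (g x))) :
    Tendsto (fun n => eLpNorm (f n - g) 2 μ) atTop (𝓝 0) := by
  refine tendsto_Lp_finite_of_tendsto_ae one_le_two (by norm_num) hf hg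
    (unifIntegrable_of one_le_two (by norm_num) hf fun ε hε => ?_) hfg
  -- Vitali's theorem: on `{|f| ≥ c}` one has `c² |f|² ≤ |f|⁴`, so the `L²` norm of the tail is at
  -- most `√K / c`, which is at most `ε` for this `c`.
  refine ⟨(√K.toReal / ε).toNNReal + 1, fun n => ?_⟩
  set c : ℝ≥0 := (√K.toReal / ε).toNNReal + 1 with hc
  have hcpos : (c : ℝ≥0∞) ≠ 0 := by simp [hc]
  set F : α → E := {x | c ≤ ‖f n x‖₊}.indicator (f n)
  have hpt : ∀ x, (c : ℝ≥0∞) ^ 2 * ‖F x‖ₑ ^ 2 ≤ ‖f n x‖ₑ ^ 4 := by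
    intro x
    by_cases hx : c ≤ ‖f n x‖₊
    · have h1 : F x = f n x := indicator_of_mem (show x ∈ {x | c ≤ ‖f n x‖₊} from hx) _
      have h2 : (c : ℝ≥0∞) ≤ ‖f n x‖ₑ := by rw [enorm_eq_nnnorm]; exact_mod_cast hx
      calc (c : ℝ≥0∞) ^ 2 * ‖F x‖ₑ ^ 2 ≤ ‖f n x‖ₑ ^ 2 * ‖f n x‖ₑ ^ 2 := by rw [h1]; gcongr
        _ = _ := by ring
    · have h1 : F x = 0 := indicator_of_notMem (show x ∉ {x | c ≤ ‖f n x‖₊} from hx) _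
      simp [h1]
  have h2 : eLpNorm F 2 μ ^ 2 = ∫⁻ x, ‖F x‖ₑ ^ 2 ∂μ := by
    have h := eLpNorm_nnreal_pow_eq_lintegral (f := F) (μ := μ) (p := 2) (by norm_num)
    simpa using h
  have h3 : (c : ℝ≥0∞) ^ 2 * eLpNorm F 2 μ ^ 2 ≤ K := by
    rw [h2, ← lintegral_const_mul' _ _ (by simp)]
    exact (lintegral_mono hpt).trans (hfK n)
  rw [← mul_pow] at h3
  have h4 : (c : ℝ≥0∞) * eLpNorm F 2 μ ≤ ENNReal.ofReal (√K.toReal) := by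
    rw [← ENNReal.pow_le_pow_left_iff two_ne_zero, ← ENNReal.ofReal_pow (Real.sqrt_nonneg _),
      Real.sq_sqrt ENNReal.toReal_nonneg, ENNReal.ofReal_toReal hK]
    exact h3
  have h5 : ENNReal.ofReal (√K.toReal) ≤ c * ENNReal.ofReal ε := by
    rw [← ENNReal.ofReal_coe_nnreal, ← ENNReal.ofReal_mul c.coe_nonneg]
    refine ENNReal.ofReal_le_ofReal ?_
    rw [← div_le_iff₀ hε, hc]
    push_cast
    linarith [Real.le_coe_toNNReal (√K.toReal / ε)]
  exact (ENNReal.mul_le_mul_iff_right hcpos ENNReal.coe_ne_top).1 (h4.trans h5)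

/-- Continuity is known only over `Ω`, so `F` is extended by zero to a Borel map on the product
before composing. -/
theorem aestronglyMeasurable_comp_of_continuousOn {G : Type*} [NormedAddCommGroup G]
    [SecondCountableTopology G] [MeasurableSpace G] [BorelSpace G] {Ω : Set Plane}
    (hΩm : MeasurableSet Ω) {F : Plane → Plane → G}
    (hF : ContinuousOn (fun p : Plane × Plane => F p.1 p.2) (Ω ×ˢ univ)) {w : Plane → Plane}
    (hw : AEStronglyMeasurable w (volume.restrict Ω)) :
    AEStronglyMeasurable (fun x => F x (w x)) (volume.restrict Ω) := by
  classical
  have hm : Measurable ((Ω ×ˢ univ).piecewise (fun p : Plane × Plane => F p.1 p.2) fun _ => 0) :=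
    hF.measurable_piecewise continuousOn_const (hΩm.prod MeasurableSet.univ)
  have h := (hm.comp_aemeasurable (aemeasurable_id.prodMk hw.aemeasurable)).aestronglyMeasurable
  refine h.congr ?_
  filter_upwards [ae_restrict_mem hΩm] with x hx
  simp [Set.piecewise, hx]

/-- The consequences of the hypotheses on the potential that are used to build the energy. -/
structure IsControlled (Ω : Set Plane) (H : Plane → Plane → ℝ) (C β : ℝ) : Prop where
  isBounded : Bornology.IsBounded Ω
  measurableSet : MeasurableSet Ω
  isC1 : IsC1Potential Ω H
  C_nonneg : 0 ≤ C
  β_nonneg : 0 ≤ β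
  growth : ∀ x ∈ Ω, ∀ W : Plane, ‖∇ (H x) W‖ ≤ C * Real.exp (β * ‖W‖ ^ 2)
  nonneg : ∀ x ∈ Ω, ∀ W : Plane, 0 ≤ H x W
  le_grad : ∀ x ∈ Ω, ∀ W : Plane, H x W ≤ ‖W‖ * ‖∇ (H x) W‖

theorem le_exp_sq (t : ℝ) : t ≤ Real.exp (t ^ 2) := by
  nlinarith [Real.add_one_le_exp (t ^ 2), sq_nonneg (t - 1)]

/-- The functional `W ↦ ∫ H(x, W)`. -/
def potential {Ω : Set Plane} (H : Plane → Plane → ℝ) (W : Pairs Ω) : ℝ :=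
  ∫ x in Ω, H x (pairVal W x)

theorem aestronglyMeasurable_pairVal {Ω : Set Plane} (W : Pairs Ω) :
    AEStronglyMeasurable (pairVal W) (volume.restrict Ω) :=
  (Lp.aestronglyMeasurable (toL2 Ω W)).congr (coeFn_toL2 W)

namespace IsControlled

variable {Ω : Set Plane} {H : Plane → Plane → ℝ} {C β : ℝ}

theorem isFiniteMeasure (h : IsControlled Ω H C β) : IsFiniteMeasure (volume.restrict Ω) :=
  ⟨by rw [Measure.restrict_apply_univ]; exact h.isBounded.measure_lt_top⟩

theorem integrable_exp (h : IsControlled Ω H C β) {q : ℝ} (hq : 0 ≤ q) (W : Pairs Ω) :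
    IntegrableOn (fun x => Real.exp (q * ‖pairVal W x‖ ^ 2)) Ω := by
  refine ⟨?_, ?_⟩
  · exact (Real.continuous_exp.comp (by fun_prop : Continuous fun w : Plane => q * ‖w‖ ^ 2)
      ).comp_aestronglyMeasurable (aestronglyMeasurable_pairVal W)
  · rw [hasFiniteIntegral_iff_ofReal (Eventually.of_forall fun _ => (Real.exp_pos _).le)]
    exact (expInt_ne_top h.isBounded h.measurableSet hq W).lt_top

theorem integrable_potential (h : IsControlled Ω H C β) (W : Pairs Ω) :
    IntegrableOn (fun x => H x (pairVal W x)) Ω := by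
  refine ((h.integrable_exp (q := β + 1) (by linarith [h.β_nonneg]) W).const_mul C).mono'
    (aestronglyMeasurable_comp_of_continuousOn h.measurableSet h.isC1.continuousOn
      (aestronglyMeasurable_pairVal W)) ?_
  filter_upwards [ae_restrict_mem h.measurableSet] with x hx
  rw [Real.norm_of_nonneg (h.nonneg x hx _)]
  set w := pairVal W x
  calc H x w ≤ ‖w‖ * ‖∇ (H x) w‖ := h.le_grad x hx w
    _ ≤ Real.exp (‖w‖ ^ 2) * (C * Real.exp (β * ‖w‖ ^ 2)) := by
        gcongr
        · exact le_exp_sq _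
        · exact h.growth x hx w
    _ = _ := by rw [add_mul, one_mul, Real.exp_add]; ring

/-- The case `k = 2` puts the gradient term in `L²`; `k = 4` supplies the uniform integrability
behind `continuous_nemytskii`. -/
theorem lintegral_grad_pow_le (h : IsControlled Ω H C β) (W : Pairs Ω) (k : ℕ) :
    ∫⁻ x in Ω, ‖∇ (H x) (pairVal W x)‖ₑ ^ k ≤ ENNReal.ofReal (C ^ k) * expInt (k * β) W := by
  rw [expInt, ← lintegral_const_mul' _ _ ENNReal.ofReal_ne_top]
  refine lintegral_mono_ae ?_
  filter_upwards [ae_restrict_mem h.measurableSet] with x hx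
  rw [← ENNReal.ofReal_mul (pow_nonneg h.C_nonneg k), ← ofReal_norm,
    ← ENNReal.ofReal_pow (norm_nonneg _)]
  refine ENNReal.ofReal_le_ofReal ?_
  calc ‖∇ (H x) (pairVal W x)‖ ^ k ≤ (C * Real.exp (β * ‖pairVal W x‖ ^ 2)) ^ k := by
        gcongr; exact h.growth x hx _
    _ = _ := by rw [mul_pow, ← Real.exp_nat_mul]; ring_nf

theorem aestronglyMeasurable_grad (h : IsControlled Ω H C β) (W : Pairs Ω) :
    AEStronglyMeasurable (fun x => ∇ (H x) (pairVal W x)) (volume.restrict Ω) :=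
  aestronglyMeasurable_comp_of_continuousOn (F := fun x W => ∇ (H x) W) h.measurableSet
    h.isC1.continuousOn_grad (aestronglyMeasurable_pairVal W)

theorem memLp_grad (h : IsControlled Ω H C β) (W : Pairs Ω) :
    MemLp (fun x => ∇ (H x) (pairVal W x)) 2 (volume.restrict Ω) := by
  refine ⟨h.aestronglyMeasurable_grad W, ?_⟩
  have h1 := eLpNorm_nnreal_pow_eq_lintegral (f := fun x => ∇ (H x) (pairVal W x))
    (μ := volume.restrict Ω) (p := 2) (by norm_num)
  simp only [NNReal.coe_ofNat, ENNReal.rpow_ofNat, ENNReal.coe_ofNat] at h1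
  have h2 : eLpNorm (fun x => ∇ (H x) (pairVal W x)) 2 (volume.restrict Ω) ^ 2 < ⊤ := by
    rw [h1]
    exact (h.lintegral_grad_pow_le W 2).trans_lt (ENNReal.mul_lt_top ENNReal.ofReal_lt_top
      (expInt_ne_top h.isBounded h.measurableSet (by have := h.β_nonneg; positivity) W).lt_top)
  simpa using h2

/-- The map `W ↦ ∇H(x, W)` from pairs to `L²`. -/
def nemytskii (h : IsControlled Ω H C β) (W : Pairs Ω) : Lp Plane 2 (volume.restrict Ω) :=
  (h.memLp_grad W).toLp

theorem coeFn_nemytskii (h : IsControlled Ω H C β) (W : Pairs Ω) :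
    h.nemytskii W =ᵐ[volume.restrict Ω] fun x => ∇ (H x) (pairVal W x) :=
  (h.memLp_grad W).coeFn_toLp

theorem norm_nemytskii_sq_le (h : IsControlled Ω H C β) {W : Pairs Ω} {K : ℝ≥0∞} (hK : K ≠ ⊤)
    (hW : expInt (2 * β) W ≤ K) :
    ‖h.nemytskii W‖ ^ 2 ≤ C ^ 2 * K.toReal := by
  have h1 : ‖h.nemytskii W‖ₑ ^ 2 ≤ ENNReal.ofReal (C ^ 2) * K := by
    rw [enorm_sq_eq_lintegral]
    refine (le_of_eq (lintegral_congr_ae ?_)).trans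
      ((h.lintegral_grad_pow_le W 2).trans (by push_cast; gcongr))
    filter_upwards [h.coeFn_nemytskii W] with x hx
    rw [hx]
  rw [← ofReal_norm, ← ENNReal.ofReal_pow (norm_nonneg _), ← ENNReal.ofReal_toReal hK,
    ← ENNReal.ofReal_mul (sq_nonneg C)] at h1
  exact (ENNReal.ofReal_le_ofReal_iff (by positivity)).1 h1

/-- A convergent sequence of pairs has a subsequence converging almost everywhere, hence so do the
gradients `∇H(x, W)`. Local boundedness of the exponential integrals bounds them in `L⁴`, which
upgrades this to convergence in `L²`. -/
theorem continuous_nemytskii (h : IsControlled Ω H C β) : Continuous h.nemytskii := by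
  have := h.isFiniteMeasure
  refine continuous_iff_seqContinuous.2 fun W W₀ hW => ?_
  refine tendsto_of_subseq_tendsto fun ns hns => ?_
  have hV : Tendsto (fun n => W (ns n)) atTop (𝓝 W₀) := hW.comp hns
  obtain ⟨ms, hms, hae⟩ := (tendstoInMeasure_of_tendsto_Lp
    (((toL2 Ω).continuous.tendsto W₀).comp hV)).exists_seq_tendsto_ae
  obtain ⟨K, hK, hbd⟩ := exists_expInt_bound_nhds h.isBounded h.measurableSet
    (q := (4 : ℕ) * β) (by have := h.β_nonneg; positivity) W₀
  obtain ⟨N, hN⟩ := eventually_atTop.1 ((hV.comp hms.tendsto_atTop).eventually hbd)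
  refine ⟨fun n => ms (n + N), ?_⟩
  rw [Lp.tendsto_Lp_iff_tendsto_eLpNorm']
  have hlim := tendsto_eLpNorm_two_of_ae_of_lintegral_pow_four_le (μ := volume.restrict Ω)
    (f := fun n x => ∇ (H x) (pairVal (W (ns (ms (n + N)))) x))
    (fun n => h.aestronglyMeasurable_grad _) (h.memLp_grad W₀)
    (K := ENNReal.ofReal (C ^ 4) * K) (ENNReal.mul_ne_top ENNReal.ofReal_ne_top hK)
    (fun n => (h.lintegral_grad_pow_le _ 4).trans
      (mul_le_mul_right (hN (n + N) (Nat.le_add_left _ _)) _)) ?_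
  · refine hlim.congr fun n => eLpNorm_congr_ae ?_
    exact ((h.coeFn_nemytskii _).sub (h.coeFn_nemytskii _)).symm
  · have hall : ∀ᵐ x ∂(volume.restrict Ω), ∀ n, toL2 Ω (W n) x = pairVal (W n) x :=
      ae_all_iff.2 fun n => coeFn_toL2 (W n)
    filter_upwards [hae, hall, coeFn_toL2 W₀, ae_restrict_mem h.measurableSet] with x h1 h2 h3 hx
    have h4 : Tendsto (fun n => pairVal (W (ns (ms (n + N)))) x) atTop (𝓝 (pairVal W₀ x)) := by
      rw [← h3]
      refine ((tendsto_add_atTop_iff_nat N).2 h1).congr fun n => ?_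
      exact h2 _
    have h5 : Continuous fun w => ∇ (H x) w := by
      have h6 := h.isC1.continuousOn_grad.comp (f := fun w : Plane => (x, w)) (s := univ)
        (by fun_prop) fun w _ => ⟨hx, mem_univ w⟩
      exact continuousOn_univ.1 h6
    exact (h5.tendsto _).comp h4

/-- The derivative of the potential term. -/
def potentialDeriv (h : IsControlled Ω H C β) (W : Pairs Ω) : Pairs Ω →L[ℝ] ℝ :=
  (innerSL ℝ (h.nemytskii W)).comp (toL2 Ω)

theorem potentialDeriv_apply (h : IsControlled Ω H C β) (W Φ : Pairs Ω) :
    h.potentialDeriv W Φ = ⟪h.nemytskii W, toL2 Ω Φ⟫ := rfl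

theorem continuous_potentialDeriv (h : IsControlled Ω H C β) : Continuous h.potentialDeriv := by
  have h1 : Continuous fun W => innerSL ℝ (h.nemytskii W) :=
    (innerSL ℝ).continuous.comp h.continuous_nemytskii
  exact h1.clm_comp continuous_const

theorem inner_pairVal_ae (h : IsControlled Ω H C β) (W Φ : Pairs Ω) :
    (fun x => ⟪h.nemytskii W x, toL2 Ω Φ x⟫) =ᵐ[volume.restrict Ω]
      fun x => ⟪pairVal Φ x, ∇ (H x) (pairVal W x)⟫ := by
  filter_upwards [h.coeFn_nemytskii W, coeFn_toL2 Φ] with x h1 h2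
  rw [h1, h2, real_inner_comm]

theorem potentialDeriv_eq_integral (h : IsControlled Ω H C β) (W Φ : Pairs Ω) :
    h.potentialDeriv W Φ = ∫ x in Ω, ⟪pairVal Φ x, ∇ (H x) (pairVal W x)⟫ := by
  rw [potentialDeriv_apply, L2.inner_def]
  exact integral_congr_ae (h.inner_pairVal_ae W Φ)

theorem integrableOn_inner_grad (h : IsControlled Ω H C β) (W Φ : Pairs Ω) :
    IntegrableOn (fun x => ⟪pairVal Φ x, ∇ (H x) (pairVal W x)⟫) Ω :=
  (L2.integrable_inner (𝕜 := ℝ) (h.nemytskii W) (toL2 Ω Φ)).congr (h.inner_pairVal_ae W Φ)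

theorem hasLineDerivAt_potential (h : IsControlled Ω H C β) (W Φ : Pairs Ω) :
    HasLineDerivAt ℝ (potential H) (h.potentialDeriv W Φ) W Φ := by
  have hJ : ∀ t : ℝ, potential H (W + t • Φ) = ∫ x in Ω, H x (pairVal W x + t • pairVal Φ x) := by
    intro t
    refine integral_congr_ae ?_
    filter_upwards [pairVal_add W (t • Φ), pairVal_smul t Φ] with x h1 h2
    rw [h1, h2]
  have hmeas : ∀ t : ℝ, AEStronglyMeasurable (fun x => pairVal W x + t • pairVal Φ x)
      (volume.restrict Ω) := fun t =>
    (aestronglyMeasurable_pairVal W).add ((aestronglyMeasurable_pairVal Φ).const_smul t)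
  rw [HasLineDerivAt, funext hJ, h.potentialDeriv_eq_integral]
  have hβ := h.β_nonneg
  have hC := h.C_nonneg
  -- The dominating function comes from `|w + tφ|² ≤ 2|w|² + 2|φ|²`, `|φ| ≤ exp(|φ|²)` and `AB ≤ A²
  -- + B²`, which separates `w` from `φ` and doubles the exponents `2β` and `2β + 1`.
  have key := hasDerivAt_integral_of_dominated_loc_of_deriv_le (μ := volume.restrict Ω)
    (F := fun (t : ℝ) x => H x (pairVal W x + t • pairVal Φ x))
    (F' := fun (t : ℝ) x => ⟪pairVal Φ x, ∇ (H x) (pairVal W x + t • pairVal Φ x)⟫)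
    (x₀ := 0) (s := Metric.ball 0 1)
    (bound := fun x => C * (Real.exp ((4 * β) * ‖pairVal W x‖ ^ 2) +
      Real.exp ((4 * β + 2) * ‖pairVal Φ x‖ ^ 2)))
    (Metric.ball_mem_nhds 0 one_pos) ?_ ?_ ?_ ?_ ?_ ?_
  · simpa using key.2
  · exact Eventually.of_forall fun t => aestronglyMeasurable_comp_of_continuousOn h.measurableSet
      h.isC1.continuousOn (hmeas t)
  · simpa using! h.integrable_potential W
  · exact (aestronglyMeasurable_pairVal Φ).inner (aestronglyMeasurable_comp_of_continuousOn
      (F := fun x W => ∇ (H x) W) h.measurableSet h.isC1.continuousOn_grad (hmeas 0))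
  · filter_upwards [ae_restrict_mem h.measurableSet] with x hx t ht
    set w := pairVal W x
    set φ := pairVal Φ x
    have ht1 : |t| ≤ 1 := by simpa using (Metric.mem_ball.1 ht).le
    have hn : ‖w + t • φ‖ ^ 2 ≤ 2 * ‖w‖ ^ 2 + 2 * ‖φ‖ ^ 2 := by
      have h1 : ‖w + t • φ‖ ≤ ‖w‖ + ‖φ‖ := by
        refine (norm_add_le _ _).trans ?_
        rw [norm_smul]
        gcongr
        exact mul_le_of_le_one_left (norm_nonneg _) ht1
      calc ‖w + t • φ‖ ^ 2 ≤ (‖w‖ + ‖φ‖) ^ 2 := by gcongr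
        _ ≤ _ := by linarith [sq_nonneg (‖w‖ - ‖φ‖)]
    calc ‖⟪φ, ∇ (H x) (w + t • φ)⟫‖ ≤ ‖φ‖ * ‖∇ (H x) (w + t • φ)‖ := norm_inner_le_norm _ _
      _ ≤ Real.exp (‖φ‖ ^ 2) * (C * Real.exp (β * ‖w + t • φ‖ ^ 2)) := by
          gcongr
          · exact le_exp_sq _
          · exact h.growth x hx _
      _ ≤ Real.exp (‖φ‖ ^ 2) * (C * Real.exp (β * (2 * ‖w‖ ^ 2 + 2 * ‖φ‖ ^ 2))) := by gcongr
      _ = C * (Real.exp (2 * β * ‖w‖ ^ 2) * Real.exp ((2 * β + 1) * ‖φ‖ ^ 2)) := by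
          rw [mul_left_comm, ← Real.exp_add, ← Real.exp_add]
          ring_nf
      _ ≤ C * (Real.exp (4 * β * ‖w‖ ^ 2) + Real.exp ((4 * β + 2) * ‖φ‖ ^ 2)) := by
          gcongr
          have e1 : Real.exp (4 * β * ‖w‖ ^ 2) = Real.exp (2 * β * ‖w‖ ^ 2) ^ 2 := by
            rw [← Real.exp_nat_mul]; push_cast; ring_nf
          have e2 : Real.exp ((4 * β + 2) * ‖φ‖ ^ 2) = Real.exp ((2 * β + 1) * ‖φ‖ ^ 2) ^ 2 := by
            rw [← Real.exp_nat_mul]; push_cast; ring_nf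
          rw [e1, e2]
          nlinarith [sq_nonneg (Real.exp (2 * β * ‖w‖ ^ 2) - Real.exp ((2 * β + 1) * ‖φ‖ ^ 2)),
            sq_nonneg (Real.exp (2 * β * ‖w‖ ^ 2)),
            sq_nonneg (Real.exp ((2 * β + 1) * ‖φ‖ ^ 2))]
  · exact ((h.integrable_exp (by positivity) W).add
      (h.integrable_exp (by positivity) Φ)).const_mul C
  · filter_upwards [ae_restrict_mem h.measurableSet] with x hx t _
    have h1 : HasDerivAt (fun t : ℝ => pairVal W x + t • pairVal Φ x) (pairVal Φ x) t := by
      simpa using ((hasDerivAt_id t).smul_const (pairVal Φ x)).const_add (pairVal W x)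
    have h2 : HasGradientAt (H x) (∇ (H x) (pairVal W x + t • pairVal Φ x))
        (pairVal W x + t • pairVal Φ x) :=
      (((h.isC1.contDiff x hx).differentiable one_ne_zero) _).hasGradientAt
    have h3 := h2.hasFDerivAt.comp_hasDerivAt t h1
    rw [InnerProductSpace.toDual_apply_apply, real_inner_comm] at h3
    exact h3

theorem hasFDerivAt_potential (h : IsControlled Ω H C β) (W : Pairs Ω) :
    HasFDerivAt (potential H) (h.potentialDeriv W) W :=
  hasFDerivAt_of_hasLineDerivAt_of_continuous h.hasLineDerivAt_potential
    h.continuous_potentialDeriv W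

end IsControlled

end Potential

/-! ### The Kirchhoff terms -/

section Kirchhoff

variable {F : Type*} [NormedAddCommGroup F]

/-- The Kirchhoff energy `(a |p|² + (b / θ) |p|^{2θ}) / 2`. -/
def kirchhoff (a b θ : ℝ) (p : F) : ℝ := 1 / 2 * (a * ‖p‖ ^ 2 + b / θ * ‖p‖ ^ (2 * θ))

/-- The Kirchhoff coefficient `a + b |p|^{2(θ-1)}`. -/
def kirchhoffCoeff (a b θ : ℝ) (p : F) : ℝ := a + b * ‖p‖ ^ (2 * (θ - 1))

theorem rpow_two_mul (p : F) (s : ℝ) : ‖p‖ ^ (2 * s) = (‖p‖ ^ 2) ^ s := by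
  rw [Real.rpow_mul (norm_nonneg p), Real.rpow_two]

theorem continuous_kirchhoffCoeff (a b : ℝ) {θ : ℝ} (hθ : 1 < θ) :
    Continuous (kirchhoffCoeff (F := F) a b θ) :=
  continuous_const.add (continuous_const.mul (continuous_norm.rpow_const fun _ =>
    Or.inr (by linarith)))

theorem mul_sq_le_kirchhoff {a b θ : ℝ} (hb : 0 ≤ b) (hθ : 1 < θ) (p : F) :
    a / 2 * ‖p‖ ^ 2 ≤ kirchhoff a b θ p := by
  have : 0 ≤ b / θ * ‖p‖ ^ (2 * θ) := by positivity
  rw [kirchhoff]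
  linarith

theorem kirchhoff_zero (a b : ℝ) {θ : ℝ} (hθ : 1 < θ) : kirchhoff a b θ (0 : F) = 0 := by
  have : 2 * θ ≠ 0 := by linarith
  simp [kirchhoff, Real.zero_rpow this]

theorem continuous_kirchhoff (a b : ℝ) {θ : ℝ} (hθ : 1 < θ) :
    Continuous (kirchhoff (F := F) a b θ) :=
  continuous_const.mul ((continuous_const.mul (continuous_norm.pow 2)).add
    (continuous_const.mul (continuous_norm.rpow_const fun _ => Or.inr (by linarith))))

variable [InnerProductSpace ℝ F]

theorem hasFDerivAt_kirchhoff {X : Type*} [NormedAddCommGroup X] [NormedSpace ℝ X] (L : X →L[ℝ] F)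
    (a b : ℝ) {θ : ℝ} (hθ : 1 < θ) (u : X) :
    HasFDerivAt (fun u => kirchhoff a b θ (L u))
      (kirchhoffCoeff a b θ (L u) • (innerSL ℝ (L u)).comp L) u := by
  have h1 : HasFDerivAt (fun u => ‖L u‖ ^ 2) ((2 • innerSL ℝ (L u)).comp L) u :=
    (hasStrictFDerivAt_norm_sq (L u)).hasFDerivAt.comp u L.hasFDerivAt
  have h2 : HasFDerivAt (fun u => ‖L u‖ ^ (2 * θ))
      ((θ * (‖L u‖ ^ 2) ^ (θ - 1)) • (2 • innerSL ℝ (L u)).comp L) u := by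
    simp only [rpow_two_mul]
    exact (Real.hasDerivAt_rpow_const (x := ‖L u‖ ^ 2) (Or.inr hθ.le)).comp_hasFDerivAt u h1
  refine (((h1.const_mul a).add (h2.const_mul (b / θ))).const_mul (1 / 2)).congr_fderiv ?_
  ext v
  simp only [kirchhoffCoeff, rpow_two_mul, smul_apply, add_apply, ContinuousLinearMap.comp_apply,
    smul_eq_mul, nsmul_eq_mul, Nat.cast_ofNat]
  field_simp

/-- Strong monotonicity of the Kirchhoff operator. -/
theorem mul_norm_sub_sq_le_kirchhoff (a : ℝ) {b θ : ℝ} (hb : 0 ≤ b) (hθ : 1 < θ) (p q : F) :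
    a * ‖p - q‖ ^ 2 ≤
      kirchhoffCoeff a b θ p * ⟪p, p - q⟫ - kirchhoffCoeff a b θ q * ⟪q, p - q⟫ := by
  set s := b * ‖p‖ ^ (2 * (θ - 1)) with hs
  set t := b * ‖q‖ ^ (2 * (θ - 1)) with ht
  have hs0 : 0 ≤ s := by positivity
  have ht0 : 0 ≤ t := by positivity
  have hexp : 0 ≤ 2 * (θ - 1) := by linarith
  have e0 : ‖p - q‖ ^ 2 = ‖p‖ ^ 2 - 2 * ⟪p, q⟫ + ‖q‖ ^ 2 := norm_sub_sq_real p q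
  have e1 : ⟪p, p - q⟫ = ‖p‖ ^ 2 - ⟪p, q⟫ := by
    rw [inner_sub_right, real_inner_self_eq_norm_sq]
  have e2 : ⟪q, p - q⟫ = ⟪p, q⟫ - ‖q‖ ^ 2 := by
    rw [inner_sub_right, real_inner_self_eq_norm_sq, real_inner_comm]
  have hcs := real_inner_le_norm p q
  -- Cauchy–Schwarz reduces monotonicity of `p ↦ b |p|^{2(θ-1)} p` to that of its radial profile.
  -- The linear part contributes exactly `a ‖p - q‖²`.
  have key : 0 ≤ (s * ‖p‖ - t * ‖q‖) * (‖p‖ - ‖q‖) := by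
    rcases le_total ‖p‖ ‖q‖ with h | h
    · have hst : s ≤ t := mul_le_mul_of_nonneg_left
        (Real.rpow_le_rpow (norm_nonneg _) h hexp) hb
      exact mul_nonneg_of_nonpos_of_nonpos
        (sub_nonpos.2 (mul_le_mul hst h (norm_nonneg _) ht0)) (sub_nonpos.2 h)
    · have hst : t ≤ s := mul_le_mul_of_nonneg_left
        (Real.rpow_le_rpow (norm_nonneg _) h hexp) hb
      exact mul_nonneg (sub_nonneg.2 (mul_le_mul hst h (norm_nonneg _) hs0)) (sub_nonneg.2 h)
  have h3 := mul_le_mul_of_nonneg_left hcs (add_nonneg hs0 ht0)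
  simp only [kirchhoffCoeff, ← hs, ← ht, e0, e1, e2]
  nlinarith

/-- The nonlocal terms leave `(b / 2)(1/θ - 1/Θ) ‖p‖^{2θ}`, nonnegative because `θ ≤ Θ`. This is why
the superquadraticity exponent must dominate both Kirchhoff exponents. -/
theorem kirchhoff_sub_ge {a b θ Θ : ℝ} (hb : 0 ≤ b) (hθ : 1 < θ) (hΘ : θ ≤ Θ) (p : F) :
    a * (1 / 2 - 1 / (2 * Θ)) * ‖p‖ ^ 2 ≤
      kirchhoff a b θ p - 1 / (2 * Θ) * (kirchhoffCoeff a b θ p * ⟪p, p⟫) := by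
  have h1 : ‖p‖ ^ (2 * (θ - 1)) * ‖p‖ ^ 2 = ‖p‖ ^ (2 * θ) := by
    rw [rpow_two_mul, rpow_two_mul]
    nth_rw 2 [← Real.rpow_one (‖p‖ ^ 2)]
    rw [← Real.rpow_add_of_nonneg (by positivity) (by linarith) zero_le_one, sub_add_cancel]
  have h2 : 0 ≤ ‖p‖ ^ (2 * θ) := by positivity
  have hθ0 : 0 < θ := by linarith
  have h3 : 1 / Θ ≤ 1 / θ := one_div_le_one_div_of_le hθ0 hΘ
  have h4 : kirchhoff a b θ p - 1 / (2 * Θ) * (kirchhoffCoeff a b θ p * ⟪p, p⟫) =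
      a * (1 / 2 - 1 / (2 * Θ)) * ‖p‖ ^ 2 + b / 2 * (1 / θ - 1 / Θ) * ‖p‖ ^ (2 * θ) := by
    rw [real_inner_self_eq_norm_sq, kirchhoff, kirchhoffCoeff, ← h1]
    have : Θ ≠ 0 := by linarith
    field_simp
    ring
  rw [h4]
  have := mul_nonneg (mul_nonneg ((by positivity : 0 ≤ b / 2)) (sub_nonneg.2 h3)) h2
  linarith

end Kirchhoff

/-! ### Critical points of functionals of Kirchhoff type -/

section Functional

variable {X F G : Type*} [NormedAddCommGroup X] [NormedSpace ℝ X]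
  [NormedAddCommGroup F] [InnerProductSpace ℝ F] [NormedAddCommGroup G] [InnerProductSpace ℝ G]

/-- The sum of two Kirchhoff energies minus a multiple of a potential term. -/
def kirchhoffFunctional (L₁ L₂ : X →L[ℝ] F) (J : X → ℝ) (a₁ a₂ b₁ b₂ θ₁ θ₂ lam : ℝ) (W : X) : ℝ :=
  kirchhoff a₁ b₁ θ₁ (L₁ W) + kirchhoff a₂ b₂ θ₂ (L₂ W) - lam * J W

/-- The derivative of `kirchhoffFunctional` if that of the potential term is `⟪N W, T ·⟫`. -/
def kirchhoffFunctionalDeriv (L₁ L₂ : X →L[ℝ] F) (T : X →L[ℝ] G) (N : X → G)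
    (a₁ a₂ b₁ b₂ θ₁ θ₂ lam : ℝ) (W : X) : X →L[ℝ] ℝ :=
  kirchhoffCoeff a₁ b₁ θ₁ (L₁ W) • (innerSL ℝ (L₁ W)).comp L₁ +
    kirchhoffCoeff a₂ b₂ θ₂ (L₂ W) • (innerSL ℝ (L₂ W)).comp L₂ -
      lam • (innerSL ℝ (N W)).comp T

theorem kirchhoffFunctionalDeriv_apply (L₁ L₂ : X →L[ℝ] F) (T : X →L[ℝ] G) (N : X → G)
    (a₁ a₂ b₁ b₂ θ₁ θ₂ lam : ℝ) (W Φ : X) :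
    kirchhoffFunctionalDeriv L₁ L₂ T N a₁ a₂ b₁ b₂ θ₁ θ₂ lam W Φ =
      kirchhoffCoeff a₁ b₁ θ₁ (L₁ W) * ⟪L₁ W, L₁ Φ⟫ +
        kirchhoffCoeff a₂ b₂ θ₂ (L₂ W) * ⟪L₂ W, L₂ Φ⟫ - lam * ⟪N W, T Φ⟫ := rfl

theorem eq_of_kirchhoffFunctionalDeriv_eq_zero {L₁ L₂ : X →L[ℝ] F} {T : X →L[ℝ] G} {N : X → G}
    {a₁ a₂ b₁ b₂ θ₁ θ₂ lam : ℝ} {W : X}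
    (h : kirchhoffFunctionalDeriv L₁ L₂ T N a₁ a₂ b₁ b₂ θ₁ θ₂ lam W = 0) (Φ : X) :
    kirchhoffCoeff a₁ b₁ θ₁ (L₁ W) * ⟪L₁ W, L₁ Φ⟫ +
      kirchhoffCoeff a₂ b₂ θ₂ (L₂ W) * ⟪L₂ W, L₂ Φ⟫ = lam * ⟪N W, T Φ⟫ := by
  rw [← sub_eq_zero, ← kirchhoffFunctionalDeriv_apply, h, zero_apply]

/-- The assumptions on the potential term of a functional of Kirchhoff type: it is `C¹`, with
derivative factoring through a compact map, superquadratic, and coercivity holds. -/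
structure IsKirchhoffSetting (L₁ L₂ : X →L[ℝ] F) (T : X →L[ℝ] G) (N : X → G) (J : X → ℝ)
    (a₁ a₂ Θ κ : ℝ) : Prop where
  hasFDerivAt : ∀ W, HasFDerivAt J ((innerSL ℝ (N W)).comp T) W
  continuous_N : Continuous N
  κ_pos : 0 < κ
  one_lt : 1 < Θ
  coercive : ∀ W, κ * ‖W‖ ^ 2 ≤ a₁ * ‖L₁ W‖ ^ 2 + a₂ * ‖L₂ W‖ ^ 2
  nonneg : ∀ W, 0 ≤ J W
  superquadratic : ∀ W, 2 * Θ * J W ≤ ⟪N W, T W⟫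
  compact : ∀ (W : ℕ → X) (r : ℝ), (∀ n, ‖W n‖ ≤ r) →
    ∃ ns : ℕ → ℕ, StrictMono ns ∧ CauchySeq fun n => T (W (ns n))

namespace IsKirchhoffSetting

variable {L₁ L₂ : X →L[ℝ] F} {T : X →L[ℝ] G} {N : X → G} {J : X → ℝ}
  {a₁ a₂ b₁ b₂ θ₁ θ₂ lam Θ κ : ℝ}

theorem hasFDerivAt_functional (S : IsKirchhoffSetting L₁ L₂ T N J a₁ a₂ Θ κ)
    (hθ₁ : 1 < θ₁) (hθ₂ : 1 < θ₂) (W : X) :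
    HasFDerivAt (kirchhoffFunctional L₁ L₂ J a₁ a₂ b₁ b₂ θ₁ θ₂ lam)
      (kirchhoffFunctionalDeriv L₁ L₂ T N a₁ a₂ b₁ b₂ θ₁ θ₂ lam W) W :=
  ((hasFDerivAt_kirchhoff L₁ a₁ b₁ hθ₁ W).add (hasFDerivAt_kirchhoff L₂ a₂ b₂ hθ₂ W)).sub
    ((S.hasFDerivAt W).const_mul lam)

theorem continuous_deriv (S : IsKirchhoffSetting L₁ L₂ T N J a₁ a₂ Θ κ)
    (hθ₁ : 1 < θ₁) (hθ₂ : 1 < θ₂) :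
    Continuous (kirchhoffFunctionalDeriv L₁ L₂ T N a₁ a₂ b₁ b₂ θ₁ θ₂ lam) := by
  have h1 : Continuous fun W => (innerSL ℝ (L₁ W)).comp L₁ :=
    ((innerSL ℝ).continuous.comp L₁.continuous).clm_comp continuous_const
  have h2 : Continuous fun W => (innerSL ℝ (L₂ W)).comp L₂ :=
    ((innerSL ℝ).continuous.comp L₂.continuous).clm_comp continuous_const
  have h3 : Continuous fun W => (innerSL ℝ (N W)).comp T :=
    ((innerSL ℝ).continuous.comp S.continuous_N).clm_comp continuous_const
  exact ((((continuous_kirchhoffCoeff a₁ b₁ hθ₁).comp L₁.continuous).smul h1).add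
    (((continuous_kirchhoffCoeff a₂ b₂ hθ₂).comp L₂.continuous).smul h2)).sub (h3.const_smul lam)

/-- The Ambrosetti–Rabinowitz estimate. -/
theorem mul_norm_sq_le (S : IsKirchhoffSetting L₁ L₂ T N J a₁ a₂ Θ κ) (hb₁ : 0 ≤ b₁)
    (hb₂ : 0 ≤ b₂) (hθ₁ : 1 < θ₁) (hθ₂ : 1 < θ₂) (hΘ₁ : θ₁ ≤ Θ) (hΘ₂ : θ₂ ≤ Θ) (hlam : 0 ≤ lam)
    (W : X) : κ * (1 / 2 - 1 / (2 * Θ)) * ‖W‖ ^ 2 ≤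
      kirchhoffFunctional L₁ L₂ J a₁ a₂ b₁ b₂ θ₁ θ₂ lam W +
        ‖kirchhoffFunctionalDeriv L₁ L₂ T N a₁ a₂ b₁ b₂ θ₁ θ₂ lam W‖ * ‖W‖ := by
  set D := kirchhoffFunctionalDeriv L₁ L₂ T N a₁ a₂ b₁ b₂ θ₁ θ₂ lam W with hD
  have hΘ := S.one_lt
  have hs : 0 ≤ 1 / 2 - 1 / (2 * Θ) := by
    rw [sub_nonneg]; exact one_div_le_one_div_of_le two_pos (by linarith)
  have h1 := kirchhoff_sub_ge (a := a₁) hb₁ hθ₁ hΘ₁ (L₁ W)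
  have h2 := kirchhoff_sub_ge (a := a₂) hb₂ hθ₂ hΘ₂ (L₂ W)
  have h3 := mul_le_mul_of_nonneg_right (S.coercive W) hs
  have h4 : lam * J W ≤ 1 / (2 * Θ) * (lam * ⟪N W, T W⟫) := by
    have := mul_le_mul_of_nonneg_left (S.superquadratic W) hlam
    rw [div_mul_eq_mul_div, le_div_iff₀ (by linarith)]
    linarith
  have h5 : D W = kirchhoffCoeff a₁ b₁ θ₁ (L₁ W) * ⟪L₁ W, L₁ W⟫ +
        kirchhoffCoeff a₂ b₂ θ₂ (L₂ W) * ⟪L₂ W, L₂ W⟫ - lam * ⟪N W, T W⟫ := rfl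
  have h6 : -(‖D‖ * ‖W‖) ≤ 1 / (2 * Θ) * D W := by
    have h7 := D.le_opNorm W
    rw [Real.norm_eq_abs] at h7
    have h8 : 1 / (2 * Θ) ≤ 1 := by rw [div_le_one (by linarith)]; linarith
    have h9 : (0 : ℝ) ≤ 1 / (2 * Θ) := by positivity
    have h10 : |1 / (2 * Θ) * D W| ≤ ‖D‖ * ‖W‖ := by
      rw [abs_mul, abs_of_nonneg h9]
      exact (mul_le_of_le_one_left (abs_nonneg _) h8).trans h7
    exact (abs_le.1 h10).1
  rw [h5] at h6
  rw [kirchhoffFunctional]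
  linarith

/-- Testing the difference of the derivatives with `V - W`: the Kirchhoff terms are strongly
monotone, and the potential term sees `V - W` only through the compact map `T`. For almost critical
sequences with `N` bounded, compactness of `T` thus yields strong convergence. -/
theorem mul_norm_sub_sq_le (S : IsKirchhoffSetting L₁ L₂ T N J a₁ a₂ Θ κ) (hb₁ : 0 ≤ b₁)
    (hb₂ : 0 ≤ b₂) (hθ₁ : 1 < θ₁) (hθ₂ : 1 < θ₂) (hlam : 0 ≤ lam) (V W : X) :
    κ * ‖V - W‖ ^ 2 ≤ (‖kirchhoffFunctionalDeriv L₁ L₂ T N a₁ a₂ b₁ b₂ θ₁ θ₂ lam V‖ +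
      ‖kirchhoffFunctionalDeriv L₁ L₂ T N a₁ a₂ b₁ b₂ θ₁ θ₂ lam W‖) * ‖V - W‖ +
        lam * (‖N V‖ + ‖N W‖) * ‖T V - T W‖ := by
  set D := kirchhoffFunctionalDeriv L₁ L₂ T N a₁ a₂ b₁ b₂ θ₁ θ₂ lam
  have h1 := mul_norm_sub_sq_le_kirchhoff a₁ hb₁ hθ₁ (L₁ V) (L₁ W)
  have h2 := mul_norm_sub_sq_le_kirchhoff a₂ hb₂ hθ₂ (L₂ V) (L₂ W)
  have h3 := S.coercive (V - W)
  simp only [map_sub] at h3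
  have hDV : D V (V - W) = kirchhoffCoeff a₁ b₁ θ₁ (L₁ V) * ⟪L₁ V, L₁ V - L₁ W⟫ +
      kirchhoffCoeff a₂ b₂ θ₂ (L₂ V) * ⟪L₂ V, L₂ V - L₂ W⟫ - lam * ⟪N V, T V - T W⟫ := by
    rw [← map_sub L₁, ← map_sub L₂, ← map_sub T]; rfl
  have hDW : D W (V - W) = kirchhoffCoeff a₁ b₁ θ₁ (L₁ W) * ⟪L₁ W, L₁ V - L₁ W⟫ +
      kirchhoffCoeff a₂ b₂ θ₂ (L₂ W) * ⟪L₂ W, L₂ V - L₂ W⟫ - lam * ⟪N W, T V - T W⟫ := by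
    rw [← map_sub L₁, ← map_sub L₂, ← map_sub T]; rfl
  have h4 : D V (V - W) ≤ ‖D V‖ * ‖V - W‖ := (le_abs_self _).trans ((D V).le_opNorm _)
  have h5 : -(‖D W‖ * ‖V - W‖) ≤ D W (V - W) := (abs_le.1 ((D W).le_opNorm (V - W))).1
  have h6 := mul_le_mul_of_nonneg_left (real_inner_le_norm (N V) (T V - T W)) hlam
  have h7 := mul_le_mul_of_nonneg_left (abs_le.1 (abs_real_inner_le_norm (N W) (T V - T W))).1 hlam
  linarith

variable [CompleteSpace X]

/-- The Palais–Smale condition at low levels. -/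
theorem exists_critical_of_palaisSmale (S : IsKirchhoffSetting L₁ L₂ T N J a₁ a₂ Θ κ)
    (hb₁ : 0 ≤ b₁) (hb₂ : 0 ≤ b₂) (hθ₁ : 1 < θ₁) (hθ₂ : 1 < θ₂) (hΘ₁ : θ₁ ≤ Θ) (hΘ₂ : θ₂ ≤ Θ)
    (hlam : 0 ≤ lam) {r M c : ℝ} (hr : 0 < r) (hM : ∀ W, ‖W‖ ≤ r → ‖N W‖ ≤ M)
    (hc : c < κ * (1 / 2 - 1 / (2 * Θ)) * r ^ 2)
    (hPS : ∀ ε > 0, ∃ W, |kirchhoffFunctional L₁ L₂ J a₁ a₂ b₁ b₂ θ₁ θ₂ lam W - c| ≤ ε ∧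
      ‖kirchhoffFunctionalDeriv L₁ L₂ T N a₁ a₂ b₁ b₂ θ₁ θ₂ lam W‖ ≤ ε) :
    ∃ W, kirchhoffFunctional L₁ L₂ J a₁ a₂ b₁ b₂ θ₁ θ₂ lam W = c ∧
      kirchhoffFunctionalDeriv L₁ L₂ T N a₁ a₂ b₁ b₂ θ₁ θ₂ lam W = 0 := by
  set I := kirchhoffFunctional L₁ L₂ J a₁ a₂ b₁ b₂ θ₁ θ₂ lam with hI
  set D := kirchhoffFunctionalDeriv L₁ L₂ T N a₁ a₂ b₁ b₂ θ₁ θ₂ lam with hD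
  set k := κ * (1 / 2 - 1 / (2 * Θ)) with hk
  have hkpos : 0 < k := by
    refine mul_pos S.κ_pos (sub_pos.2 (one_div_lt_one_div_of_lt two_pos ?_))
    linarith [S.one_lt]
  -- The second condition keeps the error below the gap in `c < k r²`. The first makes `s (k s -
  -- ε₀)` at least `r (k r - ε₀)` for `s ≥ r`, so the Ambrosetti–Rabinowitz estimate excludes norms
  -- above `r`.
  obtain ⟨ε₀, hε₀, hε₁, hε₂⟩ : ∃ ε₀ > 0, ε₀ ≤ k * r ∧ c + ε₀ + ε₀ * r < k * r ^ 2 := by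
    refine ⟨min (k * r) ((k * r ^ 2 - c) / (2 * (1 + r))), ?_, min_le_left _ _, ?_⟩
    · exact lt_min (by positivity) (div_pos (by linarith) (by positivity))
    · have h1 := min_le_right (k * r) ((k * r ^ 2 - c) / (2 * (1 + r)))
      rw [le_div_iff₀ (by positivity)] at h1
      nlinarith
  have hs : ∀ n : ℕ, (0 : ℝ) < min ε₀ (1 / (n + 1)) := fun n =>
    lt_min hε₀ Nat.one_div_pos_of_nat
  choose W hWI hWD using fun n => hPS _ (hs n)
  have hWr : ∀ n, ‖W n‖ ≤ r := by
    intro n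
    by_contra! hlt
    have h1 : k * ‖W n‖ ^ 2 ≤ I (W n) + ‖D (W n)‖ * ‖W n‖ :=
      S.mul_norm_sq_le hb₁ hb₂ hθ₁ hθ₂ hΘ₁ hΘ₂ hlam (W n)
    have h2 := (abs_le.1 ((hWI n).trans (min_le_left _ _))).2
    have h3 := (hWD n).trans (min_le_left _ _)
    have h4 : ‖D (W n)‖ * ‖W n‖ ≤ ε₀ * ‖W n‖ := mul_le_mul_of_nonneg_right h3 (norm_nonneg _)
    have h5 : r * (k * r - ε₀) ≤ ‖W n‖ * (k * ‖W n‖ - ε₀) := by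
      refine mul_le_mul hlt.le ?_ (by linarith) (norm_nonneg _)
      linarith [mul_le_mul_of_nonneg_left hlt.le hkpos.le]
    nlinarith
  obtain ⟨ns, hns, hcauchy⟩ := S.compact W r hWr
  have hd0 : Tendsto (fun n : ℕ => (1 : ℝ) / ((n : ℝ) + 1)) atTop (𝓝 0) :=
    tendsto_one_div_add_atTop_nhds_zero_nat
  have hDlim : Tendsto (fun n => ‖D (W n)‖) atTop (𝓝 0) :=
    squeeze_zero (fun n => norm_nonneg _) (fun n => (hWD n).trans (min_le_right _ _)) hd0
  have hIlim : Tendsto (fun n => I (W n)) atTop (𝓝 c) := by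
    rw [tendsto_iff_norm_sub_tendsto_zero]
    exact squeeze_zero (fun n => norm_nonneg _) (fun n => (hWI n).trans (min_le_right _ _)) hd0
  have hM0 : 0 ≤ M := (norm_nonneg _).trans (hM 0 (by simpa using hr.le))
  have hWc : CauchySeq fun n => W (ns n) := by
    rw [Metric.cauchySeq_iff]
    intro ε hε
    -- The two error terms are at most `4 r η` and `2 lam M η`; the `+ 1` makes the final inequality
    -- strict.
    set η := κ * ε ^ 2 / (4 * r + 2 * lam * M + 1) with hη
    have hden : 0 < 4 * r + 2 * lam * M + 1 := by positivity
    have hηpos : 0 < η := div_pos (mul_pos S.κ_pos (by positivity)) hden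
    obtain ⟨N1, hN1⟩ := Metric.cauchySeq_iff.1 hcauchy η hηpos
    obtain ⟨N2, hN2⟩ := eventually_atTop.1
      ((hDlim.comp hns.tendsto_atTop).eventually_lt_const hηpos)
    refine ⟨max N1 N2, fun m hm n hn => ?_⟩
    have h1 := hN1 m (le_of_max_le_left hm) n (le_of_max_le_left hn)
    have h2 : ‖D (W (ns m))‖ < η := hN2 m (le_of_max_le_right hm)
    have h3 : ‖D (W (ns n))‖ < η := hN2 n (le_of_max_le_right hn)
    rw [dist_eq_norm] at h1 ⊢
    have h4 : κ * ‖W (ns m) - W (ns n)‖ ^ 2 ≤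
        (‖D (W (ns m))‖ + ‖D (W (ns n))‖) * ‖W (ns m) - W (ns n)‖ +
          lam * (‖N (W (ns m))‖ + ‖N (W (ns n))‖) * ‖T (W (ns m)) - T (W (ns n))‖ :=
      S.mul_norm_sub_sq_le hb₁ hb₂ hθ₁ hθ₂ hlam _ _
    have h5 : ‖W (ns m) - W (ns n)‖ ≤ 2 * r := by
      linarith [norm_sub_le (W (ns m)) (W (ns n)), hWr (ns m), hWr (ns n)]
    have h6 : (‖D (W (ns m))‖ + ‖D (W (ns n))‖) * ‖W (ns m) - W (ns n)‖ ≤ (η + η) * (2 * r) := by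
      gcongr
    have h7 : lam * (‖N (W (ns m))‖ + ‖N (W (ns n))‖) * ‖T (W (ns m)) - T (W (ns n))‖ ≤
        lam * (M + M) * η := by
      gcongr
      · exact hM _ (hWr _)
      · exact hM _ (hWr _)
    have h8 : η * (4 * r + 2 * lam * M + 1) = κ * ε ^ 2 := div_mul_cancel₀ _ hden.ne'
    have h9 : κ * ‖W (ns m) - W (ns n)‖ ^ 2 < κ * ε ^ 2 := by linarith
    exact lt_of_pow_lt_pow_left₀ 2 hε.le (lt_of_mul_lt_mul_left h9 S.κ_pos.le)
  obtain ⟨V, hV⟩ := cauchySeq_tendsto_of_complete hWc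
  have hIc : Continuous I := continuous_iff_continuousAt.2 fun x =>
    (S.hasFDerivAt_functional hθ₁ hθ₂ x).continuousAt
  have hDc : Continuous D := S.continuous_deriv hθ₁ hθ₂
  refine ⟨V, tendsto_nhds_unique ((hIc.tendsto V).comp hV) (hIlim.comp hns.tendsto_atTop), ?_⟩
  exact norm_eq_zero.1 (tendsto_nhds_unique ((hDc.norm.tendsto V).comp hV)
    (hDlim.comp hns.tendsto_atTop))

/-- Existence of a critical point of positive energy for large `lam`. -/
theorem exists_critical_pos (S : IsKirchhoffSetting L₁ L₂ T N J a₁ a₂ Θ κ)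
    (hb₁ : 0 ≤ b₁) (hb₂ : 0 ≤ b₂) (hθ₁ : 1 < θ₁) (hθ₂ : 1 < θ₂) (hΘ₁ : θ₁ ≤ Θ) (hΘ₂ : θ₂ ≤ Θ)
    {r M : ℝ} (hr : 0 < r) (hM : ∀ W, ‖W‖ ≤ r → ‖N W‖ ≤ M)
    (hsmall : ∀ ε > 0, ∃ ρ > 0, ∀ W, ‖W‖ ≤ ρ → J W ≤ ε * ‖W‖ ^ 2)
    {e : X} (he : e ≠ 0) (hJe : ∀ t : ℝ, 0 < t → 0 < J (t • e)) :
    ∃ lamStar : ℝ, 0 < lamStar ∧ ∀ lam : ℝ, lamStar ≤ lam → ∃ W,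
      0 < kirchhoffFunctional L₁ L₂ J a₁ a₂ b₁ b₂ θ₁ θ₂ lam W ∧
        kirchhoffFunctionalDeriv L₁ L₂ T N a₁ a₂ b₁ b₂ θ₁ θ₂ lam W = 0 := by
  -- Half of the level below which almost critical sequences are compact.
  set η := κ * (1 / 2 - 1 / (2 * Θ)) * r ^ 2 / 2 with hη
  have hηpos : 0 < η := by
    have : 0 < 1 / 2 - 1 / (2 * Θ) :=
      sub_pos.2 (one_div_lt_one_div_of_lt two_pos (by linarith [S.one_lt]))
    have := S.κ_pos
    positivity
  let A : ℝ → ℝ := fun t => kirchhoff a₁ b₁ θ₁ (L₁ (t • e)) + kirchhoff a₂ b₂ θ₂ (L₂ (t • e))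
  have hAc : Continuous A :=
    ((continuous_kirchhoff a₁ b₁ hθ₁).comp (by fun_prop : Continuous fun t : ℝ => L₁ (t • e))).add
      ((continuous_kirchhoff a₂ b₂ hθ₂).comp (by fun_prop : Continuous fun t : ℝ => L₂ (t • e)))
  have hA0 : A 0 = 0 := by simp [A, kirchhoff_zero _ _ hθ₁, kirchhoff_zero _ _ hθ₂]
  have hJc : Continuous J := continuous_iff_continuousAt.2 fun x => (S.hasFDerivAt x).continuousAt
  obtain ⟨δ, hδ, hAδ⟩ := Metric.continuousAt_iff.1 (hAc.continuousAt (x := 0)) η hηpos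
  set t₀ := min (δ / 2) 1 with ht₀
  have ht₀pos : 0 < t₀ := lt_min (half_pos hδ) one_pos
  have hAsmall : ∀ t, 0 ≤ t → t ≤ t₀ → A t ≤ η := by
    intro t h0 h1
    have h2 : t < δ := by linarith [h1.trans (min_le_left _ _)]
    have h3 := hAδ (x := t) (by rw [Real.dist_eq, sub_zero, abs_of_nonneg h0]; exact h2)
    rw [Real.dist_eq, hA0, sub_zero] at h3
    exact ((le_abs_self _).trans_lt h3).le
  obtain ⟨B, hB⟩ := (isCompact_Icc (a := (0 : ℝ)) (b := 1)).exists_bound_of_continuousOn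
    hAc.continuousOn
  have hJt : Continuous fun t : ℝ => J (t • e) := hJc.comp (by fun_prop)
  -- On `[0, t₀]` the Kirchhoff energy alone is at most `η`. On `[t₀, 1]` it is at most `B` and `J`
  -- is at least `J (τ • e) > 0`, so `lam ≥ (B + 1) / J (τ • e)` forces the functional below `-1`.
  -- The choice of `t₀` does not involve `lam`.
  obtain ⟨τ, hτ, hτmin⟩ := (isCompact_Icc (a := t₀) (b := 1)).exists_isMinOn
    ⟨1, min_le_right _ _, le_rfl⟩ hJt.continuousOn
  have hj : 0 < J (τ • e) := hJe τ (ht₀pos.trans_le hτ.1)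
  have hB0 : 0 ≤ B := (norm_nonneg _).trans (hB 0 (by simp))
  refine ⟨(B + 1) / J (τ • e), by positivity, fun lam hlam => ?_⟩
  have hlampos : 0 < lam := lt_of_lt_of_le (by positivity) hlam
  rw [div_le_iff₀ hj] at hlam
  set I := kirchhoffFunctional L₁ L₂ J a₁ a₂ b₁ b₂ θ₁ θ₂ lam with hI
  have hIA : ∀ t : ℝ, I (t • e) = A t - lam * J (t • e) := fun t => rfl
  have hbig : ∀ t ∈ Icc t₀ 1, I (t • e) ≤ -1 := by
    intro t ht
    have h1 := mul_le_mul_of_nonneg_left (isMinOn_iff.1 hτmin t ht) hlampos.le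
    have h2 := (le_abs_self _).trans (hB t ⟨ht₀pos.le.trans ht.1, ht.2⟩)
    rw [hIA]
    linarith
  -- The Kirchhoff terms give at least `κ/2 ‖W‖²` and the potential takes at most half of it. The
  -- radius of the barrier may depend on `lam`, since only positivity of the level is needed.
  obtain ⟨ρ₀, hρ₀, hsm⟩ := hsmall (κ / (4 * lam)) (div_pos S.κ_pos (by positivity))
  set ρ := min ρ₀ (‖e‖ / 2) with hρ
  have hepos : 0 < ‖e‖ := norm_pos_iff.2 he
  have hρpos : 0 < ρ := lt_min hρ₀ (half_pos hepos)
  have hρe : ρ < ‖e‖ := (min_le_right _ _).trans_lt (half_lt_self hepos)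
  have hα : ∀ W, ‖W‖ = ρ → κ / 4 * ρ ^ 2 ≤ I W := by
    intro W hW
    have h1 := hsm W (hW.le.trans (min_le_left _ _))
    have h2 := S.coercive W
    have h3 := mul_sq_le_kirchhoff (a := a₁) hb₁ hθ₁ (L₁ W)
    have h4 := mul_sq_le_kirchhoff (a := a₂) hb₂ hθ₂ (L₂ W)
    have h5 : lam * J W ≤ κ / 4 * ‖W‖ ^ 2 := by
      calc lam * J W ≤ lam * (κ / (4 * lam) * ‖W‖ ^ 2) := by gcongr
        _ = κ / 4 * ‖W‖ ^ 2 := by field_simp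
    have h6 : 0 ≤ κ * ‖W‖ ^ 2 := mul_nonneg S.κ_pos.le (sq_nonneg _)
    rw [hI, kirchhoffFunctional, ← hW]
    linarith
  have hαpos : 0 < κ / 4 * ρ ^ 2 := mul_pos (by linarith [S.κ_pos]) (by positivity)
  have hI0 : I 0 < κ / 4 * ρ ^ 2 := by
    have h1 := hIA 0
    rw [zero_smul, hA0] at h1
    rw [h1]
    linarith [mul_nonneg hlampos.le (S.nonneg 0)]
  have hIe : I e < κ / 4 * ρ ^ 2 := by
    have h1 := hbig 1 ⟨min_le_right _ _, le_rfl⟩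
    rw [one_smul] at h1
    linarith
  have hκ : ∀ t ∈ Icc (0 : ℝ) 1, I (t • e) ≤ η := by
    intro t ht
    rcases le_total t t₀ with h | h
    · rw [hIA]
      linarith [hAsmall t ht.1 h, mul_nonneg hlampos.le (S.nonneg (t • e))]
    · linarith [hbig t ⟨h, ht.2⟩]
  obtain ⟨c, hc1, hc2, hPS⟩ := mountain_pass (S.hasFDerivAt_functional hθ₁ hθ₂)
    (S.continuous_deriv hθ₁ hθ₂) hρpos hρe hI0 hIe hα hκ
  obtain ⟨W, hW1, hW2⟩ := S.exists_critical_of_palaisSmale hb₁ hb₂ hθ₁ hθ₂ hΘ₁ hΘ₂ hlampos.le hr hM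
    (c := c) (by linarith) hPS
  exact ⟨W, hαpos.trans_le (hc1.trans_eq hW1.symm), hW2⟩

end IsKirchhoffSetting

end Functional

/-! ### Estimates for the potential term -/

section PotentialEstimates

theorem integrableOn_norm_pairVal_sq {Ω : Set Plane} (W : Pairs Ω) :
    IntegrableOn (fun x => ‖pairVal W x‖ ^ 2) Ω := by
  refine (L2.integrable_inner (𝕜 := ℝ) (toL2 Ω W) (toL2 Ω W)).congr ?_
  filter_upwards [coeFn_toL2 W] with x hx
  rw [hx, real_inner_self_eq_norm_sq]

theorem integral_norm_pairVal_sq {Ω : Set Plane} (W : Pairs Ω) :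
    ∫ x in Ω, ‖pairVal W x‖ ^ 2 = ‖toL2 Ω W‖ ^ 2 := by
  rw [← real_inner_self_eq_norm_sq, L2.inner_def]
  refine integral_congr_ae ?_
  filter_upwards [coeFn_toL2 W] with x hx
  rw [hx, real_inner_self_eq_norm_sq]

/-- Rescale `s = r τ`: half of the exponent `α τ²` absorbs `exp(β s²)` and the other half absorbs
`τ³`. With `r = ‖W‖` the exponential on the right is the one bounded by Trudinger, and `r³` is a
gain over `r²`. -/
theorem cube_mul_exp_le {α β r s : ℝ} (hα : 0 < α) (hr : 0 < r) (hβ : β * r ^ 2 ≤ α / 2)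
    (hs : 0 ≤ s) : s ^ 3 * Real.exp (β * s ^ 2) ≤
      (1 + 8 / α ^ 2) * r ^ 3 * Real.exp (α / r ^ 2 * s ^ 2) := by
  obtain ⟨τ, hτ, rfl⟩ : ∃ τ, 0 ≤ τ ∧ s = r * τ := ⟨s / r, by positivity, by field_simp⟩
  have h1 : α / r ^ 2 * (r * τ) ^ 2 = α / 2 * τ ^ 2 + α / 2 * τ ^ 2 := by
    field_simp; ring
  have h2 : Real.exp (β * (r * τ) ^ 2) ≤ Real.exp (α / 2 * τ ^ 2) := by
    refine Real.exp_le_exp.2 ?_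
    calc β * (r * τ) ^ 2 = β * r ^ 2 * τ ^ 2 := by ring
      _ ≤ _ := by gcongr
  have h3 : τ ^ 3 ≤ (1 + 8 / α ^ 2) * Real.exp (α / 2 * τ ^ 2) := by
    have h4 := Real.quadratic_le_exp_of_nonneg (x := α / 2 * τ ^ 2) (by positivity)
    have h5 : 8 / α ^ 2 * ((α / 2 * τ ^ 2) ^ 2 / 2) = τ ^ 4 := by field_simp; ring
    have h6 : τ ^ 3 ≤ 1 + τ ^ 4 := by
      nlinarith [sq_nonneg (τ ^ 2 - τ), sq_nonneg (τ - 1), sq_nonneg (τ ^ 2 - 1), sq_nonneg τ]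
    have h7 : (0 : ℝ) ≤ α / 2 * τ ^ 2 := by positivity
    have h8 : 8 / α ^ 2 * ((α / 2 * τ ^ 2) ^ 2 / 2) ≤ 8 / α ^ 2 * Real.exp (α / 2 * τ ^ 2) := by
      gcongr; linarith
    have h9 := Real.one_le_exp h7
    rw [add_mul]
    linarith
  rw [h1, Real.exp_add]
  calc (r * τ) ^ 3 * Real.exp (β * (r * τ) ^ 2) ≤
        r ^ 3 * ((1 + 8 / α ^ 2) * Real.exp (α / 2 * τ ^ 2)) * Real.exp (α / 2 * τ ^ 2) := by
        rw [mul_pow]; gcongr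
    _ = _ := by ring

namespace IsControlled

variable {Ω : Set Plane} {H : Plane → Plane → ℝ} {C β : ℝ}

theorem eq_zero (h : IsControlled Ω H C β) {x : Plane} (hx : x ∈ Ω) : H x 0 = 0 :=
  le_antisymm (by simpa using h.le_grad x hx 0) (h.nonneg x hx 0)

/-- Superlinearity handles `‖w‖ < δ`; elsewhere the factor `‖w‖² / δ² ≥ 1` can be inserted into the
growth bound. -/
theorem exists_le_sq_add_cube (h : IsControlled Ω H C β) (hSL : CondSL Ω H) {ε : ℝ} (hε : 0 < ε) :
    ∃ M : ℝ, 0 ≤ M ∧ ∀ x ∈ Ω, ∀ w : Plane,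
      H x w ≤ ε * ‖w‖ ^ 2 + M * (‖w‖ ^ 3 * Real.exp (β * ‖w‖ ^ 2)) := by
  obtain ⟨δ, hδ, hsl⟩ := hSL ε hε
  have hC := h.C_nonneg
  refine ⟨C / δ ^ 2, by positivity, fun x hx w => ?_⟩
  rcases eq_or_ne w 0 with rfl | hw
  · simp [h.eq_zero hx]
  have hw' : 0 < ‖w‖ := norm_pos_iff.2 hw
  rcases lt_or_ge ‖w‖ δ with hwδ | hwδ
  · have h1 := hsl x hx w hw' hwδ
    rw [div_lt_iff₀ (by positivity)] at h1
    have h2 : 0 ≤ C / δ ^ 2 * (‖w‖ ^ 3 * Real.exp (β * ‖w‖ ^ 2)) := by positivity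
    linarith [le_abs_self (H x w)]
  · have h1 : 1 ≤ ‖w‖ ^ 2 / δ ^ 2 := by
      rw [one_le_div (by positivity)]; gcongr
    calc H x w ≤ ‖w‖ * ‖∇ (H x) w‖ := h.le_grad x hx w
      _ ≤ ‖w‖ * (C * Real.exp (β * ‖w‖ ^ 2)) := by gcongr; exact h.growth x hx w
      _ ≤ ‖w‖ * (C * Real.exp (β * ‖w‖ ^ 2)) * (‖w‖ ^ 2 / δ ^ 2) :=
          le_mul_of_one_le_right (by positivity) h1
      _ = C / δ ^ 2 * (‖w‖ ^ 3 * Real.exp (β * ‖w‖ ^ 2)) := by ring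
      _ ≤ _ := le_add_of_nonneg_left (by positivity)

theorem potential_nonneg (h : IsControlled Ω H C β) (W : Pairs Ω) : 0 ≤ potential H W :=
  setIntegral_nonneg h.measurableSet fun x hx => h.nonneg x hx _

theorem potential_le_of_norm_le (h : IsControlled Ω H C β) {ε M α r t : ℝ} {K : ℝ≥0∞}
    {W : Pairs Ω} (hα : 0 < α) (hr : 0 < r) (hε : 0 ≤ ε) (hM : 0 ≤ M) (hβr : β * r ^ 2 ≤ α / 2)
    (hbd : ∀ x ∈ Ω, ∀ w : Plane,
      H x w ≤ ε * ‖w‖ ^ 2 + M * (‖w‖ ^ 3 * Real.exp (β * ‖w‖ ^ 2)))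
    (hK : K ≠ ⊤) (hWK : expInt (α / r ^ 2) W ≤ K) (hWt : ‖toL2 Ω W‖ ≤ t * r) :
    potential H W ≤ (ε * t ^ 2 + M * (1 + 8 / α ^ 2) * K.toReal * r) * r ^ 2 := by
  have hq : 0 ≤ α / r ^ 2 := by positivity
  have hexp : ∫ x in Ω, Real.exp (α / r ^ 2 * ‖pairVal W x‖ ^ 2) ≤ K.toReal := by
    rw [integral_eq_lintegral_of_nonneg_ae (Eventually.of_forall fun x => (Real.exp_pos _).le)
      (h.integrable_exp hq W).1]
    exact ENNReal.toReal_mono hK hWK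
  have hsq : ∫ x in Ω, ‖pairVal W x‖ ^ 2 ≤ t ^ 2 * r ^ 2 := by
    rw [integral_norm_pairVal_sq, ← mul_pow]
    exact pow_le_pow_left₀ (norm_nonneg _) hWt 2
  have h1 : potential H W ≤ ∫ x in Ω, (ε * ‖pairVal W x‖ ^ 2 +
      M * (1 + 8 / α ^ 2) * r ^ 3 * Real.exp (α / r ^ 2 * ‖pairVal W x‖ ^ 2)) := by
    refine setIntegral_mono_on (h.integrable_potential W)
      (((integrableOn_norm_pairVal_sq W).const_mul _).add ((h.integrable_exp hq W).const_mul _))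
      h.measurableSet fun x hx => (hbd x hx _).trans ?_
    have := mul_le_mul_of_nonneg_left (cube_mul_exp_le hα hr hβr (norm_nonneg (pairVal W x))) hM
    linarith
  rw [integral_add ((integrableOn_norm_pairVal_sq W).const_mul _)
    ((h.integrable_exp hq W).const_mul _), integral_const_mul, integral_const_mul] at h1
  have h2 := mul_le_mul_of_nonneg_left hsq hε
  have h3 := mul_le_mul_of_nonneg_left hexp
    (show 0 ≤ M * (1 + 8 / α ^ 2) * r ^ 3 by positivity)
  linarith

theorem potential_zero (h : IsControlled Ω H C β) : potential H (0 : Pairs Ω) = 0 := by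
  refine integral_eq_zero_of_ae ?_
  filter_upwards [pairVal_smul 0 (0 : Pairs Ω), ae_restrict_mem h.measurableSet] with x hx hxΩ
  rw [smul_zero, zero_smul] at hx
  rw [hx]
  exact h.eq_zero hxΩ

/-- The potential term is superquadratic at the origin. -/
theorem exists_potential_le (h : IsControlled Ω H C β) (hSL : CondSL Ω H) {ε : ℝ} (hε : 0 < ε) :
    ∃ ρ : ℝ, 0 < ρ ∧ ∀ W : Pairs Ω, ‖W‖ ≤ ρ → potential H W ≤ ε * ‖W‖ ^ 2 := by
  obtain ⟨α, hα, K, hK, hT⟩ := exists_expInt_const h.isBounded h.measurableSet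
  have hβ := h.β_nonneg
  obtain ⟨t, ht0, ht⟩ := (toL2 Ω).bound
  -- Here `t` bounds the norm of the embedding into `L²`, so the quadratic part costs `ε/2 ‖W‖²`.
  -- The cubic part costs `c ‖W‖³`, at most `ε/2 ‖W‖²` for `‖W‖ ≤ ρ`.
  obtain ⟨M, hM, hbd⟩ := h.exists_le_sq_add_cube hSL (ε := ε / (2 * t ^ 2)) (by positivity)
  obtain ⟨c, hc⟩ : ∃ c, c = M * (1 + 8 / α ^ 2) * K.toReal := ⟨_, rfl⟩
  have hc0 : 0 ≤ c := by rw [hc]; positivity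
  obtain ⟨ρ, hρ, hρ1, hρ2⟩ : ∃ ρ : ℝ, 0 < ρ ∧ β * ρ ^ 2 ≤ α / 2 ∧ c * ρ ≤ ε / 2 := by
    refine ⟨min (√(α / (2 * (β + 1)))) (ε / (2 * (c + 1))), by positivity, ?_, ?_⟩
    · have h1 := pow_le_pow_left₀ (by positivity)
        (min_le_left (√(α / (2 * (β + 1)))) (ε / (2 * (c + 1)))) 2
      rw [Real.sq_sqrt (by positivity), le_div_iff₀ (by positivity)] at h1
      nlinarith [sq_nonneg (min (√(α / (2 * (β + 1)))) (ε / (2 * (c + 1))))]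
    · have h1 := min_le_right (√(α / (2 * (β + 1)))) (ε / (2 * (c + 1)))
      have h2 : 0 < min (√(α / (2 * (β + 1)))) (ε / (2 * (c + 1))) := by positivity
      rw [le_div_iff₀ (by positivity)] at h1
      nlinarith
  refine ⟨ρ, hρ, fun W hW => ?_⟩
  rcases (norm_nonneg W).eq_or_lt with h0 | hr
  · have h1 : W = 0 := norm_eq_zero.1 h0.symm
    have h3 : potential H W = 0 := h1 ▸ h.potential_zero
    rw [h3, ← h0]
    simp
  have hβr : β * ‖W‖ ^ 2 ≤ α / 2 :=
    (mul_le_mul_of_nonneg_left (pow_le_pow_left₀ hr.le hW 2) hβ).trans hρ1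
  refine (h.potential_le_of_norm_le hα hr (by positivity) hM hβr hbd hK
    (hT W _ _ hr le_rfl (div_mul_cancel₀ _ (by positivity)).le) (ht W)).trans
      (mul_le_mul_of_nonneg_right ?_ (sq_nonneg _))
  have h1 : ε / (2 * t ^ 2) * t ^ 2 = ε / 2 := by field_simp
  have h2 := mul_le_mul_of_nonneg_left hW hc0
  rw [h1, ← hc]
  linarith

/-- The gradient of the potential is bounded in `L²` on a small ball. -/
theorem exists_norm_nemytskii_le (h : IsControlled Ω H C β) :
    ∃ r : ℝ, 0 < r ∧ ∃ M : ℝ, ∀ W : Pairs Ω, ‖W‖ ≤ r → ‖h.nemytskii W‖ ≤ M := by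
  obtain ⟨α, hα, K, hK, hT⟩ := exists_expInt_const h.isBounded h.measurableSet
  have hβ := h.β_nonneg
  refine ⟨√(α / (2 * (β + 1))), by positivity, √(C ^ 2 * K.toReal), fun W hW => ?_⟩
  refine Real.le_sqrt_of_sq_le (h.norm_nemytskii_sq_le hK (hT W _ _ (by positivity) hW ?_))
  rw [Real.sq_sqrt (by positivity), mul_div_assoc', div_le_iff₀ (by positivity)]
  nlinarith

theorem superquadratic_potential (h : IsControlled Ω H C β) {Θ : ℝ} (hH3 : CondH3 Ω H Θ)
    (W : Pairs Ω) : 2 * Θ * potential H W ≤ ⟪h.nemytskii W, toL2 Ω W⟫ := by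
  rw [← h.potentialDeriv_apply, h.potentialDeriv_eq_integral, potential, ← integral_const_mul]
  refine setIntegral_mono_on ((h.integrable_potential W).const_mul _)
    (h.integrableOn_inner_grad W W) h.measurableSet fun x hx => ?_
  rcases eq_or_ne (pairVal W x) 0 with h0 | h0
  · rw [h0, h.eq_zero hx]; simp
  · exact (hH3 x hx _ h0).2

theorem potential_pos (h : IsControlled Ω H C β) {Θ : ℝ} (hH3 : CondH3 Ω H Θ)
    {W : Pairs Ω} (hW : ¬ (∀ᵐ x ∂(volume.restrict Ω), pairVal W x = 0)) : 0 < potential H W := by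
  refine lt_of_le_of_ne (h.potential_nonneg W) fun h0 => hW ?_
  have h1 : 0 ≤ᵐ[volume.restrict Ω] fun x => H x (pairVal W x) := by
    filter_upwards [ae_restrict_mem h.measurableSet] with x hx using h.nonneg x hx _
  have h2 := (integral_eq_zero_iff_of_nonneg_ae h1 (h.integrable_potential W)).1 h0.symm
  filter_upwards [h2, ae_restrict_mem h.measurableSet] with x hx hxΩ
  by_contra hne
  have h3 := (hH3 x hxΩ _ hne).1
  rw [hx] at h3
  simp at h3

end IsControlled

/-- The growth and superquadraticity hypotheses give the control used to build the energy. -/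
theorem exists_isControlled {Ω : Set Plane} {H : Plane → Plane → ℝ} {β₀ Θ : ℝ} (hΘ : 1 < Θ)
    (hΩb : Bornology.IsBounded Ω) (hΩm : MeasurableSet Ω) (hH : IsC1Potential Ω H) (hβ₀ : 0 < β₀)
    (hcrit : HasCriticalGrowth Ω (fun x W => ∇ (H x) W) β₀)
    (hnonneg : ∀ x ∈ Ω, ∀ W : Plane, 0 ≤ H x W) (hSL : CondSL Ω H) (hH3 : CondH3 Ω H Θ) :
    ∃ C, IsControlled Ω H C (2 * β₀) := by
  obtain ⟨R, hR⟩ := hcrit.1 (2 * β₀) (by linarith) 1 one_pos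
  obtain ⟨C₀, hC₀⟩ := hH.bounded_grad R
  -- Superlinearity says nothing at `W = 0` itself, so continuity is used: a positive value at `0`
  -- would keep `H` above half of it nearby, against `H ≤ (H x 0 / 2) |W|²`.
  have hzero : ∀ x ∈ Ω, H x 0 = 0 := by
    intro x hx
    by_contra hne
    have hpos : 0 < H x 0 := lt_of_le_of_ne (hnonneg x hx 0) (Ne.symm hne)
    have hc : ContinuousAt (H x) 0 := (hH.contDiff x hx).continuous.continuousAt
    obtain ⟨δ₁, hδ₁, h1⟩ := Metric.continuousAt_iff.1 hc (H x 0 / 2) (half_pos hpos)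
    obtain ⟨δ₂, hδ₂, h2⟩ := hSL (H x 0 / 2) (half_pos hpos)
    obtain ⟨s, hs0, hs⟩ := exists_between (lt_min (lt_min hδ₁ hδ₂) one_pos)
    obtain ⟨w, hw⟩ : ∃ w : Plane, ‖w‖ = s := ⟨EuclideanSpace.single 0 s, by
      simp [abs_of_pos hs0]⟩
    have hs1 : s < δ₁ := hs.trans_le ((min_le_left _ _).trans (min_le_left _ _))
    have hs2 : s < δ₂ := hs.trans_le ((min_le_left _ _).trans (min_le_right _ _))
    have hs3 : s < 1 := hs.trans_le (min_le_right _ _)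
    have h3 := h1 (x := w) (by simpa [hw] using hs1)
    have h4 := h2 x hx w (hw ▸ hs0) (hw ▸ hs2)
    rw [hw, div_lt_iff₀ (by positivity)] at h4
    rw [Real.dist_eq] at h3
    have h5 := (abs_lt.1 h3).1
    have h6 := le_abs_self (H x w)
    have h7 : s ^ 2 ≤ 1 := pow_le_one₀ hs0.le hs3.le
    nlinarith
  refine ⟨max C₀ 1, ⟨hΩb, hΩm, hH, by positivity, by positivity, fun x hx W => ?_, hnonneg,
    fun x hx W => ?_⟩⟩
  · rcases le_total R ‖W‖ with h | h
    · have h1 := hR x hx W h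
      rw [div_lt_one (Real.exp_pos _)] at h1
      exact h1.le.trans (le_mul_of_one_le_left (Real.exp_pos _).le (le_max_right _ _))
    · exact ((hC₀ x hx W h).trans (le_max_left _ 1)).trans
        (le_mul_of_one_le_right (by positivity) (Real.one_le_exp (by positivity)))
  · rcases eq_or_ne W 0 with rfl | hW
    · simp [hzero x hx]
    · have h1 := (hH3 x hx W hW).2.trans (real_inner_le_norm _ _)
      have h2 := hnonneg x hx W
      nlinarith

end PotentialEstimates

/-! ### The system -/

section System

variable {Ω : Set Plane}

/-- The gradient of the first component of a pair. -/
def gradFst (Ω : Set Plane) : Pairs Ω →L[ℝ] Lp Plane 2 (volume.restrict Ω) :=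
  (gradL Ω).comp (ContinuousLinearMap.fst ℝ _ _)

/-- The gradient of the second component of a pair. -/
def gradSnd (Ω : Set Plane) : Pairs Ω →L[ℝ] Lp Plane 2 (volume.restrict Ω) :=
  (gradL Ω).comp (ContinuousLinearMap.snd ℝ _ _)

theorem energy_eq (a₁ a₂ b₁ b₂ θ₁ θ₂ lam : ℝ) (H : Plane → Plane → ℝ) (W : Pairs Ω) :
    energy Ω a₁ a₂ b₁ b₂ θ₁ θ₂ lam H W =
      kirchhoffFunctional (gradFst Ω) (gradSnd Ω) (potential H) a₁ a₂ b₁ b₂ θ₁ θ₂ lam W := by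
  simp only [energy, gnorm_eq_norm]
  rfl

theorem norm_sq_le_add (W : Pairs Ω) : ‖W‖ ^ 2 ≤ ‖W.1‖ ^ 2 + ‖W.2‖ ^ 2 := by
  rw [Prod.norm_def]
  rcases max_cases ‖W.1‖ ‖W.2‖ with h | h <;> rw [h.1] <;>
    linarith [sq_nonneg ‖W.1‖, sq_nonneg ‖W.2‖]

theorem exists_coercivity_const (hΩb : Bornology.IsBounded Ω) (hΩm : MeasurableSet Ω)
    {a₁ a₂ : ℝ} (ha₁ : 0 < a₁) (ha₂ : 0 < a₂) :
    ∃ κ : ℝ, 0 < κ ∧ ∀ W : Pairs Ω,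
      κ * ‖W‖ ^ 2 ≤ a₁ * ‖gradFst Ω W‖ ^ 2 + a₂ * ‖gradSnd Ω W‖ ^ 2 := by
  obtain ⟨C, hC, hP⟩ := exists_poincare_const hΩb hΩm
  have hm : 0 < min a₁ a₂ := lt_min ha₁ ha₂
  refine ⟨min a₁ a₂ / C, by positivity, fun W => ?_⟩
  have h1 : ‖W.1‖ ^ 2 ≤ C * ‖gradFst Ω W‖ ^ 2 := hP W.1
  have h2 : ‖W.2‖ ^ 2 ≤ C * ‖gradSnd Ω W‖ ^ 2 := hP W.2
  calc min a₁ a₂ / C * ‖W‖ ^ 2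
      ≤ min a₁ a₂ / C * (C * ‖gradFst Ω W‖ ^ 2 + C * ‖gradSnd Ω W‖ ^ 2) :=
        mul_le_mul_of_nonneg_left ((norm_sq_le_add W).trans (add_le_add h1 h2)) (by positivity)
    _ = min a₁ a₂ * ‖gradFst Ω W‖ ^ 2 + min a₁ a₂ * ‖gradSnd Ω W‖ ^ 2 := by
        field_simp
    _ ≤ _ := add_le_add (mul_le_mul_of_nonneg_right (min_le_left _ _) (sq_nonneg _))
        (mul_le_mul_of_nonneg_right (min_le_right _ _) (sq_nonneg _))

theorem exists_pairs_nontrivial (hΩo : IsOpen Ω) (hΩne : Ω.Nonempty) :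
    ∃ e : Pairs Ω, ∀ t : ℝ, 0 < t → ¬ (∀ᵐ x ∂(volume.restrict Ω), pairVal (t • e) x = 0) := by
  obtain ⟨x₀, hx₀⟩ := hΩne
  obtain ⟨ε, hε, hball⟩ := Metric.isOpen_iff.1 hΩo x₀ hx₀
  let f : ContDiffBump x₀ := ⟨ε / 4, ε / 2, by positivity, by linarith⟩
  have hsub : Metric.closedBall x₀ (ε / 2) ⊆ Ω :=
    (Metric.closedBall_subset_ball (half_lt_self hε)).trans hball
  have hf : IsTestFunction Ω f := ⟨f.contDiff, f.hasCompactSupport, by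
    rw [f.tsupport_eq]; exact hsub⟩
  obtain ⟨u, hu, -⟩ := hf.exists_H10
  refine ⟨(u, 0), fun t ht h => ?_⟩
  have h1 : ∀ᵐ x ∂(volume.restrict Ω), f x = 0 := by
    filter_upwards [h, hu, pairVal_smul t ((u, 0) : Pairs Ω)] with x h1 h2 h3
    rw [h3, smul_eq_zero] at h1
    have h4 := norm_pairVal_sq ((u, 0) : Pairs Ω) x
    rw [h1.resolve_left ht.ne', norm_zero] at h4
    have h5 : val u x ^ 2 + val (0 : H10 Ω) x ^ 2 = 0 := by
      rw [← h4]; norm_num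
    rw [← h2]
    nlinarith [sq_nonneg (val u x), sq_nonneg (val (0 : H10 Ω) x)]
  rw [ae_restrict_iff' hΩo.measurableSet] at h1
  have h2 : volume (Metric.ball x₀ (ε / 2)) = 0 := by
    refine measure_mono_null (fun x hx => ?_) h1
    have h3 : x ∈ Function.support f := by rw [f.support_eq]; exact hx
    intro hc
    exact h3 (hc (hsub (Metric.ball_subset_closedBall hx)))
  exact (Metric.measure_ball_pos volume x₀ (half_pos hε)).ne' h2

variable {H : Plane → Plane → ℝ} {C β : ℝ} {a₁ a₂ b₁ b₂ θ₁ θ₂ lam : ℝ}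

theorem IsControlled.isKirchhoffSetting (h : IsControlled Ω H C β) {Θ κ : ℝ} (hΘ : 1 < Θ)
    (hH3 : CondH3 Ω H Θ) (hκ : 0 < κ) (hcoer : ∀ W : Pairs Ω,
      κ * ‖W‖ ^ 2 ≤ a₁ * ‖gradFst Ω W‖ ^ 2 + a₂ * ‖gradSnd Ω W‖ ^ 2) :
    IsKirchhoffSetting (gradFst Ω) (gradSnd Ω) (toL2 Ω) h.nemytskii (potential H) a₁ a₂ Θ κ where
  hasFDerivAt := h.hasFDerivAt_potential
  continuous_N := h.continuous_nemytskii
  κ_pos := hκ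
  one_lt := hΘ
  coercive := hcoer
  nonneg := h.potential_nonneg
  superquadratic := h.superquadratic_potential hH3
  compact _ _ hW := exists_subseq_cauchy_toL2 h.isBounded h.measurableSet hW

/-- Critical points of the energy are weak solutions. -/
theorem IsControlled.isWeakSolution (h : IsControlled Ω H C β) {W : Pairs Ω}
    (hW : kirchhoffFunctionalDeriv (gradFst Ω) (gradSnd Ω) (toL2 Ω) h.nemytskii a₁ a₂ b₁ b₂ θ₁ θ₂
      lam W = 0) : IsWeakSolution Ω a₁ a₂ b₁ b₂ θ₁ θ₂ lam H W := by
  refine fun Φ => ⟨h.integrableOn_inner_grad W Φ, ?_⟩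
  have h1 : dirichlet W.1 Φ.1 = ⟪gradFst Ω W, gradFst Ω Φ⟫ := dirichlet_eq_inner W.1 Φ.1
  have h2 : dirichlet W.2 Φ.2 = ⟪gradSnd Ω W, gradSnd Ω Φ⟫ := dirichlet_eq_inner W.2 Φ.2
  have h3 : gnorm W.1 = ‖gradFst Ω W‖ := gnorm_eq_norm W.1
  have h4 : gnorm W.2 = ‖gradSnd Ω W‖ := gnorm_eq_norm W.2
  have h5 := congrArg₂ (· * ·) (congrArg (fun s : ℝ => a₁ + b₁ * s ^ (2 * (θ₁ - 1))) h3) h1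
  have h6 := congrArg₂ (· * ·) (congrArg (fun s : ℝ => a₂ + b₂ * s ^ (2 * (θ₂ - 1))) h4) h2
  refine (congrArg₂ (· + ·) h5 h6).trans ?_
  exact (eq_of_kirchhoffFunctionalDeriv_eq_zero hW Φ).trans
    (congrArg (lam * ·) (h.potentialDeriv_eq_integral W Φ))

/-- A weak solution which vanishes almost everywhere has zero energy. -/
theorem IsControlled.not_ae_eq_zero (h : IsControlled Ω H C β) (ha₁ : 0 < a₁) (ha₂ : 0 < a₂)
    (hb₁ : 0 ≤ b₁) (hb₂ : 0 ≤ b₂) (hθ₁ : 1 < θ₁) (hθ₂ : 1 < θ₂) {W : Pairs Ω}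
    (hW : IsWeakSolution Ω a₁ a₂ b₁ b₂ θ₁ θ₂ lam H W)
    (hE : 0 < energy Ω a₁ a₂ b₁ b₂ θ₁ θ₂ lam H W) :
    ¬ (∀ᵐ x ∂(volume.restrict Ω), pairVal W x = 0) := by
  intro h0
  -- An element of `H¹₀` is a pair of function and gradient, so vanishing of the values does not at
  -- once make the gradients vanish. Testing the equation with `W` itself does, as `a₁, a₂ > 0`.
  have h1 := (hW W).2
  have h2 : ∫ x in Ω, ⟪pairVal W x, ∇ (H x) (pairVal W x)⟫ = 0 := by
    refine integral_eq_zero_of_ae ?_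
    filter_upwards [h0] with x hx
    rw [hx, inner_zero_left, Pi.zero_apply]
  have h3 : ∫ x in Ω, H x (pairVal W x) = 0 := by
    refine integral_eq_zero_of_ae ?_
    filter_upwards [h0, ae_restrict_mem h.measurableSet] with x hx hxΩ
    rw [hx]
    exact h.eq_zero hxΩ
  have hd : ∀ u : H10 Ω, dirichlet u u = gnorm u ^ 2 := fun u => by
    rw [dirichlet_eq_inner, gnorm_eq_norm, real_inner_self_eq_norm_sq]
  have hg : ∀ u : H10 Ω, 0 ≤ gnorm u := fun u => Real.sqrt_nonneg _
  rw [h2, mul_zero, hd, hd] at h1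
  have hc1 : 0 ≤ b₁ * gnorm W.1 ^ (2 * (θ₁ - 1)) := mul_nonneg hb₁ (Real.rpow_nonneg (hg _) _)
  have hc2 : 0 ≤ b₂ * gnorm W.2 ^ (2 * (θ₂ - 1)) := mul_nonneg hb₂ (Real.rpow_nonneg (hg _) _)
  have hs1 : 0 ≤ (a₁ + b₁ * gnorm W.1 ^ (2 * (θ₁ - 1))) * gnorm W.1 ^ 2 := by positivity
  have hs2 : 0 ≤ (a₂ + b₂ * gnorm W.2 ^ (2 * (θ₂ - 1))) * gnorm W.2 ^ 2 := by positivity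
  have hz1 : gnorm W.1 = 0 := by
    have := (mul_eq_zero.1 (show (a₁ + b₁ * gnorm W.1 ^ (2 * (θ₁ - 1))) * gnorm W.1 ^ 2 = 0 by
      linarith)).resolve_left (by positivity)
    exact pow_eq_zero_iff two_ne_zero |>.1 this
  have hz2 : gnorm W.2 = 0 := by
    have := (mul_eq_zero.1 (show (a₂ + b₂ * gnorm W.2 ^ (2 * (θ₂ - 1))) * gnorm W.2 ^ 2 = 0 by
      linarith)).resolve_left (by positivity)
    exact pow_eq_zero_iff two_ne_zero |>.1 this
  rw [energy, h3, hz1, hz2, Real.zero_rpow (by linarith), Real.zero_rpow (by linarith)] at hE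
  simp at hE

end System

end KirchhoffSystem

end

/-! ### Existence for large `lam`: assembly -/

open KirchhoffSystem in
theorem theorem1p2
    (Ω : Set Plane) (hΩ : IsSmoothBoundedDomain Ω)
    (a₁ a₂ b₁ b₂ θ₁ θ₂ : ℝ)
    (ha₁ : 0 < a₁) (ha₂ : 0 < a₂) (hb₁ : 0 < b₁) (hb₂ : 0 < b₂) (hθ₁ : 1 < θ₁) (hθ₂ : 1 < θ₂)
    (H : Plane → Plane → ℝ) (hH : IsC1Potential Ω H)
    (β₀ : ℝ) (hβ₀ : 0 < β₀) (hcrit : HasCriticalGrowth Ω (fun x W => ∇ (H x) W) β₀)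
    (hH1 : CondH1 Ω H) (hH2 : CondH2 Ω H) (hSL : CondSL Ω H) (hH3 : CondH3 Ω H (max θ₁ θ₂)) :
    ∃ lamStar : ℝ, 0 < lamStar ∧ ∀ lam : ℝ, lamStar ≤ lam →
      ∃ W : H10 Ω × H10 Ω,
        IsWeakSolution Ω a₁ a₂ b₁ b₂ θ₁ θ₂ lam H W ∧
        ¬ (∀ᵐ x ∂(volume.restrict Ω), pairVal W x = 0) ∧
        IntegrableOn (fun x => H x (pairVal W x)) Ω ∧
        0 < energy Ω a₁ a₂ b₁ b₂ θ₁ θ₂ lam H W := by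
  have hΘ : 1 < max θ₁ θ₂ := lt_max_of_lt_left hθ₁
  obtain ⟨C, h⟩ := exists_isControlled hΘ hΩ.isBounded hΩ.isOpen.measurableSet hH hβ₀ hcrit
    (fun x hx W => (hH1 x hx W).1) hSL hH3
  obtain ⟨κ, hκ, hcoer⟩ := exists_coercivity_const h.isBounded h.measurableSet ha₁ ha₂
  obtain ⟨r, hr, M, hM⟩ := h.exists_norm_nemytskii_le
  obtain ⟨e, he⟩ := exists_pairs_nontrivial hΩ.isOpen hΩ.isConnected.nonempty
  have hJe : ∀ t : ℝ, 0 < t → 0 < potential H (t • e) := fun t ht =>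
    h.potential_pos hH3 (he t ht)
  have he0 : e ≠ 0 := by
    rintro rfl
    have h1 := hJe 1 one_pos
    rw [smul_zero, h.potential_zero] at h1
    exact lt_irrefl _ h1
  obtain ⟨lamStar, hpos, hex⟩ := (h.isKirchhoffSetting hΘ hH3 hκ hcoer).exists_critical_pos
    hb₁.le hb₂.le hθ₁ hθ₂ (le_max_left _ _) (le_max_right _ _) hr hM
    (fun ε hε => h.exists_potential_le hSL hε) he0 hJe
  refine ⟨lamStar, hpos, fun lam hlam => ?_⟩
  obtain ⟨W, hW1, hW2⟩ := hex lam hlam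
  have hE : 0 < energy Ω a₁ a₂ b₁ b₂ θ₁ θ₂ lam H W := by
    rw [energy_eq]
    exact hW1
  have hweak := h.isWeakSolution hW2
  exact ⟨W, hweak, h.not_ae_eq_zero ha₁ ha₂ hb₁.le hb₂.le hθ₁ hθ₂ hweak hE,
    h.integrable_potential W, hE⟩
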